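/- **Setting.** Let $\Omega=(0,1)^2\times(-1,1)$, $\Gamma=(0,1)^2\times\{0\}$, $\Omega_+=(0,1)^2\times(0,1)$, $\Omega_-=(0,1)^2\times(-1,0)$. Let $\omega>0$, let $\mu,\varepsilon\in\mathbb C$ be constants and let $f_h,f_e\in L^2(\Omega,\mathbb C^3)$. Throughout, $u\cdot v=\sum_{k=1}^3u_kv_k$, without complex conjugation. For open $U\subset\mathbb R^3$ let $H(\operatorname{curl},U)$ be the space of $u\in L^2(U,\mathbb C^3)$ with distributional curl in $L^2(U,\mathbb C^3)$, and let $H_0(\operatorname{curl},U)$ be the space of those $u\in H(\operatorname{curl},U)$ with $\int_U u\cdot\operatorname{curl}\psi=\int_U\operatorname{curl}u\cdot\psi$ for all $\psi\in H(\operatorname{curl},U)$. Let $\eta\to0$ along a sequence of positive numbers. Let $z_0\in V=(0,1)^2$ and $R>0$ be such that the closed disc $\overline{B_R(z_0)}$ is contained in $V$, let $0<r_\eta\le R$, and let $I_\eta\subset(0,1)$ be open sets (the slits). The obstacle in the unit cell is the compact wire $\Sigma_Y^\eta=\overline{T_{r_\eta,I_\eta}}$, where $$T_{r,I}=\big((0,1)\setminus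 I\big)\times B_r(z_0)\subset\mathbb R\times\mathbb R^2 ,$$ and $$\Sigma_\eta=\bigcup_{k\in\mathbb Z^2}\eta\big[(k_1,k_2,0)+\Sigma_Y^\eta\big]\cap\Omega,\qquad \Omega_\eta=\Omega\setminus\Sigma_\eta .$$ Let $(E^\eta,H^\eta)\in L^2(\Omega_\eta,\mathbb C^3)^2$ be weak solutions of the time-harmonic Maxwell system with perfectly conducting boundary, that is, $$\int_{\Omega_\eta}E^\eta\cdot\operatorname{curl}\psi=\int_{\Omega_\eta}(i\omega\mu H^\eta+f_h)\cdot\psi\quad\text{for all }\psi\in H(\operatorname{curl},\Omega_\eta),$$ $$\int_{\Omega_\eta}H^\eta\cdot\operatorname{curl}\phi=\int_{\Omega_\eta}(-i\omega\varepsilon E^\eta+f_e)\cdot\phi\quad\text{for all }\phi\in H_0(\operatorname{curl},\Omega_\eta).$$ Assume that the extensions of $E^\eta$ and $H^\eta$ by zero to $\Omega$ converge weakly in $L^2(\Omega,\mathbb C^3)$ to $E^{\hom}$ and $H^{\hom}$, respectively. **Theorem 2.4 (Main result for wires).** Assume $$\eta\,|\ln r_\eta|\to0\qquad\text{and}\qquad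 \eta^{-1}r_\eta^{-2}|I_\eta|\to0 .$$ Then $(E^{\hom},H^{\hom})$ is a weak solution of the limit system $$\operatorname{curl}E^{\hom}=i\omega\mu H^{\hom}+f_h\ \text{ in }\Omega,\qquad \operatorname{curl}H^{\hom}=-i\omega\varepsilon E^{\hom}+f_e\ \text{ in }\Omega\setminus\Gamma,\qquad E^{\hom}\times\nu=0\ \text{ on }\partial\Omega,$$ with the polarizing interface conditions $E_1^{\hom}|_\Gamma=0$ and $[\![H_1^{\hom}]\!]_\Gamma=0$. By definition this means $$\int_{\Omega\setminus\Gamma}E^{\hom}\cdot\operatorname{curl}\psi=\int_{\Omega\setminus\Gamma}(i\omega\mu H^{\hom}+f_h)\cdot\psi\quad\text{for all }\psi\in Y_1,$$ $$\int_{\Omega}H^{\hom}\cdot\operatorname{curl}\phi=\int_{\Omega}(-i\omega\varepsilon E^{\hom}+f_e)\cdot\phi\quad\text{for all }\phi\in X_1,$$ where $X_1$ is the set of continuously differentiable $\phi:\Omega\to\mathbb C^3$ with bounded derivative, boundary values $\phi=0$ on $\partial\Omega$, and $\phi_1=0$ on $\Gamma$; and $Y_1$ is the set of $\psi:\Omega\to\mathbb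 C^3$ that are continuously differentiable with bounded derivative on $\Omega_+$ and on $\Omega_-$ and whose first component has no jump across $\Gamma$ (its traces on $\Gamma$ from $\Omega_+$ and from $\Omega_-$ coincide). -/

import Mathlib

open MeasureTheory Filter Topology

noncomputable section

namespace MaxwellWires

/-- Physical space `ℝ³` with the Euclidean norm. The coordinates `x₁, x₂, x₃` of the usual notation
are `x 0, x 1, x 2`. -/
abbrev R3 : Type := EuclideanSpace ℝ (Fin 3)

/-- The cross-section plane `ℝ²` with the Euclidean norm. -/
abbrev R2 : Type := EuclideanSpace ℝ (Fin 2)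

/-- The space `ℂ³` of field values. -/
abbrev C3 : Type := EuclideanSpace ℂ (Fin 3)

/-! ### Macroscopic geometry -/

/-- `Ω = (0,1)² × (-1,1)`. -/
def Omega : Set R3 :=
  {x | x 0 ∈ Set.Ioo (0 : ℝ) 1 ∧ x 1 ∈ Set.Ioo (0 : ℝ) 1 ∧ x 2 ∈ Set.Ioo (-1 : ℝ) 1}

/-- `Γ = (0,1)² × {0}`. -/
def Gam : Set R3 :=
  {x | x 0 ∈ Set.Ioo (0 : ℝ) 1 ∧ x 1 ∈ Set.Ioo (0 : ℝ) 1 ∧ x 2 = 0}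

/-- `Ω₊ = (0,1)² × (0,1)`. -/
def OmegaPlus : Set R3 :=
  {x | x 0 ∈ Set.Ioo (0 : ℝ) 1 ∧ x 1 ∈ Set.Ioo (0 : ℝ) 1 ∧ x 2 ∈ Set.Ioo (0 : ℝ) 1}

/-- `Ω₋ = (0,1)² × (-1,0)`. -/
def OmegaMinus : Set R3 :=
  {x | x 0 ∈ Set.Ioo (0 : ℝ) 1 ∧ x 1 ∈ Set.Ioo (0 : ℝ) 1 ∧ x 2 ∈ Set.Ioo (-1 : ℝ) 0}

/-! ### Microscopic geometry -/

/-- The cross section `V = (0,1)²` of the unit cell. -/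
def crossSection : Set R2 := {z | z 0 ∈ Set.Ioo (0 : ℝ) 1 ∧ z 1 ∈ Set.Ioo (0 : ℝ) 1}

/-- The wire with gaps, `T_{r,I} = ((0,1) \ I) × B_r(z₀)`: direction `e₁`, centre `z₀`, radius `r`,
gaps `I`. -/
def wire (z₀ : R2) (r : ℝ) (I : Set ℝ) : Set R3 :=
  {y | y 0 ∈ Set.Ioo (0 : ℝ) 1 \ I ∧ !₂[y 1, y 2] ∈ Metric.ball z₀ r}

/-- The compact obstacle generated by the wire `T_{r,I}`. -/
def wireObstacle (z₀ : R2) (r : ℝ) (I : Set ℝ) : Set R3 := closure (wire z₀ r I)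

/-- The periodic extension `Σ_# = ⋃_{k ∈ ℤ²} ((k₁, k₂, 0) + Σ_Y)` of an obstacle `Σ_Y`. -/
def periodicExt (S : Set R3) : Set R3 :=
  ⋃ k : ℤ × ℤ, (fun y : R3 => !₂[(k.1 : ℝ), (k.2 : ℝ), 0] + y) '' S

/-- The inclusion `Σ_η = η Σ_# ∩ Ω`. -/
def inclusion (η : ℝ) (S : Set R3) : Set R3 :=
  (fun y : R3 => η • y) '' periodicExt S ∩ Omega

/-- The perforated domain `Ω_η = Ω \ Σ_η`. -/
def perforated (η : ℝ) (S : Set R3) : Set R3 := Omega \ inclusion η S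

/-! ### Function spaces -/

/-- The bilinear (unconjugated) product `u · v = u₁ v₁ + u₂ v₂ + u₃ v₃` on `ℂ³`. -/
def cdot (u v : C3) : ℂ := ∑ i, u i * v i

/-- The partial derivative `∂_j u_i` at `x`. -/
def pd (j i : Fin 3) (u : R3 → C3) (x : R3) : ℂ :=
  fderiv ℝ u x (EuclideanSpace.single j (1 : ℝ)) i

/-- The classical curl. -/
def curl (u : R3 → C3) (x : R3) : C3 :=
  !₂[pd 1 2 u x - pd 2 1 u x, pd 2 0 u x - pd 0 2 u x, pd 0 1 u x - pd 1 0 u x]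

/-- `u ∈ L²(U, ℂ³)`. -/
def InL2 (U : Set R3) (u : R3 → C3) : Prop := MemLp u 2 (volume.restrict U)

/-- `u ∈ H(curl, U)` and `c` is the distributional curl of `u` on the open set `U`. -/
structure InHCurl (U : Set R3) (u c : R3 → C3) : Prop where
  memL2 : InL2 U u
  curl_memL2 : InL2 U c
  weak_curl : ∀ φ : R3 → C3, ContDiff ℝ (⊤ : ℕ∞) φ → HasCompactSupport φ → tsupport φ ⊆ U →
    ∫ x in U, cdot (u x) (curl φ x) = ∫ x in U, cdot (c x) (φ x)

/-- `u ∈ H₀(curl, U)` and `c` is the distributional curl of `u` on the open set `U`. -/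
structure InHCurlZero (U : Set R3) (u c : R3 → C3) : Prop extends InHCurl U u c where
  pairing : ∀ ψ d : R3 → C3, InHCurl U ψ d →
    ∫ x in U, cdot (u x) (d x) = ∫ x in U, cdot (c x) (ψ x)

/-- Weak convergence `u_n ⇀ u` in `L²(U, ℂ³)`. (Testing with the bilinear product is the same as
testing with the inner product, since `L²` is invariant under conjugation.) -/
structure WeakConvL2 (U : Set R3) (u : ℕ → R3 → C3) (u' : R3 → C3) : Prop where
  memL2 : ∀ n, InL2 U (u n)
  limit_memL2 : InL2 U u'
  tendsto : ∀ g : R3 → C3, InL2 U g →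
    Tendsto (fun n => ∫ x in U, cdot (u n x) (g x)) atTop (𝓝 (∫ x in U, cdot (u' x) (g x)))

/-! ### The time-harmonic Maxwell system in a perforated domain -/

/-- `(E, H) ∈ L²(U, ℂ³) × L²(U, ℂ³)` is a weak solution on `U` of
`curl E = i ω μ H + f_h`, `curl H = - i ω ε E + f_e`, with `E × ν = 0` on `∂U`. -/
structure IsMaxwellSolution (U : Set R3) (ω : ℝ) (μ ε : ℂ) (fh fe E H : R3 → C3) : Prop where
  E_memL2 : InL2 U E
  H_memL2 : InL2 U H
  eq_E : ∀ ψ d : R3 → C3, InHCurl U ψ d →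
    ∫ x in U, cdot (E x) (d x) =
      ∫ x in U, cdot ((Complex.I * ω * μ) • H x + fh x) (ψ x)
  eq_H : ∀ φ d : R3 → C3, InHCurlZero U φ d →
    ∫ x in U, cdot (H x) (d x) =
      ∫ x in U, cdot (-(Complex.I * ω * ε) • E x + fe x) (φ x)

/-! ### The limit system -/

/-- `u` is continuously differentiable on the open set `U` with bounded derivative. -/
structure IsC1Bdd (U : Set R3) (u : R3 → C3) : Prop where
  contDiffOn : ContDiffOn ℝ 1 u U
  bdd : ∃ C : ℝ, ∀ x ∈ U, ‖fderiv ℝ u x‖ ≤ C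

/-- The test space `X_- = C¹₀(Ω̄, ℂ³)`: `C¹` with bounded derivative in `Ω`, boundary values `0`. -/
structure MemXMinus (φ : R3 → C3) : Prop where
  isC1 : IsC1Bdd Omega φ
  boundary : ∀ x ∈ frontier Omega, Tendsto φ (𝓝[Omega] x) (𝓝 0)

/-- The test space `X_i = {φ ∈ X_- | φ_i = 0 on Γ}`. -/
structure MemX (i : Fin 3) (φ : R3 → C3) : Prop extends MemXMinus φ where
  interface : ∀ x ∈ Gam, φ x i = 0

/-- The test space `Y_-`: `C¹` with bounded derivative on each side of `Γ`, with no condition on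
`∂Ω` nor on `Γ`. -/
structure MemYMinus (ψ : R3 → C3) : Prop where
  isC1_plus : IsC1Bdd OmegaPlus ψ
  isC1_minus : IsC1Bdd OmegaMinus ψ

/-- The test space `Y_i = {ψ ∈ Y_- | ⟦ψ_i⟧_Γ = 0}`: on `Γ`, the traces of `ψ_i` from above and from
below coincide. -/
structure MemY (i : Fin 3) (ψ : R3 → C3) : Prop extends MemYMinus ψ where
  no_jump : ∀ x ∈ Gam, ∃ c : ℂ, Tendsto (fun y => ψ y i) (𝓝[OmegaPlus] x) (𝓝 c) ∧
    Tendsto (fun y => ψ y i) (𝓝[OmegaMinus] x) (𝓝 c)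

/-- `(E, H)` is a weak solution of the limit system with test functions `φ ∈ X` in the `H`-equation
and `ψ ∈ Y` in the `E`-equation. -/
structure IsLimitSolution (X Y : (R3 → C3) → Prop) (ω : ℝ) (μ ε : ℂ)
    (fh fe E H : R3 → C3) : Prop where
  E_memL2 : InL2 Omega E
  H_memL2 : InL2 Omega H
  eq_E : ∀ ψ : R3 → C3, Y ψ →
    ∫ x in Omega \ Gam, cdot (E x) (curl ψ x) =
      ∫ x in Omega \ Gam, cdot ((Complex.I * ω * μ) • H x + fh x) (ψ x)
  eq_H : ∀ φ : R3 → C3, X φ →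
    ∫ x in Omega, cdot (H x) (curl φ x) =
      ∫ x in Omega, cdot (-(Complex.I * ω * ε) • E x + fe x) (φ x)

/-- Weak solution of the limit system with the polarizing interface condition
`E_i = 0` on `Γ` and `⟦H_i⟧_Γ = 0`, for a tangential direction `e_i`, `i ∈ {0, 1}`. -/
def IsPolarizingSolution (i : Fin 3) (ω : ℝ) (μ ε : ℂ) (fh fe E H : R3 → C3) : Prop :=
  IsLimitSolution (MemX i) (MemY i) ω μ ε fh fe E H

end MaxwellWires

end

/-!
The limit equations are obtained by weak–strong convergence: if `(ψ_η, curl ψ_η)` are admissible in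
the perforated domain `Ω_η` and their extensions by zero converge strongly in `L²(Ω)` to
`(ψ, curl ψ)`, then every term of the corresponding Maxwell equation passes to the limit
(`integral_eq_of_strong_test_fields`). So it suffices to correct each macroscopic test field in a
layer of thickness `O(η)` around `Γ`, and to see that the correction has vanishing energy. All
corrected fields are bounded and Lipschitz. By Rademacher's theorem their classical curl is the
distributional one (`inHCurl_of_bddLip`), and a Lipschitz field that vanishes outside a bounded
measurable set `U` lies in `H₀(curl, U)`, whatever the regularity of `U`: truncate its small values
and mollify (`inHCurlZero_of_bddLip`).

*Magnetic equation* (`exists_magnetic_test_fields`). The test field must vanish on the wires. The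
normal component and the component along the wires are cut off across the layer. The derivative of
the cut-off in the normal direction is of order `1/η`, but it only meets the first component, which
is `O(η)` in the layer since `φ₁ = 0` on `Γ`. The transversal tangential field `φ₂ e₂` is replaced
by `φ₂ q`, where `q` is the gradient of a potential that is constant in the wires and equals `y₂`
away from the layer; `q` is curl-free, so no factor `1/η` appears. Fields and curls are bounded on a
set of measure `O(η)`.

*Electric equation* (`exists_electric_test_fields`). The second and third components may jump across
`Γ`. The jump of the normal component is smeared out by a step in `x₃`, and the curl contains no
`x₃`-derivative of the third component. For the second component, `e₂` above and `0` below the layer are joined by a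
field that is curl-free outside of the wires and winds around each of them with circulation `η`
(`ae_curl_winding`). It decays like the inverse distance from the wire, so its energy per cell is of
order `η² |log r|`, in total `η |log r|` (`lintegral_energyDensity_le`). Its curl, of size
`1 / (η r²)`, is hidden inside the wires except over the gaps, where it contributes
`(η r²)⁻² · η r² |I| = η⁻¹ r⁻² |I|` (`norm_curl_winding_le`, `volume_gapSet_le`). The two hypotheses
on `r` and `I` say that these two quantities vanish in the limit
(`strongConvL2_of_winding_bound`).

The winding field is explicit: with microscopic coordinates `(s, t)` relative to the wire and
`m = max |s| |t|`, it is `(step t, 0) + g(m) (t, -s)` with `g(m) = (m⁻² - 4) / 8` between the core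
and the cell boundary. By Euler's identity for the homogeneous function `m⁻²`, the curl of the second
summand there is the constant that cancels the slope of the step.
-/

open scoped ENNReal

noncomputable section

namespace MaxwellWires

/-! ### Lipschitz functions and their partial derivatives -/

/-- The product of Lipschitz maps is Lipschitz if `g` is bounded and `f` is bounded where `g` does
not vanish. -/
theorem exists_lipschitzWith_smul {X 𝕜 E : Type*} [PseudoMetricSpace X] [NormedField 𝕜]
    [NormedAddCommGroup E] [NormedSpace 𝕜 E] {f : X → 𝕜} {g : X → E} {K L : NNReal} {A B : ℝ}
    (hf : LipschitzWith K f) (hg : LipschitzWith L g) (hA : ∀ x, g x ≠ 0 → ‖f x‖ ≤ A)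
    (hB : ∀ x, ‖g x‖ ≤ B) : ∃ M, LipschitzWith M (fun x => f x • g x) := by
  have key : ∀ x y, g x ≠ 0 →
      ‖f x • g x - f y • g y‖ ≤ (|A| * L + K * |B|) * dist x y := by
    intro x y hx
    have e : f x • g x - f y • g y = f x • (g x - g y) + (f x - f y) • g y := by
      rw [smul_sub, sub_smul]; abel
    have h1 : ‖g x - g y‖ ≤ L * dist x y := by
      rw [← dist_eq_norm]; exact hg.dist_le_mul x y
    have h2 : ‖f x - f y‖ ≤ K * dist x y := by
      rw [← dist_eq_norm]; exact hf.dist_le_mul x y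
    have h3 : ‖f x‖ ≤ |A| := (hA x hx).trans (le_abs_self A)
    have h4 : ‖g y‖ ≤ |B| := (hB y).trans (le_abs_self B)
    calc ‖f x • g x - f y • g y‖ ≤ ‖f x‖ * ‖g x - g y‖ + ‖f x - f y‖ * ‖g y‖ := by
          rw [e]; exact (norm_add_le _ _).trans (by rw [norm_smul, norm_smul])
      _ ≤ |A| * (L * dist x y) + (K * dist x y) * |B| := by gcongr
      _ = _ := by ring
  refine ⟨⟨|A| * L + K * |B|, by positivity⟩, LipschitzWith.of_dist_le_mul fun x y => ?_⟩
  rw [dist_eq_norm]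
  change _ ≤ (|A| * L + K * |B|) * dist x y
  by_cases hx : g x = 0
  · by_cases hy : g y = 0
    · rw [hx, hy]; simp; positivity
    · rw [← norm_neg, neg_sub, dist_comm]; exact key y x hy
  · exact key x y hx

/-- Bounded Lipschitz maps. All corrected test fields are built inside this class, which is closed
under sums and products; by Rademacher's theorem their distributional derivatives are the classical
ones. -/
structure BddLip {X E : Type*} [PseudoMetricSpace X] [NormedAddCommGroup E] (f : X → E) : Prop where
  lip : ∃ K, LipschitzWith K f
  bdd : ∃ B, ∀ x, ‖f x‖ ≤ B

namespace BddLip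

variable {X 𝕜 E : Type*} [PseudoMetricSpace X] [NormedField 𝕜]
    [NormedAddCommGroup E] [NormedSpace 𝕜 E]

theorem const (c : E) : BddLip (fun _ : X => c) :=
  ⟨⟨0, LipschitzWith.const c⟩, ‖c‖, fun _ => le_rfl⟩

theorem add {f g : X → E} (hf : BddLip f) (hg : BddLip g) : BddLip (fun x => f x + g x) := by
  obtain ⟨⟨K, hK⟩, A, hA⟩ := hf
  obtain ⟨⟨L, hL⟩, B, hB⟩ := hg
  exact ⟨⟨K + L, hK.add hL⟩, A + B, fun x => (norm_add_le _ _).trans (add_le_add (hA x) (hB x))⟩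

theorem neg {f : X → E} (hf : BddLip f) : BddLip (fun x => - f x) := by
  obtain ⟨⟨K, hK⟩, A, hA⟩ := hf
  exact ⟨⟨K, hK.neg⟩, A, fun x => by rw [norm_neg]; exact hA x⟩

theorem sub {f g : X → E} (hf : BddLip f) (hg : BddLip g) : BddLip (fun x => f x - g x) := by
  simpa [sub_eq_add_neg] using hf.add hg.neg

theorem smul {f : X → 𝕜} {g : X → E} (hf : BddLip f) (hg : BddLip g) :
    BddLip (fun x => f x • g x) := by
  obtain ⟨⟨K, hK⟩, A, hA⟩ := hf
  obtain ⟨⟨L, hL⟩, B, hB⟩ := hg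
  refine ⟨exists_lipschitzWith_smul hK hL (fun x _ => hA x) hB, |A| * |B|, fun x => ?_⟩
  rw [norm_smul]
  exact mul_le_mul ((hA x).trans (le_abs_self A)) ((hB x).trans (le_abs_self B)) (norm_nonneg _)
    (abs_nonneg _)

theorem mul {f g : X → 𝕜} (hf : BddLip f) (hg : BddLip g) : BddLip (fun x => f x * g x) :=
  hf.smul hg

theorem sum {ι : Type*} (s : Finset ι) {f : ι → X → E} (hf : ∀ i, BddLip (f i)) :
    BddLip (fun x => ∑ i ∈ s, f i x) := by
  classical
  induction s using Finset.induction_on with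
  | empty => simpa using const (X := X) (0 : E)
  | insert a s ha ih => simpa [Finset.sum_insert ha] using (hf a).add ih

theorem comp {Y : Type*} [PseudoMetricSpace Y] {f : Y → E} (hf : BddLip f) {g : X → Y}
    {L : NNReal} (hg : LipschitzWith L g) : BddLip (fun x => f (g x)) := by
  obtain ⟨⟨K, hK⟩, A, hA⟩ := hf
  exact ⟨⟨K * L, hK.comp hg⟩, A, fun x => hA _⟩

theorem clm {F : Type*} [NormedAddCommGroup F] [NormedSpace ℝ E] [NormedSpace ℝ F]
    {f : X → E} (hf : BddLip f) (T : E →L[ℝ] F) : BddLip (fun x => T (f x)) := by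
  obtain ⟨⟨K, hK⟩, A, hA⟩ := hf
  exact ⟨⟨_, T.lipschitz.comp hK⟩, ‖T‖ * A, fun x => T.le_opNorm_of_le (hA x)⟩

theorem ofReal {f : X → ℝ} (hf : BddLip f) : BddLip (fun x => (f x : ℂ)) :=
  hf.clm Complex.ofRealCLM

theorem continuous {f : X → E} (hf : BddLip f) : Continuous f :=
  let ⟨_, hK⟩ := hf.lip
  hK.continuous

end BddLip

/-- The coordinate projection `ℂ³ → ℂ` as a real-linear map. -/
def coordC (i : Fin 3) : C3 →L[ℝ] ℂ :=
  (EuclideanSpace.proj i : C3 →L[ℂ] ℂ).restrictScalars ℝ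

/-- The coordinate projection `ℝ³ → ℝ`. -/
def coordR (i : Fin 3) : R3 →L[ℝ] ℝ := EuclideanSpace.proj i

@[simp] theorem coordR_apply (i : Fin 3) (v : R3) : coordR i v = v i := rfl

/-- The basis vector `e_j` of `ℝ³`. -/
abbrev e3 (j : Fin 3) : R3 := EuclideanSpace.single j (1 : ℝ)

/-- The partial derivative `∂_j f` of a scalar function. -/
def partialD (j : Fin 3) (f : R3 → ℂ) (x : R3) : ℂ := fderiv ℝ f x (e3 j)

theorem norm_C3_le (v : C3) : ‖v‖ ≤ ‖v 0‖ + ‖v 1‖ + ‖v 2‖ := by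
  rw [EuclideanSpace.norm_eq, Fin.sum_univ_three]
  apply Real.sqrt_le_iff.2
  have := norm_nonneg (v 0); have := norm_nonneg (v 1); have := norm_nonneg (v 2)
  constructor
  · positivity
  · nlinarith [mul_nonneg (norm_nonneg (v 0)) (norm_nonneg (v 1)),
      mul_nonneg (norm_nonneg (v 0)) (norm_nonneg (v 2)),
      mul_nonneg (norm_nonneg (v 1)) (norm_nonneg (v 2))]

theorem norm_coord_le (v : C3) (i : Fin 3) : ‖v i‖ ≤ ‖v‖ := PiLp.norm_apply_le v i

theorem norm_cdot_le (u v : C3) : ‖cdot u v‖ ≤ ‖u‖ * ‖v‖ := by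
  have h : cdot u v = inner ℂ (WithLp.toLp 2 (fun i => star (u i)) : C3) v := by
    simp [cdot, PiLp.inner_apply, mul_comm]
  have h2 : ‖(WithLp.toLp 2 (fun i => star (u i)) : C3)‖ = ‖u‖ := by
    simp [EuclideanSpace.norm_eq]
  rw [h, ← h2]
  exact norm_inner_le_norm _ _

theorem pd_eq_partialD {u : R3 → C3} {x : R3} (hu : DifferentiableAt ℝ u x) (j i : Fin 3) :
    pd j i u x = partialD j (fun y => u y i) x := by
  have h : HasFDerivAt (fun y => u y i) ((coordC i).comp (fderiv ℝ u x)) x :=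
    (coordC i).hasFDerivAt.comp x hu.hasFDerivAt
  rw [partialD, h.fderiv]; rfl

theorem norm_pd_le (j i : Fin 3) (u : R3 → C3) (x : R3) : ‖pd j i u x‖ ≤ ‖fderiv ℝ u x‖ := by
  refine (norm_coord_le _ i).trans ?_
  simpa using (fderiv ℝ u x).le_opNorm (e3 j)

theorem norm_partialD_le (j : Fin 3) (f : R3 → ℂ) (x : R3) :
    ‖partialD j f x‖ ≤ ‖fderiv ℝ f x‖ := by
  rw [partialD]
  simpa using (fderiv ℝ f x).le_opNorm (e3 j)

theorem norm_partialD_le_of_lipschitz {f : R3 → ℂ} {K : NNReal} (hf : LipschitzWith K f)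
    (j : Fin 3) (x : R3) : ‖partialD j f x‖ ≤ K :=
  (norm_partialD_le j f x).trans (norm_fderiv_le_of_lipschitz ℝ hf)

theorem norm_curl_le (u : R3 → C3) (x : R3) : ‖curl u x‖ ≤ 6 * ‖fderiv ℝ u x‖ := by
  have h := fun j i => norm_pd_le j i u x
  have h0 : ‖curl u x 0‖ ≤ 2 * ‖fderiv ℝ u x‖ :=
    (norm_sub_le _ _).trans (by linarith [h 1 2, h 2 1])
  have h1 : ‖curl u x 1‖ ≤ 2 * ‖fderiv ℝ u x‖ :=
    (norm_sub_le _ _).trans (by linarith [h 2 0, h 0 2])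
  have h2 : ‖curl u x 2‖ ≤ 2 * ‖fderiv ℝ u x‖ :=
    (norm_sub_le _ _).trans (by linarith [h 0 1, h 1 0])
  exact (norm_C3_le _).trans (by linarith)

theorem norm_curl_le_of_lipschitz {u : R3 → C3} {K : NNReal} (hu : LipschitzWith K u) (x : R3) :
    ‖curl u x‖ ≤ 6 * K :=
  (norm_curl_le u x).trans (by gcongr; exact norm_fderiv_le_of_lipschitz ℝ hu)

theorem measurable_C3 {α : Type*} [MeasurableSpace α] {f g h : α → ℂ} (hf : Measurable f)
    (hg : Measurable g) (hh : Measurable h) : Measurable (fun x => (!₂[f x, g x, h x] : C3)) := by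
  refine (WithLp.measurable_toLp 2 _).comp (measurable_pi_iff.2 fun i => ?_)
  fin_cases i <;> assumption

theorem measurable_pd (j i : Fin 3) (u : R3 → C3) : Measurable (pd j i u) :=
  (coordC i).continuous.measurable.comp ((measurable_fderiv ℝ u).apply_continuousLinearMap (e3 j))

theorem measurable_partialD (j : Fin 3) (f : R3 → ℂ) : Measurable (partialD j f) :=
  (measurable_fderiv ℝ f).apply_continuousLinearMap (e3 j)

theorem measurable_curl (u : R3 → C3) : Measurable (curl u) :=
  measurable_C3 ((measurable_pd _ _ u).sub (measurable_pd _ _ u))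
    ((measurable_pd _ _ u).sub (measurable_pd _ _ u))
    ((measurable_pd _ _ u).sub (measurable_pd _ _ u))

theorem partialD_mul {f g : R3 → ℂ} {x : R3} (hf : DifferentiableAt ℝ f x)
    (hg : DifferentiableAt ℝ g x) (j : Fin 3) :
    partialD j (fun y => f y * g y) x = f x * partialD j g x + partialD j f x * g x := by
  rw [partialD, fderiv_fun_mul hf hg]; simp [partialD]; ring

theorem partialD_congr {f g : R3 → ℂ} {x : R3} (h : f =ᶠ[𝓝 x] g) (j : Fin 3) :
    partialD j f x = partialD j g x := by
  rw [partialD, partialD, h.fderiv_eq]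

theorem curl_congr {f g : R3 → C3} {x : R3} (h : f =ᶠ[𝓝 x] g) : curl f x = curl g x := by
  simp only [curl, pd, h.fderiv_eq]

theorem integral_partialD_eq_zero {f : R3 → ℂ} {K : NNReal} (hf : LipschitzWith K f)
    (hc : HasCompactSupport f) (j : Fin 3) : ∫ x, partialD j f x = 0 := by
  have real : ∀ T : ℂ →L[ℝ] ℝ, ∫ x, T (partialD j f x) = 0 := by
    intro T
    have hl : LipschitzWith (‖T‖₊ * K) (fun x => T (f x)) := T.lipschitz.comp hf
    have h1 := LipschitzWith.integral_lineDeriv_mul_eq (μ := (volume : Measure R3))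
      (LipschitzWith.const (α := R3) (1 : ℝ)) hl (hc.comp_left (map_zero T)) (-(e3 j))
    have h0 : ∀ x : R3, lineDeriv ℝ (fun _ : R3 => (1 : ℝ)) x (-(e3 j)) = 0 := fun x => by
      simp [lineDeriv]
    simp only [h0, zero_mul, integral_zero, mul_one, neg_neg] at h1
    rw [h1]
    refine integral_congr_ae ?_
    filter_upwards [hf.ae_differentiableAt (μ := (volume : Measure R3))] with x hx
    have hd : HasFDerivAt (fun y => T (f y)) (T.comp (fderiv ℝ f x)) x :=
      T.hasFDerivAt.comp x hx.hasFDerivAt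
    rw [hd.differentiableAt.lineDeriv_eq_fderiv, hd.fderiv]; rfl
  have hint : Integrable (partialD j f) := by
    refine Measure.integrableOn_of_bounded (s := tsupport f) (M := K) hc.measure_lt_top.ne
      (measurable_partialD j f).aestronglyMeasurable
      (ae_of_all _ fun x => norm_partialD_le_of_lipschitz hf j x)
      |>.integrable_of_forall_notMem_eq_zero ?_
    intro x hx
    have : f =ᶠ[𝓝 x] fun _ => 0 := notMem_tsupport_iff_eventuallyEq.1 hx
    rw [partialD, this.fderiv_eq]; simp
  have hre := real Complex.reCLM
  have him := real Complex.imCLM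
  rw [Complex.reCLM.integral_comp_comm hint] at hre
  rw [Complex.imCLM.integral_comp_comm hint] at him
  exact Complex.ext hre him

theorem lipschitz_coord {u : R3 → C3} {K : NNReal} (hu : LipschitzWith K u) (i : Fin 3) :
    ∃ L, LipschitzWith L (fun x => u x i) :=
  ⟨_, (coordC i).lipschitz.comp hu⟩

theorem lipschitz_mul_of_hasCompactSupport {f g : R3 → ℂ} {K L : NNReal} (hf : LipschitzWith K f)
    (hg : LipschitzWith L g) (hc : HasCompactSupport g) :
    ∃ M, LipschitzWith M (fun x => f x * g x) := by
  obtain ⟨A, hA⟩ := hc.isCompact.exists_bound_of_continuousOn hf.continuous.continuousOn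
  obtain ⟨B, hB⟩ := hc.exists_bound_of_continuous hg.continuous
  exact exists_lipschitzWith_smul hf hg (fun x hx => hA x (subset_tsupport _ hx)) hB

theorem cdot_expand (u v : C3) : cdot u v = u 0 * v 0 + u 1 * v 1 + u 2 * v 2 := by
  rw [cdot, Fin.sum_univ_three]

theorem continuous_cdot : Continuous (fun p : C3 × C3 => cdot p.1 p.2) := by
  unfold cdot; fun_prop

theorem measurable_cdot {α : Type*} [MeasurableSpace α] {f g : α → C3} (hf : Measurable f)
    (hg : Measurable g) : Measurable (fun x => cdot (f x) (g x)) :=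
  continuous_cdot.measurable.comp (hf.prodMk hg)

theorem aestronglyMeasurable_cdot {α : Type*} [MeasurableSpace α] {m : Measure α} {f g : α → C3}
    (hf : AEStronglyMeasurable f m) (hg : AEStronglyMeasurable g m) :
    AEStronglyMeasurable (fun x => cdot (f x) (g x)) m :=
  Continuous.comp_aestronglyMeasurable₂ (g := cdot) continuous_cdot hf hg

theorem integrable_of_bounded_of_zero {E : Type*} [NormedAddCommGroup E] {f : R3 → E} {S : Set R3}
    (hS : volume S ≠ ⊤) (hf : AEStronglyMeasurable f) {M : ℝ} (hM : ∀ x ∈ S, ‖f x‖ ≤ M)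
    (h0 : ∀ x, x ∉ S → f x = 0) : Integrable f := by
  refine (Measure.integrableOn_of_bounded (s := toMeasurable volume S) (M := |M|)
    (by rwa [measure_toMeasurable]) hf
      (ae_of_all _ fun x => ?_)).integrable_of_forall_notMem_eq_zero
      (fun x hx => h0 x fun h => hx (subset_toMeasurable _ _ h))
  by_cases hx : x ∈ S
  · exact (hM x hx).trans (le_abs_self M)
  · rw [h0 x hx, norm_zero]; exact abs_nonneg M

theorem integral_alternating_eq_zero {p₁ p₂ p₃ p₄ p₅ p₆ : R3 → ℂ} (h₁ : Integrable p₁)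
    (h₂ : Integrable p₂) (h₃ : Integrable p₃) (h₄ : Integrable p₄) (h₅ : Integrable p₅)
    (h₆ : Integrable p₆) (z₁ : ∫ x, p₁ x = 0) (z₂ : ∫ x, p₂ x = 0) (z₃ : ∫ x, p₃ x = 0)
    (z₄ : ∫ x, p₄ x = 0) (z₅ : ∫ x, p₅ x = 0) (z₆ : ∫ x, p₆ x = 0) :
    ∫ x, (p₁ x - p₂ x + p₃ x - p₄ x + p₅ x - p₆ x) = 0 := by
  have a₁ : Integrable (fun x => p₁ x - p₂ x) := h₁.sub h₂
  have a₂ : Integrable (fun x => p₁ x - p₂ x + p₃ x) := a₁.add h₃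
  have a₃ : Integrable (fun x => p₁ x - p₂ x + p₃ x - p₄ x) := a₂.sub h₄
  have a₄ : Integrable (fun x => p₁ x - p₂ x + p₃ x - p₄ x + p₅ x) := a₃.add h₅
  rw [integral_sub a₄ h₆, integral_add a₃ h₅, integral_sub a₂ h₄, integral_add a₁ h₃,
    integral_sub h₁ h₂, z₁, z₂, z₃, z₄, z₅, z₆]
  simp

theorem curl_apply_zero (u : R3 → C3) (x : R3) : curl u x 0 = pd 1 2 u x - pd 2 1 u x := rfl
theorem curl_apply_one (u : R3 → C3) (x : R3) : curl u x 1 = pd 2 0 u x - pd 0 2 u x := rfl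
theorem curl_apply_two (u : R3 → C3) (x : R3) : curl u x 2 = pd 0 1 u x - pd 1 0 u x := rfl

theorem differentiableAt_coord {u : R3 → C3} {x : R3} (hu : DifferentiableAt ℝ u x) (i : Fin 3) :
    DifferentiableAt ℝ (fun y => u y i) x :=
  ((coordC i).hasFDerivAt.comp x hu.hasFDerivAt).differentiableAt

/-- `u · curl φ - curl u · φ` is the divergence of `φ × u`. -/
theorem cdot_curl_sub {u φ : R3 → C3} {x : R3} (hu : DifferentiableAt ℝ u x)
    (hφ : DifferentiableAt ℝ φ x) :
    cdot (u x) (curl φ x) - cdot (curl u x) (φ x) =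
      partialD 1 (fun x => u x 0 * φ x 2) x - partialD 2 (fun x => u x 0 * φ x 1) x
      + partialD 2 (fun x => u x 1 * φ x 0) x - partialD 0 (fun x => u x 1 * φ x 2) x
      + partialD 0 (fun x => u x 2 * φ x 1) x - partialD 1 (fun x => u x 2 * φ x 0) x := by
  have c1 := differentiableAt_coord hu
  have c2 := differentiableAt_coord hφ
  rw [partialD_mul (c1 0) (c2 2), partialD_mul (c1 0) (c2 1), partialD_mul (c1 1) (c2 0),
    partialD_mul (c1 1) (c2 2), partialD_mul (c1 2) (c2 1), partialD_mul (c1 2) (c2 0)]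
  simp only [cdot_expand, curl_apply_zero, curl_apply_one, curl_apply_two, pd_eq_partialD hu,
    pd_eq_partialD hφ]
  ring

/-- The classical curl of a Lipschitz field is its distributional curl. -/
theorem integral_cdot_curl {u φ : R3 → C3} {K L : NNReal} (hu : LipschitzWith K u)
    (hφ : LipschitzWith L φ) (hc : HasCompactSupport φ) :
    ∫ x, cdot (u x) (curl φ x) = ∫ x, cdot (curl u x) (φ x) := by
  obtain ⟨A, hA⟩ := hc.isCompact.exists_bound_of_continuousOn hu.continuous.continuousOn
  obtain ⟨B, hB⟩ := hc.exists_bound_of_continuous hφ.continuous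
  have hz : ∀ x, x ∉ tsupport φ → curl φ x = 0 := fun x hx => by
    have : φ =ᶠ[𝓝 x] fun _ => 0 := notMem_tsupport_iff_eventuallyEq.1 hx
    rw [curl_congr this]
    ext i; fin_cases i <;> simp [curl, pd]
  have i1 : Integrable (fun x => cdot (u x) (curl φ x)) := by
    refine integrable_of_bounded_of_zero (S := tsupport φ) (M := |A| * (6 * L))
      hc.isCompact.measure_lt_top.ne
      (measurable_cdot hu.continuous.measurable (measurable_curl φ)).aestronglyMeasurable
      (fun x hx => (norm_cdot_le _ _).trans ?_) (fun x hx => by simp [hz x hx, cdot])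
    exact mul_le_mul ((hA x hx).trans (le_abs_self A)) (norm_curl_le_of_lipschitz hφ x)
      (norm_nonneg _) (abs_nonneg _)
  have i2 : Integrable (fun x => cdot (curl u x) (φ x)) := by
    refine integrable_of_bounded_of_zero (S := tsupport φ) (M := (6 * K) * B)
      hc.isCompact.measure_lt_top.ne
      (measurable_cdot (measurable_curl u) hφ.continuous.measurable).aestronglyMeasurable
      (fun x hx => (norm_cdot_le _ _).trans ?_)
      (fun x hx => by simp [image_eq_zero_of_notMem_tsupport hx, cdot])
    exact mul_le_mul (norm_curl_le_of_lipschitz hu x) (hB x) (norm_nonneg _) (by positivity)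
  rw [← sub_eq_zero, ← integral_sub i1 i2]
  choose Lu hLu using fun i => lipschitz_coord hu i
  choose Lφ hLφ using fun i => lipschitz_coord hφ i
  have hcc : ∀ i, HasCompactSupport (fun x => φ x i) := fun i =>
    hc.comp_left (g := fun v : C3 => v i) rfl
  choose M hM using fun i k => lipschitz_mul_of_hasCompactSupport (hLu i) (hLφ k) (hcc k)
  have hcp : ∀ i k, HasCompactSupport (fun x => u x i * φ x k) := fun i k => (hcc k).mul_left
  have hzero := fun j i k => integral_partialD_eq_zero (hM i k) (hcp i k) j
  have hi : ∀ j i k, Integrable (partialD j (fun x => u x i * φ x k)) := by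
    intro j i k
    refine integrable_of_bounded_of_zero (S := tsupport (fun x => u x i * φ x k)) (M := M i k)
      (hcp i k).isCompact.measure_lt_top.ne
      (measurable_partialD _ _).aestronglyMeasurable
      (fun x _ => norm_partialD_le_of_lipschitz (hM i k) j x) (fun x hx => ?_)
    have : (fun x => u x i * φ x k) =ᶠ[𝓝 x] fun _ => 0 := notMem_tsupport_iff_eventuallyEq.1 hx
    rw [partialD_congr this]; simp [partialD]
  rw [integral_congr_ae (by
    filter_upwards [hu.ae_differentiableAt (μ := (volume : Measure R3)),
      hφ.ae_differentiableAt (μ := (volume : Measure R3))] with x h1 h2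
    exact cdot_curl_sub h1 h2)]
  exact integral_alternating_eq_zero (hi _ _ _) (hi _ _ _) (hi _ _ _) (hi _ _ _) (hi _ _ _)
    (hi _ _ _) (hzero _ _ _) (hzero _ _ _) (hzero _ _ _) (hzero _ _ _) (hzero _ _ _) (hzero _ _ _)

theorem setIntegral_eq_integral_of_zero {U : Set R3} {f : R3 → ℂ} (h : ∀ x, x ∉ U → f x = 0) :
    ∫ x in U, f x = ∫ x, f x :=
  setIntegral_eq_integral_of_forall_compl_eq_zero h

theorem curl_eq_zero_of_notMem_tsupport {φ : R3 → C3} {x : R3} (hx : x ∉ tsupport φ) :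
    curl φ x = 0 := by
  have : φ =ᶠ[𝓝 x] fun _ => 0 := notMem_tsupport_iff_eventuallyEq.1 hx
  rw [curl_congr this]
  ext i; fin_cases i <;> simp [curl, pd]

theorem memLp_of_bounded {U : Set R3} (hU : volume U ≠ ⊤) {u : R3 → C3}
    (hm : AEStronglyMeasurable u (volume.restrict U)) {M : ℝ} (hM : ∀ x ∈ U, ‖u x‖ ≤ M)
    (hUm : MeasurableSet U) : InL2 U u := by
  have : IsFiniteMeasure (volume.restrict U) := ⟨by simpa using hU.lt_top⟩
  exact MemLp.of_bound hm M ((ae_restrict_iff' hUm).2 (ae_of_all _ hM))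

/-- The restriction of a bounded Lipschitz field to a set of finite measure lies in `H(curl)`. -/
theorem inHCurl_of_bddLip {U : Set R3} (hU : volume U ≠ ⊤) (hUm : MeasurableSet U) {u : R3 → C3}
    (hu : BddLip u) : InHCurl U u (curl u) := by
  obtain ⟨⟨K, hK⟩, B, hB⟩ := hu
  refine ⟨memLp_of_bounded hU hK.continuous.aestronglyMeasurable (fun x _ => hB x) hUm,
    memLp_of_bounded hU (measurable_curl u).aestronglyMeasurable
      (fun x _ => norm_curl_le_of_lipschitz hK x) hUm, fun φ hφ hc hs => ?_⟩
  obtain ⟨L, hL⟩ := ContDiff.lipschitzWith_of_hasCompactSupport hc hφ (by simp)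
  rw [setIntegral_eq_integral_of_zero, setIntegral_eq_integral_of_zero,
    integral_cdot_curl hK hL hc]
  · intro x hx
    simp [image_eq_zero_of_notMem_tsupport fun h => hx (hs h), cdot]
  · intro x hx
    simp [curl_eq_zero_of_notMem_tsupport fun h => hx (hs h), cdot]

/-! ### Lipschitz fields vanishing outside `U` belong to `H₀(curl, U)` -/

/-- A Lipschitz map has vanishing derivative at almost every point of its zero set. -/
theorem ae_fderiv_eq_zero_of_eq_zero {u : R3 → C3} {K : NNReal} (hu : LipschitzWith K u) :
    ∀ᵐ x : R3, u x = 0 → fderiv ℝ u x = 0 := by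
  have hN : LipschitzWith (1 * K) (fun x => ‖u x‖) := lipschitzWith_one_norm.comp hu
  filter_upwards [hN.ae_differentiableAt (μ := (volume : Measure R3))] with x h2 hx
  -- `‖u‖` is differentiable at its minimum `x`
  have hmin : IsLocalMin (fun y => ‖u y‖) x :=
    Eventually.of_forall fun y => by simp [hx]
  have h3 : HasFDerivAt (fun y => ‖u y‖) (0 : R3 →L[ℝ] ℝ) x := by
    rw [← hmin.fderiv_eq_zero]; exact h2.hasFDerivAt
  have h4 : HasFDerivAt u (0 : R3 →L[ℝ] C3) x := by
    rw [hasFDerivAt_iff_isLittleO] at h3 ⊢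
    simp only [hx, norm_zero, sub_zero, _root_.zero_apply] at h3 ⊢
    exact h3.of_norm_left
  exact h4.fderiv

/-- The curl as a function of the full derivative. -/
def curlOf (T : R3 →L[ℝ] C3) : C3 :=
  !₂[T (e3 1) 2 - T (e3 2) 1, T (e3 2) 0 - T (e3 0) 2, T (e3 0) 1 - T (e3 1) 0]

theorem continuous_curlOf : Continuous curlOf := by
  refine (PiLp.continuous_toLp 2 _).comp (continuous_pi fun i => ?_)
  fin_cases i <;>
  · simp
    fun_prop

theorem tendsto_curl_of_tendsto_fderiv {u : R3 → C3} {v : ℕ → R3 → C3} {x : R3}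
    (h : Tendsto (fun n => fderiv ℝ (v n) x) atTop (𝓝 (fderiv ℝ u x))) :
    Tendsto (fun n => curl (v n) x) atTop (𝓝 (curl u x)) :=
  (continuous_curlOf.tendsto (fderiv ℝ u x)).comp h

/-- The derivative may be moved onto a factor that is merely Lipschitz. -/
theorem hasFDerivAt_convolution_of_lipschitz (b : ContDiffBump (0 : R3)) {v : R3 → C3}
    {K : NNReal} (hv : LipschitzWith K v) (x : R3) :
    HasFDerivAt (convolution (b.normed volume) v (ContinuousLinearMap.lsmul ℝ ℝ) volume)
      (convolution (b.normed volume) (fderiv ℝ v) (ContinuousLinearMap.lsmul ℝ ℝ) volume x) x := by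
  have hb : Continuous (b.normed (volume : Measure R3)) := b.continuous_normed
  have hbi : Integrable (b.normed (volume : Measure R3)) := b.integrable_normed
  refine (hasFDerivAt_integral_of_dominated_loc_of_lip (μ := (volume : Measure R3))
    (F := fun x y => ContinuousLinearMap.lsmul ℝ ℝ (b.normed volume y) (v (x - y)))
    (F' := fun y => ContinuousLinearMap.lsmul ℝ ℝ (b.normed volume y) (fderiv ℝ v (x - y)))
    (bound := fun y => b.normed volume y * K) (s := Set.univ) univ_mem ?_ ?_ ?_ ?_ ?_ ?_).2
  · refine Eventually.of_forall fun z => Continuous.aestronglyMeasurable ?_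
    have := hv.continuous
    simp only [ContinuousLinearMap.lsmul_apply]
    fun_prop
  · refine Continuous.integrable_of_hasCompactSupport ?_ ?_
    · have := hv.continuous
      simp only [ContinuousLinearMap.lsmul_apply]
      fun_prop
    · exact b.hasCompactSupport_normed.smul_right
  · refine hb.aestronglyMeasurable.smul (Measurable.aestronglyMeasurable ?_)
    exact (measurable_fderiv ℝ v).comp (measurable_const.sub measurable_id)
  · refine ae_of_all _ fun y => LipschitzOnWith.of_dist_le_mul fun p _ q _ => ?_
    have h0 : 0 ≤ b.normed volume y := b.nonneg_normed y
    simp only [ContinuousLinearMap.lsmul_apply]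
    rw [dist_smul₀, Real.norm_of_nonneg h0, Real.coe_nnabs,
      abs_of_nonneg (mul_nonneg h0 K.coe_nonneg), mul_assoc]
    refine mul_le_mul_of_nonneg_left ?_ h0
    simpa using hv.dist_le_mul (p - y) (q - y)
  · exact hbi.mul_const _
  · have hq := (quasiMeasurePreserving_sub_left (volume : Measure R3) x).ae
      (hv.ae_differentiableAt (μ := (volume : Measure R3)))
    filter_upwards [hq] with y hy
    have h1 : HasFDerivAt (fun z : R3 => z - y) (ContinuousLinearMap.id ℝ R3) x :=
      (hasFDerivAt_id x).sub_const y
    have h2 := (hy.hasFDerivAt.comp x h1).const_smul (b.normed volume y)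
    rw [ContinuousLinearMap.comp_id] at h2
    exact h2

theorem norm_convolution_fderiv_le (b : ContDiffBump (0 : R3)) {v : R3 → C3}
    {K : NNReal} (hv : LipschitzWith K v) (x : R3) :
    ‖convolution (b.normed volume) (fderiv ℝ v) (ContinuousLinearMap.lsmul ℝ ℝ) volume x‖ ≤ K := by
  have hbi : Integrable (b.normed (volume : Measure R3)) := b.integrable_normed
  have h := norm_integral_le_of_norm_le (μ := (volume : Measure R3))
    (f := fun y => ContinuousLinearMap.lsmul ℝ ℝ (b.normed volume y) (fderiv ℝ v (x - y)))
    (hbi.mul_const (K : ℝ)) (ae_of_all _ fun y => by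
      have h0 : 0 ≤ b.normed volume y := b.nonneg_normed y
      simp only [ContinuousLinearMap.lsmul_apply]
      rw [norm_smul, Real.norm_of_nonneg h0]
      exact mul_le_mul_of_nonneg_left (norm_fderiv_le_of_lipschitz ℝ hv) h0)
  rwa [integral_mul_const, b.integral_normed, one_mul] at h

theorem integrable_of_inL2 {U : Set R3} (hU : volume U ≠ ⊤) {u : R3 → C3} (h : InL2 U u) :
    Integrable u (volume.restrict U) := by
  have : IsFiniteMeasure (volume.restrict U) := ⟨by simpa using hU.lt_top⟩
  exact h.integrable (by norm_num)

theorem continuous_cdot_left (c : C3) : Continuous (fun w => cdot w c) := by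
  unfold cdot; fun_prop

theorem tendsto_integral_cdot {U : Set R3} {f : R3 → C3} (hf : Integrable f (volume.restrict U))
    {g : ℕ → R3 → C3} {g' : R3 → C3} {M : ℝ} (hgm : ∀ n, Measurable (g n))
    (hg : ∀ n x, ‖g n x‖ ≤ M)
    (hlim : ∀ᵐ x : R3, Tendsto (fun n => g n x) atTop (𝓝 (g' x))) :
    Tendsto (fun n => ∫ x in U, cdot (g n x) (f x)) atTop (𝓝 (∫ x in U, cdot (g' x) (f x))) := by
  refine tendsto_integral_of_dominated_convergence (fun x => M * ‖f x‖) (fun n => ?_)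
    (hf.norm.const_mul M) (fun n => ae_of_all _ fun x => ?_) ?_
  · exact aestronglyMeasurable_cdot (hgm n).aestronglyMeasurable hf.aestronglyMeasurable
  · exact (norm_cdot_le _ _).trans (mul_le_mul_of_nonneg_right (hg n x) (norm_nonneg _))
  · filter_upwards [ae_restrict_of_ae hlim] with x hx
    exact ((continuous_cdot_left (f x)).tendsto (g' x)).comp hx

theorem cdot_comm (u v : C3) : cdot u v = cdot v u := by simp [cdot, mul_comm]

/-- The defining identity of `H₀(curl, U)` for a Lipschitz field whose support keeps a positive
distance from the complement of `U`; it follows by mollification. -/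
theorem pairing_of_lipschitz_of_thickening {U : Set R3} (hUb : Bornology.IsBounded U)
    {v : R3 → C3} {K : NNReal} (hv : LipschitzWith K v) {B : ℝ} (hB : ∀ x, ‖v x‖ ≤ B) {ρ : ℝ}
    (hρ : 0 < ρ) (hs : ∀ x y, v x ≠ 0 → dist x y ≤ ρ → y ∈ U) {ψ d : R3 → C3}
    (hψ : InHCurl U ψ d) :
    ∫ x in U, cdot (v x) (d x) = ∫ x in U, cdot (curl v x) (ψ x) := by
  have hU : volume U ≠ ⊤ := hUb.measure_lt_top.ne
  let b : ℕ → ContDiffBump (0 : R3) := fun n =>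
    ⟨ρ / 4 / ((n : ℝ) + 1), ρ / 2 / ((n : ℝ) + 1), by positivity, by gcongr; norm_num⟩
  let φ : ℕ → R3 → C3 := fun n =>
    convolution ((b n).normed volume) v (ContinuousLinearMap.lsmul ℝ ℝ) volume
  have hrle : ∀ n, (b n).rOut ≤ ρ / 2 := fun n => div_le_self (by positivity) (by simp)
  have hr0 : Tendsto (fun n => (b n).rOut) atTop (𝓝 0) :=
    tendsto_const_div_atTop_nhds_zero_nat (ρ / 2) |>.comp (tendsto_add_atTop_nat 1) |>.congr
      fun n => by simp [b]
  have hclose : ∀ n x, dist (φ n x) (v x) ≤ K * (b n).rOut := fun n x =>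
    (b n).dist_normed_convolution_le hv.continuous.aestronglyMeasurable fun y hy =>
      (hv.dist_le_mul y x).trans (by gcongr; exact (Metric.mem_ball.1 hy).le)
  have hder : ∀ n x, HasFDerivAt (φ n) (convolution ((b n).normed volume) (fderiv ℝ v)
      (ContinuousLinearMap.lsmul ℝ ℝ) volume x) x := fun n x =>
    hasFDerivAt_convolution_of_lipschitz (b n) hv x
  have hsmooth : ∀ n, ContDiff ℝ (⊤ : ℕ∞) (φ n) := fun n =>
    (b n).hasCompactSupport_normed.contDiff_convolution_left _ (b n).contDiff_normed
      hv.continuous.locallyIntegrable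
  have hnear : ∀ n x, φ n x ≠ 0 → ∃ y, v y ≠ 0 ∧ dist y x ≤ ρ / 2 := by
    intro n x hx
    obtain ⟨p, hp, q, hq, rfl⟩ := support_convolution_subset (ContinuousLinearMap.lsmul ℝ ℝ) hx
    refine ⟨q, hq, ?_⟩
    rw [(b n).support_normed_eq] at hp
    have : ‖p‖ < (b n).rOut := by simpa using hp
    rw [dist_eq_norm, sub_add_cancel_right, norm_neg]
    exact this.le.trans (hrle n)
  have htsupp : ∀ n, tsupport (φ n) ⊆ U := by
    intro n x hx
    obtain ⟨x', hx', hd⟩ := Metric.mem_closure_iff.1 hx (ρ / 2) (by positivity)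
    obtain ⟨y, hy, hyd⟩ := hnear n x' hx'
    refine hs y x hy ?_
    have := dist_triangle y x' x
    rw [dist_comm x] at hd
    linarith
  have hcomp : ∀ n, HasCompactSupport (φ n) := fun n =>
    Metric.isCompact_of_isClosed_isBounded (isClosed_tsupport _) (hUb.subset (htsupp n))
  have hlim1 : ∀ᵐ x : R3, Tendsto (fun n => φ n x) atTop (𝓝 (v x)) := by
    refine ae_of_all _ fun x => tendsto_iff_dist_tendsto_zero.2 ?_
    refine squeeze_zero (fun _ => dist_nonneg) (fun n => hclose n x) ?_
    simpa using hr0.const_mul (K : ℝ)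
  have hlim2 : ∀ᵐ x : R3, Tendsto (fun n => curl (φ n) x) atTop (𝓝 (curl v x)) := by
    have hloc : LocallyIntegrable (fderiv ℝ v) (volume : Measure R3) := by
      rw [locallyIntegrable_iff]
      intro k hk
      exact Measure.integrableOn_of_bounded (M := K) hk.measure_lt_top.ne
        (measurable_fderiv ℝ v).aestronglyMeasurable
        (ae_of_all _ fun x => norm_fderiv_le_of_lipschitz ℝ hv)
    have := ContDiffBump.ae_convolution_tendsto_right_of_locallyIntegrable (φ := b) (K := 2) hr0
      (Eventually.of_forall fun n => le_of_eq (by simp only [b]; ring)) hloc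
    filter_upwards [this] with x hx
    exact tendsto_curl_of_tendsto_fderiv (hx.congr fun n => ((hder n x).fderiv).symm)
  have hbd1 : ∀ n x, ‖φ n x‖ ≤ B + K * (ρ / 2) := by
    intro n x
    have h1 := hclose n x
    have h2 : ‖φ n x‖ ≤ ‖v x‖ + dist (φ n x) (v x) := by
      rw [dist_eq_norm]; exact norm_le_norm_add_norm_sub' _ _
    have h3 : K * (b n).rOut ≤ K * (ρ / 2) := by gcongr; exact hrle n
    linarith [hB x]
  have hbd2 : ∀ n x, ‖curl (φ n) x‖ ≤ 6 * K := fun n x => by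
    refine (norm_curl_le _ _).trans ?_
    rw [(hder n x).fderiv]
    gcongr
    exact norm_convolution_fderiv_le (b n) hv x
  have t1 := tendsto_integral_cdot (U := U) (integrable_of_inL2 hU hψ.curl_memL2)
    (fun n => (hsmooth n).continuous.measurable) hbd1 hlim1
  have t2 := tendsto_integral_cdot (U := U) (integrable_of_inL2 hU hψ.memL2)
    (fun n => measurable_curl (φ n)) hbd2 hlim2
  refine tendsto_nhds_unique t1 (t2.congr fun n => ?_)
  have := hψ.weak_curl (φ n) (hsmooth n) (hcomp n) (htsupp n)
  simp only [cdot_comm (ψ _), cdot_comm (d _)] at this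
  exact this

/-- A piecewise linear cut-off: `0` on `(-∞, 1]`, `1` on `[2, ∞)`. -/
def ramp (t : ℝ) : ℝ := max 0 (min 1 (t - 1))

theorem ramp_of_le {t : ℝ} (h : t ≤ 1) : ramp t = 0 :=
  max_eq_left ((min_le_right _ _).trans (by linarith))

theorem ramp_of_ge {t : ℝ} (h : 2 ≤ t) : ramp t = 1 := by
  rw [ramp, min_eq_left (by linarith), max_eq_right zero_le_one]

theorem ramp_nonneg (t : ℝ) : 0 ≤ ramp t := le_max_left _ _

theorem ramp_le_one (t : ℝ) : ramp t ≤ 1 := max_le zero_le_one (min_le_left _ _)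

theorem norm_ramp_le (t : ℝ) : ‖ramp t‖ ≤ 1 := by
  rw [Real.norm_of_nonneg (ramp_nonneg t)]; exact ramp_le_one t

theorem lipschitzWith_ramp : LipschitzWith 1 ramp :=
  LipschitzWith.const_max (LipschitzWith.const_min (LipschitzWith.of_dist_le_mul fun x y => by
    simp [dist_eq_norm]) 1) 0

/-- Truncation of small vectors: `0` for `‖w‖ ≤ 1` and `w` for `‖w‖ ≥ 2`. -/
def truncC3 (w : C3) : C3 := ramp ‖w‖ • w

theorem exists_lipschitzWith_truncC3 : ∃ K, LipschitzWith K truncC3 := by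
  -- `truncC3 w = w - (1 - ramp ‖w‖) • w`, and the second term vanishes for `‖w‖ ≥ 2`
  have hr : LipschitzWith 1 (fun w : C3 => ramp ‖w‖) := by
    have := lipschitzWith_ramp.comp (lipschitzWith_one_norm (E := C3))
    rwa [one_mul] at this
  have key : ∀ x y : C3, ‖x‖ ≤ ‖y‖ → ‖truncC3 x - truncC3 y‖ ≤ 4 * dist x y := by
    intro x y hxy
    rw [dist_eq_norm]
    by_cases hx : 2 ≤ ‖x‖
    · rw [truncC3, truncC3, ramp_of_ge hx, ramp_of_ge (hx.trans hxy), one_smul, one_smul]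
      linarith [norm_nonneg (x - y)]
    · have e : truncC3 x - truncC3 y = (ramp ‖x‖ - ramp ‖y‖) • x + ramp ‖y‖ • (x - y) := by
        rw [truncC3, truncC3, sub_smul, smul_sub]; abel
      have h1 : ‖ramp ‖x‖ - ramp ‖y‖‖ ≤ ‖x - y‖ := by
        rw [← dist_eq_norm, ← dist_eq_norm]; simpa using hr.dist_le_mul x y
      rw [e]
      refine (norm_add_le _ _).trans ?_
      rw [norm_smul, norm_smul]
      have h2 := mul_le_mul h1 (not_le.1 hx).le (norm_nonneg _) (norm_nonneg _)
      have h3 := mul_le_mul_of_nonneg_right (norm_ramp_le ‖y‖) (norm_nonneg (x - y))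
      linarith [norm_nonneg (x - y)]
  refine ⟨4, LipschitzWith.of_dist_le_mul fun x y => ?_⟩
  rw [dist_eq_norm]
  rcases le_total ‖x‖ ‖y‖ with h | h
  · exact key x y h
  · rw [← norm_neg, neg_sub, dist_comm]; exact key y x h

/-- A bounded Lipschitz field that vanishes outside the bounded set `U` lies in `H₀(curl, U)`: it is
the limit of its truncations, whose supports keep a positive distance from the complement of `U`. -/
theorem inHCurlZero_of_bddLip {U : Set R3} (hUb : Bornology.IsBounded U) (hUm : MeasurableSet U)
    {u : R3 → C3} (hu : BddLip u) (h0 : ∀ x, x ∉ U → u x = 0) : InHCurlZero U u (curl u) := by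
  have hU : volume U ≠ ⊤ := hUb.measure_lt_top.ne
  refine ⟨inHCurl_of_bddLip hU hUm hu, fun ψ d hψ => ?_⟩
  obtain ⟨⟨K, hK⟩, B, hB⟩ := hu
  obtain ⟨T, hT⟩ := exists_lipschitzWith_truncC3
  let ε : ℕ → ℝ := fun n => 1 / ((n : ℝ) + 1)
  have hε : ∀ n, 0 < ε n := fun n => by positivity
  have hε0 : Tendsto ε atTop (𝓝 0) := tendsto_one_div_add_atTop_nhds_zero_nat
  let v : ℕ → R3 → C3 := fun n x => ramp (‖u x‖ / ε n) • u x
  have hv_eq : ∀ n x, v n x = ε n • truncC3 ((ε n)⁻¹ • u x) := by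
    intro n x
    simp only [v, truncC3]
    rw [norm_smul, norm_inv, Real.norm_of_nonneg (hε n).le, smul_comm, smul_smul (ε n),
      mul_inv_cancel₀ (hε n).ne', one_smul, div_eq_inv_mul]
  -- by scaling, the Lipschitz constants are bounded uniformly in `n`
  have hvL : ∀ n, LipschitzWith (T * K) (v n) := by
    intro n
    refine LipschitzWith.of_dist_le_mul fun x y => ?_
    rw [hv_eq, hv_eq, dist_smul₀]
    have h1 := hT.dist_le_mul ((ε n)⁻¹ • u x) ((ε n)⁻¹ • u y)
    rw [dist_smul₀] at h1
    have h2 := hK.dist_le_mul x y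
    have he : ‖ε n‖ * ‖(ε n)⁻¹‖ = 1 := by
      rw [← norm_mul, mul_inv_cancel₀ (hε n).ne', norm_one]
    calc ‖ε n‖ * dist (truncC3 ((ε n)⁻¹ • u x)) (truncC3 ((ε n)⁻¹ • u y))
        ≤ ‖ε n‖ * (T * (‖(ε n)⁻¹‖ * dist (u x) (u y))) := by gcongr
      _ = T * dist (u x) (u y) * (‖ε n‖ * ‖(ε n)⁻¹‖) := by ring
      _ ≤ T * (K * dist x y) := by rw [he, mul_one]; gcongr
      _ = _ := by push_cast; ring
  have hvB : ∀ n x, ‖v n x‖ ≤ B := fun n x => by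
    simp only [v]
    rw [norm_smul]
    have := mul_le_mul_of_nonneg_right (norm_ramp_le (‖u x‖ / ε n)) (norm_nonneg (u x))
    linarith [hB x]
  have hpair : ∀ n, ∫ x in U, cdot (v n x) (d x) = ∫ x in U, cdot (curl (v n) x) (ψ x) := by
    intro n
    refine pairing_of_lipschitz_of_thickening hUb (hvL n) (hvB n) (ρ := ε n / (K + 1))
      (div_pos (hε n) (by positivity)) (fun x y hx hd => ?_) hψ
    by_contra hy
    apply hx
    have h1 := hK.dist_le_mul x y
    rw [h0 y hy, dist_zero_right] at h1
    have h2 : ‖u x‖ ≤ ε n := by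
      refine h1.trans ((mul_le_mul_of_nonneg_left hd K.coe_nonneg).trans ?_)
      rw [mul_div_assoc', div_le_iff₀ (by positivity)]
      nlinarith [hε n, K.coe_nonneg]
    simp only [v]
    rw [ramp_of_le ((div_le_one (hε n)).2 h2), zero_smul]
  have hev : ∀ x, u x ≠ 0 → ∀ᶠ n in atTop, v n =ᶠ[𝓝 x] u := by
    intro x hx
    have hpos : 0 < ‖u x‖ := norm_pos_iff.2 hx
    filter_upwards [hε0.eventually_lt_const (show (0 : ℝ) < ‖u x‖ / 4 by positivity)] with n hn
    have hnb : ∀ᶠ y in 𝓝 x, ‖u x‖ / 2 < ‖u y‖ :=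
      (hK.continuous.norm.tendsto x).eventually_const_lt (by linarith)
    filter_upwards [hnb] with y hy
    simp only [v]
    rw [ramp_of_ge, one_smul]
    rw [le_div_iff₀ (hε n)]; linarith
  have hev0 : ∀ x, u x = 0 → ∀ n, v n =ᶠ[𝓝 x] fun _ => 0 := by
    intro x hx n
    have hnb : ∀ᶠ y in 𝓝 x, ‖u y‖ < ε n :=
      (hK.continuous.norm.tendsto x).eventually_lt_const (by simpa [hx] using hε n)
    filter_upwards [hnb] with y hy
    simp only [v]
    rw [ramp_of_le ((div_le_one (hε n)).2 hy.le), zero_smul]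
  have hlim1 : ∀ᵐ x : R3, Tendsto (fun n => v n x) atTop (𝓝 (u x)) := by
    refine ae_of_all _ fun x => ?_
    by_cases hx : u x = 0
    · rw [hx]
      exact tendsto_const_nhds.congr fun n => ((hev0 x hx n).self_of_nhds).symm
    · exact tendsto_nhds_of_eventually_eq ((hev x hx).mono fun n hn => hn.self_of_nhds)
  have hlim2 : ∀ᵐ x : R3, Tendsto (fun n => curl (v n) x) atTop (𝓝 (curl u x)) := by
    filter_upwards [ae_fderiv_eq_zero_of_eq_zero hK] with x hx0
    by_cases hx : u x = 0
    · have e1 : curl u x = curl (fun _ => 0) x := by simp [curl, pd, hx0 hx]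
      rw [e1]
      exact tendsto_const_nhds.congr fun n => (curl_congr (hev0 x hx n)).symm
    · exact tendsto_nhds_of_eventually_eq ((hev x hx).mono fun n hn => curl_congr hn)
  have t1 := tendsto_integral_cdot (U := U) (integrable_of_inL2 hU hψ.curl_memL2)
    (fun n => (hvL n).continuous.measurable) hvB hlim1
  have t2 := tendsto_integral_cdot (U := U) (integrable_of_inL2 hU hψ.memL2)
    (fun n => measurable_curl (v n)) (fun n x => norm_curl_le_of_lipschitz (hvL n) x) hlim2
  exact tendsto_nhds_unique t1 (t2.congr fun n => (hpair n).symm)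

/-! ### Products of weakly and strongly convergent sequences -/

/-- Componentwise complex conjugation, which turns the bilinear product into the inner product. -/
def conjC3 (v : C3) : C3 := WithLp.toLp 2 (fun i => star (v i))

theorem norm_conjC3 (v : C3) : ‖conjC3 v‖ = ‖v‖ := by simp [conjC3, EuclideanSpace.norm_eq]

theorem inner_conjC3 (u v : C3) : inner ℂ (conjC3 u) v = cdot u v := by
  simp [conjC3, cdot, PiLp.inner_apply, mul_comm]

theorem continuous_conjC3 : Continuous conjC3 := by
  refine (PiLp.continuous_toLp 2 _).comp (continuous_pi fun i => ?_)
  fun_prop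

theorem memLp_conjC3 {m : Measure R3} {u : R3 → C3} (hu : MemLp u 2 m) :
    MemLp (fun x => conjC3 (u x)) 2 m :=
  MemLp.of_le hu (continuous_conjC3.comp_aestronglyMeasurable hu.1)
    (ae_of_all _ fun _ => (norm_conjC3 _).le)

theorem integral_cdot_eq_inner {m : Measure R3} {u v : R3 → C3} (hu : MemLp u 2 m) (hv : MemLp v 2 m) :
    ∫ x, cdot (u x) (v x) ∂m = inner ℂ (MemLp.toLp _ (memLp_conjC3 hu)) (MemLp.toLp v hv) := by
  rw [L2.inner_def]
  refine integral_congr_ae ?_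
  filter_upwards [MemLp.coeFn_toLp (memLp_conjC3 hu), MemLp.coeFn_toLp hv] with x h1 h2
  rw [h1, h2, inner_conjC3]

theorem integrable_cdot {m : Measure R3} {u v : R3 → C3} (hu : MemLp u 2 m) (hv : MemLp v 2 m) :
    Integrable (fun x => cdot (u x) (v x)) m := by
  refine (L2.integrable_inner (𝕜 := ℂ) (MemLp.toLp _ (memLp_conjC3 hu)) (MemLp.toLp v hv)).congr ?_
  filter_upwards [MemLp.coeFn_toLp (memLp_conjC3 hu), MemLp.coeFn_toLp hv] with x h1 h2
  rw [h1, h2, inner_conjC3]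

theorem norm_toLp_conj {m : Measure R3} {u : R3 → C3} (hu : MemLp u 2 m) :
    ‖MemLp.toLp _ (memLp_conjC3 hu)‖ = (eLpNorm u 2 m).toReal := by
  rw [Lp.norm_toLp]
  congr 1
  exact eLpNorm_congr_norm_ae (ae_of_all _ fun _ => norm_conjC3 _)

theorem norm_integral_cdot_le {U : Set R3} {u v : R3 → C3} (hu : InL2 U u) (hv : InL2 U v) :
    ‖∫ x in U, cdot (u x) (v x)‖ ≤ (eLpNorm u 2 (volume.restrict U)).toReal *
      (eLpNorm v 2 (volume.restrict U)).toReal := by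
  rw [integral_cdot_eq_inner hu hv, ← norm_toLp_conj hu, ← Lp.norm_toLp v hv]
  exact norm_inner_le_norm _ _

/-- Weakly convergent sequences are bounded, by the Banach–Steinhaus theorem. -/
theorem WeakConvL2.exists_bound {U : Set R3} {u : ℕ → R3 → C3} {u' : R3 → C3}
    (h : WeakConvL2 U u u') :
    ∃ C, ∀ n, (eLpNorm (u n) 2 (volume.restrict U)).toReal ≤ C := by
  let T : ℕ → Lp C3 2 (volume.restrict U) →L[ℂ] ℂ := fun n =>
    innerSL ℂ (MemLp.toLp _ (memLp_conjC3 (h.memL2 n)))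
  obtain ⟨C, hC⟩ := banach_steinhaus (g := T) (fun g => by
    have hg : MemLp g 2 (volume.restrict U) := Lp.memLp g
    obtain ⟨C, hC⟩ := (h.tendsto g hg).norm.bddAbove_range
    refine ⟨C, fun n => ?_⟩
    have e : T n g = ∫ x in U, cdot (u n x) (g x) := by
      rw [integral_cdot_eq_inner (h.memL2 n) hg, Lp.toLp_coeFn]; rfl
    rw [e]
    exact hC ⟨n, rfl⟩)
  refine ⟨C, fun n => ?_⟩
  have := hC n
  rwa [innerSL_apply_norm, norm_toLp_conj (h.memL2 n)] at this

/-- Strong convergence `g_n → g` in `L²(U, ℂ³)`. -/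
structure StrongConvL2 (U : Set R3) (g : ℕ → R3 → C3) (g' : R3 → C3) : Prop where
  memL2 : ∀ n, InL2 U (g n)
  limit_memL2 : InL2 U g'
  tendsto : Tendsto (fun n => eLpNorm (fun x => g n x - g' x) 2 (volume.restrict U)) atTop (𝓝 0)

theorem cdot_sub (u v w : C3) : cdot u (v - w) = cdot u v - cdot u w := by
  simp [cdot_expand]; ring

theorem cdot_add_left (u v w : C3) : cdot (u + v) w = cdot u w + cdot v w := by
  simp [cdot_expand]; ring

theorem cdot_smul_left (a : ℂ) (u v : C3) : cdot (a • u) v = a * cdot u v := by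
  simp [cdot_expand]; ring

/-- The product of a weakly and a strongly convergent sequence converges. -/
theorem WeakConvL2.tendsto_cdot {U : Set R3} {u : ℕ → R3 → C3} {u' : R3 → C3}
    (h : WeakConvL2 U u u') {g : ℕ → R3 → C3} {g' : R3 → C3} (hg : StrongConvL2 U g g') :
    Tendsto (fun n => ∫ x in U, cdot (u n x) (g n x)) atTop (𝓝 (∫ x in U, cdot (u' x) (g' x))) := by
  obtain ⟨C, hC⟩ := h.exists_bound
  have hdiff : Tendsto (fun n => ∫ x in U, cdot (u n x) (g n x - g' x)) atTop (𝓝 0) := by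
    have h1 := (ENNReal.tendsto_toReal ENNReal.zero_ne_top).comp hg.tendsto
    have h2 := h1.const_mul C
    rw [ENNReal.toReal_zero, mul_zero] at h2
    refine squeeze_zero_norm (fun n => ?_) h2
    refine (norm_integral_cdot_le (h.memL2 n) ((hg.memL2 n).sub hg.limit_memL2)).trans ?_
    exact mul_le_mul_of_nonneg_right (hC n) ENNReal.toReal_nonneg
  have := hdiff.add (h.tendsto g' hg.limit_memL2)
  rw [zero_add] at this
  refine this.congr fun n => ?_
  simp only [cdot_sub]
  rw [integral_sub (integrable_cdot (h.memL2 n) (hg.memL2 n))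
    (integrable_cdot (h.memL2 n) hg.limit_memL2), sub_add_cancel]

theorem tendsto_integral_cdot_of_strong {U : Set R3} {f : R3 → C3} (hf : InL2 U f)
    {g : ℕ → R3 → C3} {g' : R3 → C3} (hg : StrongConvL2 U g g') :
    Tendsto (fun n => ∫ x in U, cdot (f x) (g n x)) atTop (𝓝 (∫ x in U, cdot (f x) (g' x))) :=
  WeakConvL2.tendsto_cdot (u := fun _ => f) ⟨fun _ => hf, hf, fun _ _ => tendsto_const_nhds⟩ hg

theorem cdot_indicator_indicator (S : Set R3) (u v : R3 → C3) (x : R3) :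
    cdot (S.indicator u x) (S.indicator v x) = S.indicator (fun y => cdot (u y) (v y)) x := by
  by_cases hx : x ∈ S <;> simp [hx, cdot]

theorem cdot_indicator_right (S : Set R3) (u v : R3 → C3) (x : R3) :
    cdot (u x) (S.indicator v x) = S.indicator (fun y => cdot (u y) (v y)) x := by
  by_cases hx : x ∈ S <;> simp [hx, cdot]

theorem setIntegral_indicator_of_subset {Ω U : Set R3} (hUm : MeasurableSet U) (hUΩ : U ⊆ Ω)
    (f : R3 → ℂ) : ∫ x in Ω, U.indicator f x = ∫ x in U, f x := by
  rw [setIntegral_indicator hUm, Set.inter_eq_right.2 hUΩ]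

/-- Passage to the limit in one of the two Maxwell equations, given strongly convergent test
fields. -/
theorem integral_eq_of_strong_test_fields {Ω : Set R3} {U : ℕ → Set R3}
    (hUm : ∀ n, MeasurableSet (U n)) (hUΩ : ∀ n, U n ⊆ Ω) (a : ℂ) {f : R3 → C3} (hf : InL2 Ω f)
    {F G : ℕ → R3 → C3} {F' G' : R3 → C3}
    (hF : WeakConvL2 Ω (fun n => (U n).indicator (F n)) F')
    (hG : WeakConvL2 Ω (fun n => (U n).indicator (G n)) G')
    {ψ d : ℕ → R3 → C3} {ψ' d' : R3 → C3}
    (hψ : StrongConvL2 Ω (fun n => (U n).indicator (ψ n)) ψ')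
    (hd : StrongConvL2 Ω (fun n => (U n).indicator (d n)) d')
    (heq : ∀ n, ∫ x in U n, cdot (F n x) (d n x) = ∫ x in U n, cdot (a • G n x + f x) (ψ n x)) :
    ∫ x in Ω, cdot (F' x) (d' x) = ∫ x in Ω, cdot (a • G' x + f x) (ψ' x) := by
  have t1 := hF.tendsto_cdot hd
  have t2 := ((hG.tendsto_cdot hψ).const_mul a).add (tendsto_integral_cdot_of_strong hf hψ)
  have e : ∀ n, ∫ x in Ω, cdot ((U n).indicator (F n) x) ((U n).indicator (d n) x) =
      a * (∫ x in Ω, cdot ((U n).indicator (G n) x) ((U n).indicator (ψ n) x)) +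
        ∫ x in Ω, cdot (f x) ((U n).indicator (ψ n) x) := by
    intro n
    rw [← integral_const_mul, ← integral_add ((integrable_cdot (hG.memL2 n)
      (hψ.memL2 n)).const_mul a) (integrable_cdot hf (hψ.memL2 n))]
    simp only [cdot_indicator_indicator]
    simp only [cdot_indicator_right]
    rw [setIntegral_indicator_of_subset (hUm n) (hUΩ n), heq n,
      ← setIntegral_indicator_of_subset (hUm n) (hUΩ n)]
    refine integral_congr_ae (ae_of_all _ fun x => ?_)
    by_cases hx : x ∈ U n <;> simp [hx, cdot_add_left, cdot_smul_left]
  have e' : ∫ x in Ω, cdot (a • G' x + f x) (ψ' x) =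
      a * (∫ x in Ω, cdot (G' x) (ψ' x)) + ∫ x in Ω, cdot (f x) (ψ' x) := by
    rw [← integral_const_mul, ← integral_add ((integrable_cdot hG.limit_memL2
      hψ.limit_memL2).const_mul a) (integrable_cdot hf hψ.limit_memL2)]
    exact integral_congr_ae (ae_of_all _ fun x => by simp [cdot_add_left, cdot_smul_left])
  rw [e']
  exact tendsto_nhds_unique t1 (t2.congr fun n => (e n).symm)

/-! ### Integration in coordinates and null sets -/

theorem measurePreserving_coords :
    MeasurePreserving (fun x : R3 => (x 0, x 1, x 2)) (volume : Measure R3)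
      (volume : Measure (ℝ × ℝ × ℝ)) := by
  have h1 := EuclideanSpace.volume_preserving_symm_measurableEquiv_toLp (Fin 3)
  have h2 := volume_preserving_piFinSuccAbove (fun _ : Fin 3 => ℝ) 0
  have h3 : MeasurePreserving (Prod.map id (MeasurableEquiv.finTwoArrow : (Fin 2 → ℝ) ≃ᵐ ℝ × ℝ))
      (volume : Measure (ℝ × (Fin 2 → ℝ))) (volume : Measure (ℝ × ℝ × ℝ)) :=
    (MeasurePreserving.id volume).prod (volume_preserving_finTwoArrow ℝ)
  exact h3.comp (h2.comp h1)

theorem lintegral_R3 {F : ℝ → ℝ → ℝ → ℝ≥0∞}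
    (hF : Measurable (fun p : ℝ × ℝ × ℝ => F p.1 p.2.1 p.2.2)) :
    ∫⁻ x : R3, F (x 0) (x 1) (x 2) = ∫⁻ a, ∫⁻ b, ∫⁻ c, F a b c := by
  have h := measurePreserving_coords.lintegral_comp hF
  refine h.trans ?_
  rw [Measure.volume_eq_prod, lintegral_prod _ hF.aemeasurable]
  refine lintegral_congr fun a => ?_
  have : Measurable (fun q : ℝ × ℝ => F a q.1 q.2) := hF.comp measurable_prodMk_left
  rw [Measure.volume_eq_prod, lintegral_prod _ this.aemeasurable]

theorem lintegral_div_sub {f : ℝ → ℝ≥0∞} (hf : Measurable f) {η : ℝ} (hη : 0 < η) (a : ℝ) :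
    ∫⁻ t, f (t / η - a) = ENNReal.ofReal η * ∫⁻ t, f t := by
  have h1 : Measurable fun t => f (t - a) := hf.comp (measurable_id.sub_const a)
  have h2 : ∫⁻ t, f (t / η - a) = ∫⁻ t, f (t - a) ∂(Measure.map (η⁻¹ * ·) volume) := by
    rw [lintegral_map h1 (by fun_prop)]
    simp only [div_eq_inv_mul]
  rw [h2, Real.map_volume_mul_left (inv_ne_zero hη.ne'), lintegral_smul_measure, inv_inv,
    abs_of_pos hη, lintegral_sub_right_eq_self f a]
  rfl

theorem volume_box {η : ℝ} (hη : 0 < η) (a b c : ℝ) {A B C : Set ℝ} (hA : MeasurableSet A)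
    (hB : MeasurableSet B) (hC : MeasurableSet C) :
    volume {x : R3 | x 0 / η - a ∈ A ∧ x 1 / η - b ∈ B ∧ x 2 / η - c ∈ C} =
      ENNReal.ofReal (η ^ 3) * (volume A * volume B * volume C) := by
  have hm : MeasurableSet {x : R3 | x 0 / η - a ∈ A ∧ x 1 / η - b ∈ B ∧ x 2 / η - c ∈ C} := by
    have h0 : Measurable fun x : R3 => x 0 / η - a := by fun_prop
    have h1 : Measurable fun x : R3 => x 1 / η - b := by fun_prop
    have h2 : Measurable fun x : R3 => x 2 / η - c := by fun_prop
    exact (h0 hA).inter ((h1 hB).inter (h2 hC))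
  have iA : Measurable (A.indicator (1 : ℝ → ℝ≥0∞)) := measurable_one.indicator hA
  have iB : Measurable (B.indicator (1 : ℝ → ℝ≥0∞)) := measurable_one.indicator hB
  have iC : Measurable (C.indicator (1 : ℝ → ℝ≥0∞)) := measurable_one.indicator hC
  have e : ∀ x : R3, {x : R3 | x 0 / η - a ∈ A ∧ x 1 / η - b ∈ B ∧ x 2 / η - c ∈ C}.indicator
      (1 : R3 → ℝ≥0∞) x = A.indicator 1 (x 0 / η - a) * (B.indicator 1 (x 1 / η - b) *
        C.indicator 1 (x 2 / η - c)) := by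
    intro x
    by_cases h0 : x 0 / η - a ∈ A <;> by_cases h1 : x 1 / η - b ∈ B <;>
      by_cases h2 : x 2 / η - c ∈ C <;> simp [Set.indicator, h0, h1, h2]
  have jA : Measurable fun t => A.indicator (1 : ℝ → ℝ≥0∞) (t / η - a) :=
    iA.comp (by fun_prop)
  have jB : Measurable fun t => B.indicator (1 : ℝ → ℝ≥0∞) (t / η - b) :=
    iB.comp (by fun_prop)
  have jC : Measurable fun t => C.indicator (1 : ℝ → ℝ≥0∞) (t / η - c) :=
    iC.comp (by fun_prop)
  rw [← lintegral_indicator_one hm, lintegral_congr e, lintegral_R3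
    (F := fun p q r => A.indicator 1 (p / η - a) * (B.indicator 1 (q / η - b) *
        C.indicator 1 (r / η - c)))
    ((jA.comp measurable_fst).mul ((jB.comp (measurable_fst.comp measurable_snd)).mul
      (jC.comp (measurable_snd.comp measurable_snd))))]
  have l1 : ∀ p, ∫⁻ q, ∫⁻ r, A.indicator (1 : ℝ → ℝ≥0∞) (p / η - a) * (B.indicator 1 (q / η - b) *
      C.indicator 1 (r / η - c)) = A.indicator 1 (p / η - a) * ((ENNReal.ofReal η * volume B) *
        (ENNReal.ofReal η * volume C)) := by
    intro p
    have : ∀ q, ∫⁻ r, A.indicator (1 : ℝ → ℝ≥0∞) (p / η - a) * (B.indicator 1 (q / η - b) *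
      C.indicator 1 (r / η - c)) = A.indicator (1 : ℝ → ℝ≥0∞) (p / η - a) *
        (B.indicator 1 (q / η - b) * (ENNReal.ofReal η * volume C)) := by
      intro q
      rw [lintegral_const_mul _ (jC.const_mul _), lintegral_const_mul _ jC,
        lintegral_div_sub iC hη, lintegral_indicator_one hC]
    simp_rw [this]
    rw [lintegral_const_mul _ (jB.mul_const _), lintegral_mul_const _ jB,
      lintegral_div_sub iB hη, lintegral_indicator_one hB]
  simp_rw [l1]
  rw [lintegral_mul_const _ jA, lintegral_div_sub iA hη, lintegral_indicator_one hA,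
    ENNReal.ofReal_pow hη.le]
  ring

theorem lintegral_Omega_le {η : ℝ} (hη : 0 < η) (a b : ℝ) {Φ : ℝ → ℝ → ℝ≥0∞}
    (hΦ : Measurable fun p : ℝ × ℝ => Φ p.1 p.2) :
    ∫⁻ x in Omega, Φ (x 1 / η - a) (x 2 / η - b) ≤
      ENNReal.ofReal (η ^ 2) * ∫⁻ s, ∫⁻ t, Φ s t := by
  set J : ℝ → ℝ≥0∞ := (Set.Ioo (0 : ℝ) 1).indicator 1 with hJ
  have hJm : Measurable J := measurable_one.indicator measurableSet_Ioo
  have hm : Measurable fun p : ℝ × ℝ × ℝ => J p.1 * Φ (p.2.1 / η - a) (p.2.2 / η - b) :=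
    (hJm.comp measurable_fst).mul (hΦ.comp (f := fun p : ℝ × ℝ × ℝ =>
      (p.2.1 / η - a, p.2.2 / η - b)) (by fun_prop))
  have h1 : ∫⁻ x in Omega, Φ (x 1 / η - a) (x 2 / η - b) ≤
      ∫⁻ x : R3, J (x 0) * Φ (x 1 / η - a) (x 2 / η - b) := by
    refine (setLIntegral_mono' ?_ fun x hx => ?_).trans (setLIntegral_le_lintegral Omega _)
    · have h : ∀ i : Fin 3, Measurable fun x : R3 => x i := fun i => by fun_prop
      exact ((h 0) measurableSet_Ioo).inter
        (((h 1) measurableSet_Ioo).inter ((h 2) measurableSet_Ioo))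
    · rw [hJ, Set.indicator_of_mem hx.1, Pi.one_apply, one_mul]
  refine h1.trans (le_of_eq ?_)
  rw [lintegral_R3 (F := fun p q r => J p * Φ (q / η - a) (r / η - b)) hm]
  have hΦs : ∀ s, Measurable (Φ s) := fun s => hΦ.comp measurable_prodMk_left
  have hΦi : Measurable fun s => ∫⁻ t, Φ s t := hΦ.lintegral_prod_right'
  have l1 : ∀ p, ∫⁻ q, ∫⁻ r, J p * Φ (q / η - a) (r / η - b) =
      J p * (ENNReal.ofReal η * (ENNReal.ofReal η * ∫⁻ s, ∫⁻ t, Φ s t)) := by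
    intro p
    have l2 : ∀ q, ∫⁻ r, J p * Φ (q / η - a) (r / η - b) =
        J p * (ENNReal.ofReal η * ∫⁻ t, Φ (q / η - a) t) := by
      intro q
      have hr : Measurable fun r => Φ (q / η - a) (r / η - b) :=
        (hΦs _).comp (f := fun r : ℝ => r / η - b) (by fun_prop)
      rw [lintegral_const_mul _ hr, lintegral_div_sub (hΦs _) hη]
    simp_rw [l2]
    have hq : Measurable fun q => ∫⁻ t, Φ (q / η - a) t :=
      hΦi.comp (f := fun q : ℝ => q / η - a) (by fun_prop)
    rw [lintegral_const_mul _ (hq.const_mul _), lintegral_const_mul _ hq,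
      lintegral_div_sub hΦi hη]
  simp_rw [l1]
  rw [lintegral_mul_const _ hJm, hJ, lintegral_indicator_one measurableSet_Ioo, Real.volume_Ioo,
    ENNReal.ofReal_pow hη.le]
  simp; ring

theorem ae_notMem_of_countable (T : R3 →L[ℝ] ℝ) (hT : T ≠ 0) {C : Set ℝ} (hC : C.Countable) :
    ∀ᵐ x : R3, T x ∉ C := by
  have h1 : ∀ c, volume {x : R3 | T x = c} = 0 := by
    intro c
    rcases Set.eq_empty_or_nonempty {x : R3 | T x = c} with h | ⟨v, hv⟩
    · rw [h, measure_empty]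
    · have hker : volume ((LinearMap.ker (T : R3 →ₗ[ℝ] ℝ) : Submodule ℝ R3) : Set R3) = 0 := by
        refine Measure.addHaar_submodule _ _ fun h => hT ?_
        ext x
        have : x ∈ LinearMap.ker (T : R3 →ₗ[ℝ] ℝ) := h ▸ Submodule.mem_top
        simpa using this
      rw [← measure_preimage_add volume (-v)] at hker
      refine measure_mono_null (fun x hx => ?_) hker
      simp only [Set.mem_ofPred_eq] at hv hx
      simp [hv, hx]
  rw [ae_iff]
  have : {x : R3 | ¬ T x ∉ C} = ⋃ c ∈ C, {x : R3 | T x = c} := by ext x; simp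
  rw [this]
  exact (measure_biUnion_null_iff hC).2 fun c _ => h1 c

/-! ### The logarithmic integral -/

theorem lintegral_inv_sq_add_sq {σ : ℝ} (hσ : 0 < σ) :
    ∫⁻ t, ENNReal.ofReal (2 / (σ ^ 2 + t ^ 2)) = ENNReal.ofReal (2 * Real.pi / σ) := by
  have hm : Measurable fun u : ℝ => ENNReal.ofReal ((1 + u ^ 2)⁻¹) := by fun_prop
  have e : ∀ t, ENNReal.ofReal (2 / (σ ^ 2 + t ^ 2)) =
      ENNReal.ofReal (2 / σ ^ 2) * ENNReal.ofReal ((1 + (t / σ - 0) ^ 2)⁻¹) := by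
    intro t
    rw [← ENNReal.ofReal_mul (by positivity)]
    congr 1
    field_simp
    simp
  simp_rw [e]
  rw [lintegral_const_mul _ (by fun_prop),
    lintegral_div_sub hm hσ, ← ofReal_integral_eq_lintegral_ofReal integrable_inv_one_add_sq
      (ae_of_all _ fun u => by positivity), integral_univ_inv_one_add_sq,
    ← ENNReal.ofReal_mul hσ.le, ← ENNReal.ofReal_mul (by positivity)]
  congr 1
  field_simp

theorem lintegral_inv_abs_add {δ : ℝ} (hδ : 0 < δ) (hδ2 : δ ≤ 1 / 2) :
    ∫⁻ s in Set.Ioc (-(1 / 2) : ℝ) (1 / 2), ENNReal.ofReal (1 / (|s| + δ)) ≤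
      ENNReal.ofReal (2 * |Real.log δ|) := by
  have hpos : ∀ s : ℝ, 0 < |s| + δ := fun s => by positivity
  have hc : Continuous fun s : ℝ => 1 / (|s| + δ) :=
    continuous_const.div (by fun_prop) fun s => (hpos s).ne'
  rw [← ofReal_integral_eq_lintegral_ofReal (hc.integrableOn_Ioc)
    (ae_of_all _ fun s => (by have := hpos s; positivity)),
    ← intervalIntegral.integral_of_le (by norm_num)]
  refine ENNReal.ofReal_le_ofReal ?_
  have half : ∫ s in (0 : ℝ)..(1 / 2), 1 / (|s| + δ) ≤ |Real.log δ| := by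
    have e : ∫ s in (0 : ℝ)..(1 / 2), 1 / (|s| + δ) = ∫ s in (0 : ℝ)..(1 / 2), 1 / (s + δ) := by
      refine intervalIntegral.integral_congr fun s hs => ?_
      rw [Set.uIcc_of_le (by norm_num)] at hs
      simp only [abs_of_nonneg hs.1]
    rw [e, intervalIntegral.integral_comp_add_right (fun x => 1 / x),
      integral_one_div_of_pos (by linarith) (by linarith)]
    refine le_trans ?_ (neg_le_abs _)
    rw [← Real.log_inv]
    refine Real.log_le_log (by positivity) ?_
    rw [div_le_iff₀ (by linarith), zero_add, inv_mul_cancel₀ hδ.ne']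
    linarith
  have hneg : ∫ s in (-(1 / 2) : ℝ)..0, 1 / (|s| + δ) = ∫ s in (0 : ℝ)..(1 / 2), 1 / (|s| + δ) := by
    have := intervalIntegral.integral_comp_neg (a := 0) (b := 1 / 2)
      (fun s : ℝ => 1 / (|s| + δ))
    simp only [abs_neg, neg_zero] at this
    exact this.symm
  rw [← intervalIntegral.integral_add_adjacent_intervals (b := 0)
    (hc.intervalIntegrable _ _) (hc.intervalIntegrable _ _), hneg]
  linarith

/-- The energy density of the field around one wire, regularized at the scale `δ` and cut off at the
lateral faces of the period cell. -/
def energyDensity (δ s t : ℝ) : ℝ≥0∞ :=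
  (Set.Ioc (-(1 / 2) : ℝ) (1 / 2)).indicator 1 s * ENNReal.ofReal (1 / max (max |s| |t|) δ ^ 2)

theorem measurable_energyDensity (δ : ℝ) :
    Measurable fun p : ℝ × ℝ => energyDensity δ p.1 p.2 := by
  refine Measurable.mul ?_ (by fun_prop)
  exact (measurable_one.indicator measurableSet_Ioc).comp measurable_fst

/-- The field energy of one wire grows logarithmically in the radius. -/
theorem lintegral_energyDensity_le {δ : ℝ} (hδ : 0 < δ) (hδ2 : δ ≤ 1 / 2) :
    ∫⁻ s, ∫⁻ t, energyDensity δ s t ≤ ENNReal.ofReal (8 * Real.pi * |Real.log δ|) := by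
  have inner : ∀ s, ∫⁻ t, energyDensity δ s t ≤
      (Set.Ioc (-(1 / 2) : ℝ) (1 / 2)).indicator
        (fun s => ENNReal.ofReal (4 * Real.pi) * ENNReal.ofReal (1 / (|s| + δ))) s := by
    intro s
    by_cases hs : s ∈ Set.Ioc (-(1 / 2) : ℝ) (1 / 2)
    · rw [Set.indicator_of_mem hs]
      -- `max |s| |t| δ` dominates both `(|s| + δ) / 2` and `|t|`; the integral in `t` is then explicit
      have hσ : 0 < (|s| + δ) / 2 := by positivity
      calc ∫⁻ t, energyDensity δ s t
          ≤ ∫⁻ t, ENNReal.ofReal (2 / (((|s| + δ) / 2) ^ 2 + t ^ 2)) := by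
            refine lintegral_mono fun t => ?_
            rw [energyDensity, Set.indicator_of_mem hs, Pi.one_apply, one_mul]
            refine ENNReal.ofReal_le_ofReal ?_
            have h1 : |s| ≤ max (max |s| |t|) δ := (le_max_left _ _).trans (le_max_left _ _)
            have h2 : |t| ≤ max (max |s| |t|) δ := (le_max_right _ _).trans (le_max_left _ _)
            have h3 : δ ≤ max (max |s| |t|) δ := le_max_right _ _
            set M := max (max |s| |t|) δ
            have hM : 0 < M := hδ.trans_le h3
            rw [div_le_div_iff₀ (by positivity) (by positivity)]
            have h4 : t ^ 2 ≤ M ^ 2 := by rw [← sq_abs]; gcongr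
            have h5 : ((|s| + δ) / 2) ^ 2 ≤ M ^ 2 := by gcongr; linarith
            linarith
        _ = ENNReal.ofReal (2 * Real.pi / ((|s| + δ) / 2)) := lintegral_inv_sq_add_sq hσ
        _ ≤ _ := by
            rw [← ENNReal.ofReal_mul (by positivity)]
            refine ENNReal.ofReal_le_ofReal (le_of_eq ?_)
            field_simp
            norm_num
    · rw [Set.indicator_of_notMem hs]
      simp only [energyDensity, Set.indicator_of_notMem hs, zero_mul, lintegral_zero, le_refl]
  refine (lintegral_mono inner).trans ?_
  rw [lintegral_indicator measurableSet_Ioc, lintegral_const_mul _ (by fun_prop)]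
  refine (mul_le_mul_right (lintegral_inv_abs_add hδ hδ2) _).trans ?_
  rw [← ENNReal.ofReal_mul (by positivity)]
  exact ENNReal.ofReal_le_ofReal (le_of_eq (by ring))

/-! ### Geometry of the perforated domains -/

theorem measurable_coord (i : Fin 3) : Measurable fun x : R3 => x i := by fun_prop

theorem continuous_coord (i : Fin 3) : Continuous fun x : R3 => x i := by fun_prop

theorem isOpen_Omega : IsOpen Omega :=
  (isOpen_Ioo.preimage (continuous_coord 0)).inter
    ((isOpen_Ioo.preimage (continuous_coord 1)).inter (isOpen_Ioo.preimage (continuous_coord 2)))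

theorem isOpen_OmegaPlus : IsOpen OmegaPlus :=
  (isOpen_Ioo.preimage (continuous_coord 0)).inter
    ((isOpen_Ioo.preimage (continuous_coord 1)).inter (isOpen_Ioo.preimage (continuous_coord 2)))

theorem isOpen_OmegaMinus : IsOpen OmegaMinus :=
  (isOpen_Ioo.preimage (continuous_coord 0)).inter
    ((isOpen_Ioo.preimage (continuous_coord 1)).inter (isOpen_Ioo.preimage (continuous_coord 2)))

theorem convex_coord {S : Set ℝ} (hS : Convex ℝ S) (i : Fin 3) : Convex ℝ {x : R3 | x i ∈ S} :=
  hS.linear_preimage (coordR i : R3 →ₗ[ℝ] ℝ)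

theorem convex_Omega : Convex ℝ Omega :=
  (convex_coord (convex_Ioo _ _) 0).inter
    ((convex_coord (convex_Ioo _ _) 1).inter (convex_coord (convex_Ioo _ _) 2))

theorem convex_OmegaPlus : Convex ℝ OmegaPlus :=
  (convex_coord (convex_Ioo _ _) 0).inter
    ((convex_coord (convex_Ioo _ _) 1).inter (convex_coord (convex_Ioo _ _) 2))

theorem convex_OmegaMinus : Convex ℝ OmegaMinus :=
  (convex_coord (convex_Ioo _ _) 0).inter
    ((convex_coord (convex_Ioo _ _) 1).inter (convex_coord (convex_Ioo _ _) 2))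

theorem OmegaPlus_subset : OmegaPlus ⊆ Omega := fun _ hx =>
  ⟨hx.1, hx.2.1, by linarith [hx.2.2.1], hx.2.2.2⟩

theorem OmegaMinus_subset : OmegaMinus ⊆ Omega := fun _ hx =>
  ⟨hx.1, hx.2.1, hx.2.2.1, by linarith [hx.2.2.2]⟩

theorem norm_lt_two_of_mem_Omega {x : R3} (hx : x ∈ Omega) : ‖x‖ < 2 := by
  obtain ⟨⟨h1, h2⟩, ⟨h3, h4⟩, h5, h6⟩ := hx
  rw [EuclideanSpace.norm_eq, Fin.sum_univ_three, Real.sqrt_lt' (by norm_num)]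
  simp only [Real.norm_eq_abs, sq_abs]
  nlinarith

theorem isBounded_Omega : Bornology.IsBounded Omega :=
  isBounded_iff_forall_norm_le.2 ⟨2, fun _ hx => (norm_lt_two_of_mem_Omega hx).le⟩

theorem volume_Omega_ne_top : volume Omega ≠ ⊤ := isBounded_Omega.measure_lt_top.ne

theorem measurableSet_Omega : MeasurableSet Omega := isOpen_Omega.measurableSet

theorem measurableSet_perforated {η : ℝ} (hη : η ≠ 0) {S : Set R3} (hS : IsClosed S) :
    MeasurableSet (perforated η S) := by
  refine measurableSet_Omega.diff (MeasurableSet.inter ?_ measurableSet_Omega)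
  refine ((MeasurableEquiv.smul₀ η hη).measurableSet_image).2 (MeasurableSet.iUnion fun k => ?_)
  exact ((Homeomorph.addLeft (!₂[(k.1 : ℝ), (k.2 : ℝ), 0] : R3)).isClosed_image.2 hS).measurableSet

theorem perforated_subset (η : ℝ) (S : Set R3) : perforated η S ⊆ Omega := Set.sdiff_subset

/-- The admissible disc stays inside the unit square; in particular `R < 1/2`. -/
theorem disc_bounds {z₀ : R2} {R : ℝ} (hR : Metric.closedBall z₀ R ⊆ crossSection) (h0 : 0 < R) :
    (R < z₀ 0 ∧ z₀ 0 + R < 1) ∧ (R < z₀ 1 ∧ z₀ 1 + R < 1) := by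
  have h : ∀ (i : Fin 2) (t : ℝ), |t| = R → z₀ + EuclideanSpace.single i t ∈ crossSection := by
    intro i t ht
    apply hR
    rw [Metric.mem_closedBall, dist_eq_norm]
    simp [ht]
  have a1 := h 0 R (abs_of_pos h0)
  have a2 := h 0 (-R) (by rw [abs_neg, abs_of_pos h0])
  have a3 := h 1 R (abs_of_pos h0)
  have a4 := h 1 (-R) (by rw [abs_neg, abs_of_pos h0])
  simp only [crossSection, Set.mem_Ioo, Set.mem_ofPred_eq, PiLp.add_apply,
    PiLp.single_apply] at a1 a2 a3 a4
  simp at a1 a2 a3 a4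
  refine ⟨⟨?_, ?_⟩, ?_, ?_⟩ <;> linarith

/-- First microscopic cross-section coordinate, relative to the `k`-th wire. -/
def offset (η : ℝ) (z₀ : R2) (k : ℤ) (x : R3) : ℝ := x 1 / η - (k + z₀ 0)

/-- Second microscopic cross-section coordinate, relative to the layer of wires. -/
def height (η : ℝ) (z₀ : R2) (x : R3) : ℝ := x 2 / η - z₀ 1

/-- A finite set of cell indices that contains all cells meeting `Ω`. -/
def cells (η : ℝ) : Finset ℤ := Finset.Icc (-((⌈1 / η⌉₊ : ℤ) + 2)) ((⌈1 / η⌉₊ : ℤ) + 2)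

theorem card_cells_le {η : ℝ} (hη : 0 < η) (hη1 : η ≤ 1) : ((cells η).card : ℝ) ≤ 9 / η := by
  have h1 : (⌈1 / η⌉₊ : ℝ) < 1 / η + 1 := Nat.ceil_lt_add_one (by positivity)
  have h2 : ((cells η).card : ℝ) = 2 * ⌈1 / η⌉₊ + 5 := by
    rw [cells, Int.card_Icc]
    have : ((⌈1 / η⌉₊ : ℤ) + 2 + 1 - -((⌈1 / η⌉₊ : ℤ) + 2)).toNat = 2 * ⌈1 / η⌉₊ + 5 := by omega
    rw [this]; push_cast; ring
  have h3 : 1 ≤ 1 / η := by rw [le_div_iff₀ hη]; linarith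
  have h4 : 9 / η = 9 * (1 / η) := by ring
  rw [h2, h4]; linarith

theorem mem_cells {η : ℝ} (hη : 0 < η) {t : ℝ} (ht : t ∈ Set.Ioo (0 : ℝ) 1) {k : ℤ} {a : ℝ}
    (ha : a ∈ Set.Ico (0 : ℝ) 1) (h : |t / η - (k + a)| ≤ 1) : k ∈ cells η := by
  have h1 : 0 < t / η := div_pos ht.1 hη
  have h2 : t / η < 1 / η := by gcongr; exact ht.2
  have h3 : (1 : ℝ) / η ≤ ⌈1 / η⌉₊ := Nat.le_ceil _
  rw [abs_le] at h
  have l : -((⌈1 / η⌉₊ : ℝ) + 2) ≤ k := by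
    have : (0 : ℝ) ≤ ⌈1 / η⌉₊ := Nat.cast_nonneg _
    linarith [ha.1, ha.2]
  have u : (k : ℝ) ≤ (⌈1 / η⌉₊ : ℝ) + 2 := by linarith [ha.1, ha.2]
  rw [cells, Finset.mem_Icc]
  constructor
  · exact_mod_cast l
  · exact_mod_cast u

theorem closure_wire_subset (z₀ : R2) (r : ℝ) (I : Set ℝ) :
    wireObstacle z₀ r I ⊆ {y | |y 1 - z₀ 0| ≤ r ∧ |y 2 - z₀ 1| ≤ r} := by
  refine closure_minimal (fun y hy => ?_) ?_
  · have h := Metric.mem_ball.1 hy.2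
    rw [dist_eq_norm] at h
    have h0 := (PiLp.norm_apply_le (!₂[y 1, y 2] - z₀) 0).trans h.le
    have h1 := (PiLp.norm_apply_le (!₂[y 1, y 2] - z₀) 1).trans h.le
    exact ⟨by simpa using h0, by simpa using h1⟩
  · have c1 : Continuous fun y : R3 => |y 1 - z₀ 0| := by fun_prop
    have c2 : Continuous fun y : R3 => |y 2 - z₀ 1| := by fun_prop
    exact (isClosed_le c1 continuous_const).inter (isClosed_le c2 continuous_const)

/-- Every point of the inclusion lies in one of the closed tubes around the wires. -/
theorem exists_offset_le_of_mem_inclusion {η : ℝ} (hη : 0 < η) {z₀ : R2} {r : ℝ} {I : Set ℝ}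
    {x : R3} (hx : x ∈ inclusion η (wireObstacle z₀ r I)) :
    ∃ k : ℤ, |offset η z₀ k x| ≤ r ∧ |height η z₀ x| ≤ r := by
  obtain ⟨⟨y, hy, rfl⟩, -⟩ := hx
  obtain ⟨k, w, hw, rfl⟩ := Set.mem_iUnion.1 hy
  obtain ⟨h1, h2⟩ := closure_wire_subset z₀ r I hw
  refine ⟨k.2, ?_, ?_⟩
  · have : offset η z₀ k.2 (η • ((!₂[(k.1 : ℝ), (k.2 : ℝ), 0] : R3) + w)) = w 1 - z₀ 0 := by
      simp [offset]; field_simp; ring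
    simp only [this, h1]
  · have : height η z₀ (η • ((!₂[(k.1 : ℝ), (k.2 : ℝ), 0] : R3) + w)) = w 2 - z₀ 1 := by
      simp [height]; field_simp
    simp only [this, h2]

/-- Away from the gaps and from the cell faces, a square tube around each wire is contained in the
inclusion. -/
theorem mem_inclusion_of_offset_le {η : ℝ} (hη : 0 < η) {z₀ : R2} {r : ℝ} (hr : 0 < r) {I : Set ℝ}
    {x : R3} (hx : x ∈ Omega) {k : ℤ} (h1 : |offset η z₀ k x| ≤ r / 2)
    (h2 : |height η z₀ x| ≤ r / 2) (h3 : Int.fract (x 0 / η) ∉ I) (h4 : Int.fract (x 0 / η) ≠ 0) :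
    x ∈ inclusion η (wireObstacle z₀ r I) := by
  refine ⟨⟨η⁻¹ • x, Set.mem_iUnion.2 ⟨(⌊x 0 / η⌋, k),
    !₂[Int.fract (x 0 / η), x 1 / η - k, x 2 / η], subset_closure ⟨⟨⟨?_, ?_⟩, ?_⟩, ?_⟩, ?_⟩, ?_⟩, hx⟩
  · exact lt_of_le_of_ne (Int.fract_nonneg _) h4.symm
  · exact Int.fract_lt_one _
  · exact h3
  · rw [Metric.mem_ball, dist_eq_norm, EuclideanSpace.norm_eq, Fin.sum_univ_two,
      Real.sqrt_lt' hr]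
    simp only [Real.norm_eq_abs, sq_abs]
    have e1 : (x 1 / η - k - z₀ 0) ^ 2 ≤ (r / 2) ^ 2 := by
      rw [← sq_abs]
      have : x 1 / η - k - z₀ 0 = offset η z₀ k x := by rw [offset]; ring
      rw [this]; gcongr
    have e2 : (x 2 / η - z₀ 1) ^ 2 ≤ (r / 2) ^ 2 := by
      rw [← sq_abs]
      have : x 2 / η - z₀ 1 = height η z₀ x := rfl
      rw [this]; gcongr
    have e3 : (r / 2) ^ 2 + (r / 2) ^ 2 < r ^ 2 := by nlinarith
    simpa using (add_le_add e1 e2).trans_lt e3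
  · ext i
    fin_cases i
    · simp [div_eq_inv_mul, Int.floor_add_fract]
    · simp [div_eq_inv_mul]
    · simp [div_eq_inv_mul]
  · simp [smul_smul, mul_inv_cancel₀ hη.ne']

/-- The layer around `Γ` outside of which the test fields need no correction. -/
def slab (η : ℝ) : Set R3 := {x | |x 2| ≤ 3 * η}

theorem measurableSet_slab (η : ℝ) : MeasurableSet (slab η) :=
  (measurable_coord 2).abs measurableSet_Iic

theorem mem_slab_of_height_le {η : ℝ} (hη : 0 < η) {z₀ : R2} (hz : z₀ 1 ∈ Set.Ioo (0 : ℝ) 1)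
    {x : R3} (h : |height η z₀ x| ≤ 2) : x ∈ slab η := by
  rw [height, abs_le] at h
  have e : x 2 = η * (x 2 / η) := by field_simp
  change |x 2| ≤ 3 * η
  rw [abs_le, e]
  constructor
  · nlinarith [hz.1, hz.2]
  · nlinarith [hz.1, hz.2]

theorem volume_slab_le (η : ℝ) :
    volume (Omega ∩ slab η) ≤ ENNReal.ofReal (6 * η) := by
  have h := volume_box one_pos 0 0 0 (measurableSet_Ioo (a := (0 : ℝ)) (b := 1))
    (measurableSet_Ioo (a := (0 : ℝ)) (b := 1)) (measurableSet_Icc (a := -(3 * η)) (b := 3 * η))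
  refine (measure_mono fun x hx => ?_).trans (h.le.trans (le_of_eq ?_))
  · have h1 := hx.1.1
    have h2 := hx.1.2.1
    have h3 := abs_le.1 (show |x 2| ≤ 3 * η from hx.2)
    simpa using ⟨h1, h2, h3⟩
  · rw [Real.volume_Ioo, Real.volume_Icc, sub_zero, one_pow, ENNReal.ofReal_one, one_mul, one_mul,
      one_mul]
    congr 1
    ring

/-- The part of `Ω` inside the square tubes of half-width `δ` around the wires, over the gaps. -/
def gapSet (η : ℝ) (z₀ : R2) (δ : ℝ) (I : Set ℝ) : Set R3 :=
  {x | x ∈ Omega ∧ Int.fract (x 0 / η) ∈ I ∧ |height η z₀ x| ≤ δ ∧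
    ∃ k ∈ cells η, |offset η z₀ k x| ≤ δ}

theorem volume_gapSet_le {η : ℝ} (hη : 0 < η) (hη1 : η ≤ 1) (z₀ : R2) {δ : ℝ} (hδ : 0 < δ)
    {I : Set ℝ} (hI : MeasurableSet I) :
    volume (gapSet η z₀ δ I) ≤ ENNReal.ofReal (324 * η * δ ^ 2) * volume I := by
  let box : ℤ → ℤ → Set R3 := fun j k => {x | x 0 / η - j ∈ I ∧
    x 1 / η - (k + z₀ 0) ∈ Set.Icc (-δ) δ ∧ x 2 / η - z₀ 1 ∈ Set.Icc (-δ) δ}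
  have hsub : gapSet η z₀ δ I ⊆ ⋃ j ∈ cells η, ⋃ k ∈ cells η, box j k := by
    rintro x ⟨hx, hf, hh, k, hk, hs⟩
    have hj : ⌊x 0 / η⌋ ∈ cells η := by
      refine mem_cells hη hx.1 (a := 0) ⟨le_rfl, one_pos⟩ ?_
      have : x 0 / η - (⌊x 0 / η⌋ + 0) = Int.fract (x 0 / η) := by rw [add_zero]; rfl
      rw [this, abs_of_nonneg (Int.fract_nonneg _)]
      exact (Int.fract_lt_one _).le
    simp only [Set.mem_iUnion]
    exact ⟨_, hj, k, hk, hf, abs_le.1 hs, abs_le.1 hh⟩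
  have hbox : ∀ j k, volume (box j k) = ENNReal.ofReal (4 * η ^ 3 * δ ^ 2) * volume I := by
    intro j k
    rw [volume_box hη j (k + z₀ 0) (z₀ 1) hI measurableSet_Icc measurableSet_Icc, Real.volume_Icc,
      mul_assoc (volume I), mul_comm (volume I), ← mul_assoc,
      ← ENNReal.ofReal_mul (by linarith), ← ENNReal.ofReal_mul (by positivity)]
    congr 2
    ring
  have hc := card_cells_le hη hη1
  refine (measure_mono hsub).trans ((measure_biUnion_finset_le _ _).trans ?_)
  calc ∑ j ∈ cells η, volume (⋃ k ∈ cells η, box j k)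
      ≤ ∑ j ∈ cells η, ∑ k ∈ cells η, volume (box j k) :=
        Finset.sum_le_sum fun j _ => measure_biUnion_finset_le _ _
    _ = ENNReal.ofReal ((cells η).card * ((cells η).card * (4 * η ^ 3 * δ ^ 2))) * volume I := by
        simp only [hbox, Finset.sum_const, nsmul_eq_mul]
        rw [ENNReal.ofReal_mul (Nat.cast_nonneg _),
          ENNReal.ofReal_mul (p := ((cells η).card : ℝ)) (Nat.cast_nonneg _),
          ENNReal.ofReal_natCast]
        ring
    _ ≤ _ := by
        refine mul_le_mul_left (ENNReal.ofReal_le_ofReal ?_) _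
        calc ((cells η).card : ℝ) * ((cells η).card * (4 * η ^ 3 * δ ^ 2))
            ≤ (9 / η) * ((9 / η) * (4 * η ^ 3 * δ ^ 2)) := by gcongr
          _ = 324 * η * δ ^ 2 := by field_simp; norm_num

/-! ### Criteria for strong convergence -/

theorem strongConvL2_of_sq_le {U : Set R3} {g : ℕ → R3 → C3} {g' : R3 → C3}
    (hg : ∀ n, InL2 U (g n)) (hg' : InL2 U g') {F : ℕ → R3 → ℝ≥0∞}
    (hF : ∀ᶠ n in atTop, ∀ᵐ x ∂volume.restrict U, ‖g n x - g' x‖ₑ ^ 2 ≤ F n x)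
    (hlim : Tendsto (fun n => ∫⁻ x in U, F n x) atTop (𝓝 0)) : StrongConvL2 U g g' := by
  refine ⟨hg, hg', ?_⟩
  have h1 : Tendsto (fun n => (∫⁻ x in U, F n x) ^ (1 / 2 : ℝ)) atTop (𝓝 0) := by
    have := hlim.ennrpow_const (1 / 2 : ℝ)
    rwa [ENNReal.zero_rpow_of_pos (by norm_num)] at this
  refine tendsto_of_tendsto_of_tendsto_of_le_of_le' tendsto_const_nhds h1
    (Eventually.of_forall fun _ => zero_le) ?_
  filter_upwards [hF] with n hn
  rw [eLpNorm_eq_lintegral_rpow_enorm_toReal (by norm_num) (by norm_num)]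
  simp only [ENNReal.toReal_ofNat]
  refine ENNReal.rpow_le_rpow (lintegral_mono_ae ?_) (by norm_num)
  filter_upwards [hn] with x hx
  simpa using hx

theorem enorm_sq_le_ofReal {v : C3} {a : ℝ} (h : ‖v‖ ≤ a) : ‖v‖ₑ ^ 2 ≤ ENNReal.ofReal (a ^ 2) := by
  rw [← ofReal_norm, ← ENNReal.ofReal_pow (norm_nonneg _)]
  exact ENNReal.ofReal_le_ofReal (by gcongr)

theorem tendsto_lintegral_slab {η : ℕ → ℝ} (hη0 : Tendsto η atTop (𝓝 0))
    (C : ℝ) : Tendsto (fun n => ∫⁻ x in Omega, (slab (η n)).indicator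
      (fun _ => ENNReal.ofReal C) x) atTop (𝓝 0) := by
  have h1 : Tendsto (fun n => ENNReal.ofReal C * ENNReal.ofReal (6 * η n)) atTop (𝓝 0) := by
    have h2 : Tendsto (fun n => ENNReal.ofReal (6 * η n)) atTop (𝓝 0) := by
      have := ENNReal.tendsto_ofReal (hη0.const_mul 6)
      simpa using this
    have := ENNReal.Tendsto.const_mul (a := ENNReal.ofReal C) h2 (Or.inr ENNReal.ofReal_ne_top)
    simpa using this
  refine tendsto_of_tendsto_of_tendsto_of_le_of_le tendsto_const_nhds h1 (fun _ => zero_le)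
    fun n => ?_
  change ∫⁻ x in Omega, (slab (η n)).indicator (fun _ => ENNReal.ofReal C) x ≤ _
  rw [lintegral_indicator_const (measurableSet_slab _), Measure.restrict_apply
    (measurableSet_slab _), Set.inter_comm]
  gcongr
  exact volume_slab_le (η n)

/-- Uniformly bounded corrections that are supported in the slab converge strongly to zero. -/
theorem strongConvL2_of_slab {η : ℕ → ℝ} (hη0 : Tendsto η atTop (𝓝 0))
    {g : ℕ → R3 → C3} {g' : R3 → C3} (hg : ∀ n, InL2 Omega (g n)) (hg' : InL2 Omega g') {C : ℝ}
    (hC : ∀ n, ∀ᵐ x : R3, x ∈ Omega → x ∈ slab (η n) → ‖g n x - g' x‖ ≤ C)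
    (h0 : ∀ n x, x ∈ Omega → x ∉ slab (η n) → g n x = g' x) : StrongConvL2 Omega g g' := by
  refine strongConvL2_of_sq_le hg hg' (F := fun n => (slab (η n)).indicator
      (fun _ => ENNReal.ofReal (C ^ 2))) (Eventually.of_forall fun n => ?_)
    (tendsto_lintegral_slab hη0 _)
  rw [ae_restrict_iff' measurableSet_Omega]
  filter_upwards [hC n] with x hx hxΩ
  by_cases hs : x ∈ slab (η n)
  · rw [Set.indicator_of_mem hs]
    exact enorm_sq_le_ofReal (hx hxΩ hs)
  · rw [h0 n x hxΩ hs]; simp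

/-! ### Extension of macroscopic test fields -/

/-- The product of Lipschitz maps is Lipschitz if `f` is bounded and `g` is bounded where `f` does
not vanish. -/
theorem exists_lipschitzWith_smul_of_bdd_on {X 𝕜 E : Type*} [PseudoMetricSpace X] [NormedField 𝕜]
    [NormedAddCommGroup E] [NormedSpace 𝕜 E] {f : X → 𝕜} {g : X → E} {K L : NNReal} {A B : ℝ}
    (hf : LipschitzWith K f) (hg : LipschitzWith L g) (hA : ∀ x, ‖f x‖ ≤ A)
    (hB : ∀ x, f x ≠ 0 → ‖g x‖ ≤ B) : ∃ M, LipschitzWith M (fun x => f x • g x) := by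
  have key : ∀ x y, f x ≠ 0 →
      ‖f x • g x - f y • g y‖ ≤ (|A| * L + K * |B|) * dist x y := by
    intro x y hx
    have e : f x • g x - f y • g y = f y • (g x - g y) + (f x - f y) • g x := by
      rw [smul_sub, sub_smul]; abel
    have h1 : ‖g x - g y‖ ≤ L * dist x y := by
      rw [← dist_eq_norm]; exact hg.dist_le_mul x y
    have h2 : ‖f x - f y‖ ≤ K * dist x y := by
      rw [← dist_eq_norm]; exact hf.dist_le_mul x y
    have h3 : ‖f y‖ ≤ |A| := (hA y).trans (le_abs_self A)
    have h4 : ‖g x‖ ≤ |B| := (hB x hx).trans (le_abs_self B)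
    calc ‖f x • g x - f y • g y‖ ≤ ‖f y‖ * ‖g x - g y‖ + ‖f x - f y‖ * ‖g x‖ := by
          rw [e]; exact (norm_add_le _ _).trans (by rw [norm_smul, norm_smul])
      _ ≤ |A| * (L * dist x y) + (K * dist x y) * |B| := by gcongr
      _ = _ := by ring
  refine ⟨⟨|A| * L + K * |B|, by positivity⟩, LipschitzWith.of_dist_le_mul fun x y => ?_⟩
  rw [dist_eq_norm]
  change _ ≤ (|A| * L + K * |B|) * dist x y
  by_cases hx : f x = 0
  · by_cases hy : f y = 0
    · rw [hx, hy]; simp; positivity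
    · rw [← norm_neg, neg_sub, dist_comm]; exact key y x hy
  · exact key x y hx

/-- A `C¹` field with bounded derivative on a convex open subset of `Ω` is the restriction of a
bounded Lipschitz field on `ℝ³`. -/
theorem IsC1Bdd.exists_bddLip {U : Set R3} (hU : IsOpen U) (hc : Convex ℝ U) (hΩ : U ⊆ Omega)
    {u : R3 → C3} (hu : IsC1Bdd U u) : ∃ v : R3 → C3, BddLip v ∧ Set.EqOn v u U := by
  obtain ⟨C, hC⟩ := hu.bdd
  have hd : ∀ x ∈ U, DifferentiableAt ℝ u x := fun x hx =>
    (hu.contDiffOn.differentiableOn one_ne_zero).differentiableAt (hU.mem_nhds hx)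
  have hL : LipschitzOnWith C.toNNReal u U :=
    hc.lipschitzOnWith_of_nnnorm_fderiv_le hd fun x hx => by
      rw [← NNReal.coe_le_coe, coe_nnnorm]
      exact (hC x hx).trans (Real.le_coe_toNNReal C)
  obtain ⟨w, hw, hwu⟩ := hL.extend_finite_dimension
  -- multiply the extension by a cut-off that equals `1` on the ball of radius `2`
  have hr : LipschitzWith (1 * (0 + 1)) (fun x : R3 => ramp (4 - ‖x‖)) :=
    lipschitzWith_ramp.comp ((LipschitzWith.const (4 : ℝ)).sub lipschitzWith_one_norm)
  have hsupp : ∀ x : R3, ramp (4 - ‖x‖) ≠ 0 → x ∈ Metric.closedBall (0 : R3) 3 := by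
    intro x hx
    rw [mem_closedBall_zero_iff]
    by_contra h
    exact hx (ramp_of_le (by linarith))
  obtain ⟨B, hB⟩ := (isCompact_closedBall (0 : R3) 3).exists_bound_of_continuousOn
    hw.continuous.continuousOn
  refine ⟨fun x => ramp (4 - ‖x‖) • w x, ⟨exists_lipschitzWith_smul_of_bdd_on hr hw
    (fun x => norm_ramp_le _) fun x hx => hB x (hsupp x hx), |B|, fun x => ?_⟩, fun x hx => ?_⟩
  · by_cases h : ramp (4 - ‖x‖) = 0
    · rw [h, zero_smul, norm_zero]; exact abs_nonneg B
    · rw [norm_smul]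
      have h1 := mul_le_mul (norm_ramp_le (4 - ‖x‖)) (hB x (hsupp x h)) (norm_nonneg _) zero_le_one
      linarith [le_abs_self B]
  · have := norm_lt_two_of_mem_Omega (hΩ hx)
    simp only
    rw [ramp_of_ge (by linarith), one_smul, ← hwu hx]

/-- The extension by zero of a field with zero boundary values is bounded and Lipschitz on `ℝ³`. -/
theorem MemXMinus.bddLip_indicator {φ : R3 → C3} (hφ : MemXMinus φ) :
    BddLip (Omega.indicator φ) := by
  obtain ⟨v, ⟨⟨K, hK⟩, B, hB⟩, hv⟩ := hφ.isC1.exists_bddLip isOpen_Omega convex_Omega le_rfl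
  have hfr : ∀ x ∈ frontier Omega, v x = 0 := by
    intro x hx
    have : (𝓝[Omega] x).NeBot := mem_closure_iff_nhdsWithin_neBot.1 (frontier_subset_closure hx)
    refine tendsto_nhds_unique ((hK.continuous.tendsto x).mono_left nhdsWithin_le_nhds)
      ((hφ.boundary x hx).congr' ?_)
    filter_upwards [self_mem_nhdsWithin] with y hy
    exact (hv hy).symm
  have hne : Omega ≠ Set.univ := by
    intro h
    have : (0 : R3) ∈ Omega := h ▸ Set.mem_univ _
    simpa using this.1.1
  have key : ∀ x y, x ∈ Omega → y ∉ Omega → ‖φ x‖ ≤ K * dist x y := by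
    intro x y hx hy
    obtain ⟨z, hz, hd⟩ := exists_mem_frontier_infDist_compl_eq_dist hx hne
    have h1 := hK.dist_le_mul x z
    rw [hfr z hz, dist_zero_right, hv hx, ← hd] at h1
    exact h1.trans (by gcongr; exact Metric.infDist_le_dist_of_mem hy)
  refine ⟨⟨K, LipschitzWith.of_dist_le_mul fun x y => ?_⟩, |B|, fun x => ?_⟩
  · by_cases hx : x ∈ Omega <;> by_cases hy : y ∈ Omega
    · rw [Set.indicator_of_mem hx, Set.indicator_of_mem hy, ← hv hx, ← hv hy]
      exact hK.dist_le_mul x y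
    · rw [Set.indicator_of_mem hx, Set.indicator_of_notMem hy, dist_zero_right]
      exact key x y hx hy
    · rw [Set.indicator_of_notMem hx, Set.indicator_of_mem hy, dist_zero_left, dist_comm]
      exact key y x hy hx
    · rw [Set.indicator_of_notMem hx, Set.indicator_of_notMem hy, dist_self]; positivity
  · by_cases hx : x ∈ Omega
    · rw [Set.indicator_of_mem hx, ← hv hx]; exact (hB x).trans (le_abs_self B)
    · rw [Set.indicator_of_notMem hx, norm_zero]; exact abs_nonneg B

/-! ### Fields given by components -/

/-- The field with components `f, g, h`. -/
def vecField (f g h : R3 → ℂ) (x : R3) : C3 := !₂[f x, g x, h x]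

theorem BddLip.vecField {f g h : R3 → ℂ} (hf : BddLip f) (hg : BddLip g) (hh : BddLip h) :
    BddLip (vecField f g h) := by
  have e : MaxwellWires.vecField f g h = fun x => f x • (EuclideanSpace.single 0 1 : C3) +
      g x • (EuclideanSpace.single 1 1 : C3) + h x • (EuclideanSpace.single 2 1 : C3) := by
    funext x; ext i; fin_cases i <;> simp [MaxwellWires.vecField]
  rw [e]
  exact ((hf.smul (BddLip.const _)).add (hg.smul (BddLip.const _))).add (hh.smul (BddLip.const _))

theorem differentiableAt_vecField {f g h : R3 → ℂ} {x : R3} (hf : DifferentiableAt ℝ f x)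
    (hg : DifferentiableAt ℝ g x) (hh : DifferentiableAt ℝ h x) :
    DifferentiableAt ℝ (vecField f g h) x := by
  have e : vecField f g h = fun x => f x • (EuclideanSpace.single 0 1 : C3) +
      g x • (EuclideanSpace.single 1 1 : C3) + h x • (EuclideanSpace.single 2 1 : C3) := by
    funext x; ext i; fin_cases i <;> simp [vecField]
  rw [e]
  exact ((hf.smul_const _).add (hg.smul_const _)).add (hh.smul_const _)

theorem curl_vecField {f g h : R3 → ℂ} {x : R3} (hf : DifferentiableAt ℝ f x)
    (hg : DifferentiableAt ℝ g x) (hh : DifferentiableAt ℝ h x) :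
    curl (vecField f g h) x = !₂[partialD 1 h x - partialD 2 g x,
      partialD 2 f x - partialD 0 h x, partialD 0 g x - partialD 1 f x] := by
  simp only [curl, pd_eq_partialD (differentiableAt_vecField hf hg hh)]
  rfl

theorem norm_vec_le {a b c : ℂ} {A B C : ℝ} (ha : ‖a‖ ≤ A) (hb : ‖b‖ ≤ B) (hc : ‖c‖ ≤ C) :
    ‖(!₂[a, b, c] : C3)‖ ≤ A + B + C :=
  (norm_C3_le _).trans (add_le_add (add_le_add ha hb) hc)

theorem BddLip.ae_differentiableAt {f : R3 → ℂ} (hf : BddLip f) :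
    ∀ᵐ x : R3, DifferentiableAt ℝ f x :=
  let ⟨_, hK⟩ := hf.lip
  hK.ae_differentiableAt

theorem partialD_eq_zero_of_const {f : R3 → ℂ} {j : Fin 3}
    (h : ∀ (x : R3) (t : ℝ), f (x + t • e3 j) = f x) (x : R3) : partialD j f x = 0 := by
  rw [partialD]
  by_cases hd : DifferentiableAt ℝ f x
  · rw [← hd.lineDeriv_eq_fderiv, lineDeriv]
    simp [h]
  · rw [fderiv_zero_of_not_differentiableAt hd]; rfl

theorem partialD_eq_of_hasDerivAt {f : R3 → ℂ} {j : Fin 3} {x : R3} {c : ℂ}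
    (hd : DifferentiableAt ℝ f x) (h : HasDerivAt (fun t : ℝ => f (x + t • e3 j)) c 0) :
    partialD j f x = c := by
  rw [partialD, ← hd.lineDeriv_eq_fderiv, lineDeriv]
  exact h.deriv

theorem partialD_add {f g : R3 → ℂ} {x : R3} (hf : DifferentiableAt ℝ f x)
    (hg : DifferentiableAt ℝ g x) (j : Fin 3) :
    partialD j (fun y => f y + g y) x = partialD j f x + partialD j g x := by
  rw [partialD, fderiv_fun_add hf hg]; rfl

theorem offset_line_one (η : ℝ) (z₀ : R2) (k : ℤ) (x : R3) (t : ℝ) :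
    offset η z₀ k (x + t • e3 1) = offset η z₀ k x + t / η := by
  simp [offset]; ring

theorem offset_line_two (η : ℝ) (z₀ : R2) (k : ℤ) (x : R3) (t : ℝ) :
    offset η z₀ k (x + t • e3 2) = offset η z₀ k x := by
  simp [offset]

theorem offset_line_zero (η : ℝ) (z₀ : R2) (k : ℤ) (x : R3) (t : ℝ) :
    offset η z₀ k (x + t • e3 0) = offset η z₀ k x := by
  simp [offset]

theorem height_line_zero (η : ℝ) (z₀ : R2) (x : R3) (t : ℝ) :
    height η z₀ (x + t • e3 0) = height η z₀ x := by
  simp [height]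

theorem height_line_one (η : ℝ) (z₀ : R2) (x : R3) (t : ℝ) :
    height η z₀ (x + t • e3 1) = height η z₀ x := by
  simp [height]

theorem height_line_two (η : ℝ) (z₀ : R2) (x : R3) (t : ℝ) :
    height η z₀ (x + t • e3 2) = height η z₀ x + t / η := by
  simp [height]; ring

theorem dist_coord_le (x y : R3) (i : Fin 3) : |x i - y i| ≤ dist x y := by
  rw [dist_eq_norm]; exact PiLp.norm_apply_le (x - y) i

theorem lipschitzWith_offset {η : ℝ} (hη : 0 < η) (z₀ : R2) (k : ℤ) :
    LipschitzWith (Real.toNNReal (1 / η)) (offset η z₀ k) := by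
  refine LipschitzWith.of_dist_le_mul fun x y => ?_
  rw [Real.coe_toNNReal _ (by positivity), Real.dist_eq, offset, offset]
  have : x 1 / η - (k + z₀ 0) - (y 1 / η - (k + z₀ 0)) = 1 / η * (x 1 - y 1) := by ring
  rw [this, abs_mul, abs_of_pos (by positivity : 0 < 1 / η)]
  gcongr
  exact dist_coord_le x y 1

theorem lipschitzWith_height {η : ℝ} (hη : 0 < η) (z₀ : R2) :
    LipschitzWith (Real.toNNReal (1 / η)) (height η z₀) := by
  refine LipschitzWith.of_dist_le_mul fun x y => ?_
  rw [Real.coe_toNNReal _ (by positivity), Real.dist_eq, height, height]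
  have : x 2 / η - z₀ 1 - (y 2 / η - z₀ 1) = 1 / η * (x 2 - y 2) := by ring
  rw [this, abs_mul, abs_of_pos (by positivity : 0 < 1 / η)]
  gcongr
  exact dist_coord_le x y 2

/-- At most one cell contributes: if `f` vanishes outside `(-1/2, 1/2)`, a sum over the offsets
to the wires has at most one nonzero term. -/
theorem sum_offset_eq {E : Type*} [AddCommMonoid E] (S : Finset ℤ) {η : ℝ} {z₀ : R2} {x : R3}
    {f : ℝ → E} (hf : ∀ t, 1 / 2 ≤ |t| → f t = 0) {k : ℤ} (hk : |offset η z₀ k x| ≤ 1 / 2)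
    (hkS : k ∉ S → f (offset η z₀ k x) = 0) :
    ∑ j ∈ S, f (offset η z₀ j x) = f (offset η z₀ k x) := by
  refine Finset.sum_eq_single k (fun j _ hj => hf _ ?_) hkS
  have h1 : (1 : ℝ) ≤ |(k : ℝ) - j| := by
    have : (1 : ℤ) ≤ |k - j| := Int.one_le_abs (sub_ne_zero.2 hj.symm)
    exact_mod_cast this
  have h2 : offset η z₀ j x = offset η z₀ k x + (k - j) := by simp only [offset]; ring
  have h3 := abs_sub_abs_le_abs_sub ((k : ℝ) - j) (-offset η z₀ k x)
  rw [abs_neg] at h3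
  have h4 : (k : ℝ) - j - -offset η z₀ k x = offset η z₀ j x := by rw [h2]; ring
  rw [h4] at h3
  linarith

/-- Every point has a nearest wire in the layer, at lateral distance at most half a period. -/
theorem exists_offset_le_half (η : ℝ) (z₀ : R2) (x : R3) :
    ∃ k : ℤ, |offset η z₀ k x| ≤ 1 / 2 := by
  refine ⟨round (x 1 / η - z₀ 0), ?_⟩
  have := abs_sub_round (x 1 / η - z₀ 0)
  have e : offset η z₀ (round (x 1 / η - z₀ 0)) x =
      x 1 / η - z₀ 0 - round (x 1 / η - z₀ 0) := by rw [offset]; ring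
  rwa [e]

/-! ### Test fields for the magnetic equation -/

/-- Cut-off profiles for a potential `y₂ - P(y₂) κ(y₃)` that is constant on the square of half-width
`R` and agrees with `y₂` near the boundary of the unit cell; `P'` and `κ'` are the derivatives, and
coordinates are relative to the centre of the wire. -/
structure IsWireProfile (R : ℝ) (P P' κ κ' : ℝ → ℝ) : Prop where
  hasDerivAt_P : ∀ t, HasDerivAt P (P' t) t
  hasDerivAt_κ : ∀ t, HasDerivAt κ (κ' t) t
  P_bddLip : BddLip P
  P'_bddLip : BddLip P'
  κ_bddLip : BddLip κ
  κ'_bddLip : BddLip κ'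
  P_eq_zero : ∀ t, 1 / 2 ≤ |t| → P t = 0
  P'_eq_zero : ∀ t, 1 / 2 ≤ |t| → P' t = 0
  κ_eq_zero : ∀ t, 1 / 2 ≤ |t| → κ t = 0
  κ'_eq_zero : ∀ t, 1 / 2 ≤ |t| → κ' t = 0
  P'_eq_one : ∀ t, |t| ≤ R → P' t = 1
  κ_eq_one : ∀ t, |t| ≤ R → κ t = 1
  κ'_eq_zero_of_le : ∀ t, |t| ≤ R → κ' t = 0

theorem bddLip_of_contDiff {f : ℝ → ℝ} (hf : ContDiff ℝ 1 f) (hc : HasCompactSupport f) :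
    BddLip f :=
  ⟨hf.lipschitzWith_of_hasCompactSupport hc one_ne_zero, hc.exists_bound_of_continuous hf.continuous⟩

theorem exists_isWireProfile {R : ℝ} (h0 : 0 < R) (hR : R < 1 / 2) :
    ∃ P P' κ κ' : ℝ → ℝ, IsWireProfile R P P' κ κ' := by
  let b : ContDiffBump (0 : ℝ) := ⟨(2 * R + 1 / 2) / 3, (R + 1) / 3, by linarith, by linarith⟩
  have hRb : R < b.rIn := by change R < (2 * R + 1 / 2) / 3; linarith
  have hb2 : b.rOut < 1 / 2 := by change (R + 1) / 3 < 1 / 2; linarith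
  have hbs : ContDiff ℝ 2 b := b.contDiff
  have hPs : ContDiff ℝ 2 (fun t => t * b t) := contDiff_id.mul hbs
  have hbc : HasCompactSupport b := b.hasCompactSupport
  have hPc : HasCompactSupport (fun t => t * b t) := hbc.mul_left
  have d1 : ∀ {f : ℝ → ℝ}, ContDiff ℝ 2 f → ContDiff ℝ 1 (deriv f) := fun hf =>
    ((contDiff_succ_iff_deriv (n := 1)).1 (by rw [one_add_one_eq_two]; exact hf)).2.2
  have hz : ∀ t, 1 / 2 ≤ |t| → (b : ℝ → ℝ) =ᶠ[𝓝 t] fun _ => 0 := by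
    intro t ht
    refine notMem_tsupport_iff_eventuallyEq.1 ?_
    rw [b.tsupport_eq, mem_closedBall_zero_iff, Real.norm_eq_abs, not_le]
    linarith
  have ho : ∀ t, |t| ≤ R → (b : ℝ → ℝ) =ᶠ[𝓝 t] fun _ => 1 := fun t ht =>
    b.eventuallyEq_one_of_mem_ball (by
      rw [mem_ball_zero_iff, Real.norm_eq_abs]; linarith)
  have hPz : ∀ t, 1 / 2 ≤ |t| → (fun t => t * b t) =ᶠ[𝓝 t] fun _ => 0 := fun t ht => by
    filter_upwards [hz t ht] with s hs
    rw [hs, mul_zero]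
  have hPo : ∀ t, |t| ≤ R → (fun t => t * b t) =ᶠ[𝓝 t] fun s => s := fun t ht => by
    filter_upwards [ho t ht] with s hs
    rw [hs, mul_one]
  exact ⟨fun t => t * b t, deriv fun t => t * b t, b, deriv b,
    { hasDerivAt_P := fun t => (hPs.differentiable two_ne_zero t).hasDerivAt
      hasDerivAt_κ := fun t => (hbs.differentiable two_ne_zero t).hasDerivAt
      P_bddLip := bddLip_of_contDiff (hPs.of_le one_le_two) hPc
      P'_bddLip := bddLip_of_contDiff (d1 hPs) hPc.deriv
      κ_bddLip := bddLip_of_contDiff (hbs.of_le one_le_two) hbc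
      κ'_bddLip := bddLip_of_contDiff (d1 hbs) hbc.deriv
      P_eq_zero := fun t ht => (hPz t ht).self_of_nhds
      P'_eq_zero := fun t ht => by rw [(hPz t ht).deriv_eq, deriv_const]
      κ_eq_zero := fun t ht => (hz t ht).self_of_nhds
      κ'_eq_zero := fun t ht => by rw [(hz t ht).deriv_eq, deriv_const]
      P'_eq_one := fun t ht => by rw [(hPo t ht).deriv_eq]; exact deriv_id t
      κ_eq_one := fun t ht => (ho t ht).self_of_nhds
      κ'_eq_zero_of_le := fun t ht => by rw [(ho t ht).deriv_eq, deriv_const] }⟩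

/-- Component along `e₂` of the gradient `q` of the rescaled potential `y₂ - Σ_k P(y₂ - k) κ(y₃)`. -/
def potentialGradOne (P' κ : ℝ → ℝ) (η : ℝ) (z₀ : R2) (x : R3) : ℝ :=
  1 - ∑ k ∈ cells η, P' (offset η z₀ k x) * κ (height η z₀ x)

/-- Component along `e₃` of the gradient `q` of the rescaled potential `y₂ - Σ_k P(y₂ - k) κ(y₃)`. -/
def potentialGradTwo (P κ' : ℝ → ℝ) (η : ℝ) (z₀ : R2) (x : R3) : ℝ :=
  -∑ k ∈ cells η, P (offset η z₀ k x) * κ' (height η z₀ x)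

theorem bddLip_potentialGradOne {R : ℝ} {P P' κ κ' : ℝ → ℝ} (hp : IsWireProfile R P P' κ κ')
    {η : ℝ} (hη : 0 < η) (z₀ : R2) :
    BddLip fun x => (potentialGradOne P' κ η z₀ x : ℂ) :=
  ((BddLip.const (1 : ℝ)).sub (BddLip.sum (cells η) fun k =>
    (hp.P'_bddLip.comp (lipschitzWith_offset hη z₀ k)).mul
      (hp.κ_bddLip.comp (lipschitzWith_height hη z₀)))).ofReal

theorem bddLip_potentialGradTwo {R : ℝ} {P P' κ κ' : ℝ → ℝ} (hp : IsWireProfile R P P' κ κ')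
    {η : ℝ} (hη : 0 < η) (z₀ : R2) :
    BddLip fun x => (potentialGradTwo P κ' η z₀ x : ℂ) :=
  (BddLip.sum (cells η) fun k =>
    (hp.P_bddLip.comp (lipschitzWith_offset hη z₀ k)).mul
      (hp.κ'_bddLip.comp (lipschitzWith_height hη z₀))).neg.ofReal

theorem partialD_two_potentialGradOne {R : ℝ} {P P' κ κ' : ℝ → ℝ} (hp : IsWireProfile R P P' κ κ')
    {η : ℝ} (z₀ : R2) {x : R3}
    (hd : DifferentiableAt ℝ (fun x => (potentialGradOne P' κ η z₀ x : ℂ)) x) :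
    partialD 2 (fun x => (potentialGradOne P' κ η z₀ x : ℂ)) x =
      ((-∑ k ∈ cells η, P' (offset η z₀ k x) * (κ' (height η z₀ x) * (1 / η)) : ℝ) : ℂ) := by
  refine partialD_eq_of_hasDerivAt hd (HasDerivAt.ofReal_comp ?_)
  simp only [potentialGradOne, offset_line_two, height_line_two]
  have hκ : HasDerivAt (fun t : ℝ => κ (height η z₀ x + t / η))
      (κ' (height η z₀ x) * (1 / η)) 0 := by
    have h1 : HasDerivAt (fun t : ℝ => height η z₀ x + t / η) (1 / η) 0 :=
      ((hasDerivAt_id (0 : ℝ)).div_const η).const_add _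
    have h2 : HasDerivAt κ (κ' (height η z₀ x)) (height η z₀ x + 0 / η) := by
      rw [zero_div, add_zero]; exact hp.hasDerivAt_κ _
    exact h2.comp (0 : ℝ) h1
  have h4 := (HasDerivAt.fun_sum (u := cells η) fun k _ =>
    hκ.const_mul (P' (offset η z₀ k x))).const_sub 1
  exact h4

theorem partialD_one_potentialGradTwo {R : ℝ} {P P' κ κ' : ℝ → ℝ} (hp : IsWireProfile R P P' κ κ')
    {η : ℝ} (z₀ : R2) {x : R3}
    (hd : DifferentiableAt ℝ (fun x => (potentialGradTwo P κ' η z₀ x : ℂ)) x) :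
    partialD 1 (fun x => (potentialGradTwo P κ' η z₀ x : ℂ)) x =
      ((-∑ k ∈ cells η, P' (offset η z₀ k x) * (κ' (height η z₀ x) * (1 / η)) : ℝ) : ℂ) := by
  refine partialD_eq_of_hasDerivAt hd (HasDerivAt.ofReal_comp ?_)
  simp only [potentialGradTwo, offset_line_one, height_line_one]
  have hP : ∀ k, HasDerivAt (fun t : ℝ => P (offset η z₀ k x + t / η))
      (P' (offset η z₀ k x) * (1 / η)) 0 := by
    intro k
    have h1 : HasDerivAt (fun t : ℝ => offset η z₀ k x + t / η) (1 / η) 0 :=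
      ((hasDerivAt_id (0 : ℝ)).div_const η).const_add _
    have h2 : HasDerivAt P (P' (offset η z₀ k x)) (offset η z₀ k x + 0 / η) := by
      rw [zero_div, add_zero]; exact hp.hasDerivAt_P _
    exact h2.comp (0 : ℝ) h1
  have h4 := (HasDerivAt.fun_sum (u := cells η) fun k _ =>
    (hP k).mul_const (κ' (height η z₀ x))).neg
  refine h4.congr_deriv ?_
  congr 1
  exact Finset.sum_congr rfl fun k _ => by ring

/-- The gradient `q` is bounded uniformly in the period. -/
theorem exists_bound_potentialGrad {R : ℝ} {P P' κ κ' : ℝ → ℝ} (hp : IsWireProfile R P P' κ κ') :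
    ∃ Q : ℝ, ∀ (η : ℝ) (z₀ : R2) (x : R3),
    ‖(potentialGradOne P' κ η z₀ x : ℂ)‖ ≤ Q ∧ ‖(potentialGradTwo P κ' η z₀ x : ℂ)‖ ≤ Q := by
  obtain ⟨A, hA⟩ := hp.P_bddLip.bdd
  obtain ⟨A', hA'⟩ := hp.P'_bddLip.bdd
  obtain ⟨B, hB⟩ := hp.κ_bddLip.bdd
  obtain ⟨B', hB'⟩ := hp.κ'_bddLip.bdd
  have bound : ∀ {f g : ℝ → ℝ} {a b : ℝ}, (∀ t, 1 / 2 ≤ |t| → f t = 0) → (∀ t, ‖f t‖ ≤ a) →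
      (∀ t, ‖g t‖ ≤ b) → ∀ (η : ℝ) (z₀ : R2) (x : R3),
      ‖∑ k ∈ cells η, f (offset η z₀ k x) * g (height η z₀ x)‖ ≤ |a| * |b| := by
    intro f g a b hf ha hb η z₀ x
    have h2 : ∀ k, ‖f (offset η z₀ k x) * g (height η z₀ x)‖ ≤ |a| * |b| := fun k => by
      rw [norm_mul]
      exact mul_le_mul ((ha _).trans (le_abs_self a)) ((hb _).trans (le_abs_self b))
        (norm_nonneg _) (abs_nonneg _)
    obtain ⟨k, hk⟩ := exists_offset_le_half η z₀ x
    by_cases hkS : k ∈ cells η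
    · rw [sum_offset_eq (cells η) (f := fun t => f t * g (height η z₀ x))
        (fun t ht => by rw [hf t ht, zero_mul]) hk fun h => absurd hkS h]
      exact h2 k
    · rw [← Finset.sum_mul]
      have : ∑ j ∈ cells η, f (offset η z₀ j x) = ∑ j ∈ insert k (cells η),
          f (offset η z₀ j x) - f (offset η z₀ k x) := by
        rw [Finset.sum_insert hkS]; ring
      rw [this, sum_offset_eq (insert k (cells η)) hf hk fun h => absurd (by simp) h]
      simp; positivity
  refine ⟨max (1 + |A'| * |B|) (|A| * |B'|), fun η z₀ x => ⟨le_max_of_le_left ?_,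
    le_max_of_le_right ?_⟩⟩
  · rw [Complex.norm_real, potentialGradOne]
    refine (norm_sub_le _ _).trans ?_
    rw [norm_one]
    gcongr
    exact bound hp.P'_eq_zero hA' hB η z₀ x
  · rw [Complex.norm_real, potentialGradTwo, norm_neg]
    exact bound hp.P_eq_zero hA hB' η z₀ x

/-- The cut-off across the layer of wires. -/
def layerCut (η : ℝ) (z₀ : R2) (x : R3) : ℝ := ramp |height η z₀ x|

theorem lipschitzWith_layerCut {η : ℝ} (hη : 0 < η) (z₀ : R2) :
    LipschitzWith (Real.toNNReal (1 / η)) (fun x => (layerCut η z₀ x : ℂ)) := by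
  refine LipschitzWith.of_dist_le_mul fun x y => ?_
  rw [dist_eq_norm, ← Complex.ofReal_sub, Complex.norm_real, ← dist_eq_norm]
  have h1 := lipschitzWith_ramp.dist_le_mul |height η z₀ x| |height η z₀ y|
  have h2 := (lipschitzWith_height hη z₀).dist_le_mul x y
  rw [NNReal.coe_one, one_mul] at h1
  exact h1.trans ((abs_abs_sub_abs_le _ _).trans h2)

theorem norm_layerCut_le (η : ℝ) (z₀ : R2) (x : R3) : ‖(layerCut η z₀ x : ℂ)‖ ≤ 1 := by
  rw [Complex.norm_real]; exact norm_ramp_le _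

theorem bddLip_layerCut {η : ℝ} (hη : 0 < η) (z₀ : R2) :
    BddLip fun x => (layerCut η z₀ x : ℂ) :=
  ⟨⟨_, lipschitzWith_layerCut hη z₀⟩, 1, norm_layerCut_le η z₀⟩

/-- The corrected test field: the component `u₁` along the wires and the normal component `u₃` are
cut off near the layer, and `u₂ e₂` is replaced by `u₂ q` with the curl-free field `q`, which vanishes
in the tubes and equals `e₂` away from the layer. -/
def magneticTest (P P' κ κ' : ℝ → ℝ) (η : ℝ) (z₀ : R2) (u : R3 → C3) : R3 → C3 :=
  vecField (fun x => layerCut η z₀ x * u x 0)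
    (fun x => potentialGradOne P' κ η z₀ x * u x 1)
    (fun x => potentialGradTwo P κ' η z₀ x * u x 1 + layerCut η z₀ x * u x 2)

theorem BddLip.coord {u : R3 → C3} (hu : BddLip u) (i : Fin 3) : BddLip fun x => u x i :=
  hu.clm (coordC i)

theorem bddLip_magneticTest {R : ℝ} {P P' κ κ' : ℝ → ℝ} (hp : IsWireProfile R P P' κ κ') {η : ℝ}
    (hη : 0 < η) (z₀ : R2) {u : R3 → C3} (hu : BddLip u) :
    BddLip (magneticTest P P' κ κ' η z₀ u) :=
  ((bddLip_layerCut hη z₀).mul (hu.coord 0)).vecField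
    ((bddLip_potentialGradOne hp hη z₀).mul (hu.coord 1))
    (((bddLip_potentialGradTwo hp hη z₀).mul (hu.coord 1)).add
      ((bddLip_layerCut hη z₀).mul (hu.coord 2)))

/-- The corrected test field vanishes on the inclusion, hence outside of the perforated domain. -/
theorem magneticTest_eq_zero {R : ℝ} {P P' κ κ' : ℝ → ℝ} (hp : IsWireProfile R P P' κ κ')
    (hR : R < 1 / 2) {η : ℝ} (hη : 0 < η) {z₀ : R2} (hz : z₀ 0 ∈ Set.Ico (0 : ℝ) 1) {r : ℝ}
    (hrR : r ≤ R) {I : Set ℝ} {u : R3 → C3} (h0 : ∀ x, x ∉ Omega → u x = 0) {x : R3}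
    (hx : x ∉ perforated η (wireObstacle z₀ r I)) : magneticTest P P' κ κ' η z₀ u x = 0 := by
  by_cases hxΩ : x ∈ Omega
  · have hxi : x ∈ inclusion η (wireObstacle z₀ r I) := by
      by_contra h; exact hx ⟨hxΩ, h⟩
    obtain ⟨k, h1, h2⟩ := exists_offset_le_of_mem_inclusion hη hxi
    have hk : |offset η z₀ k x| ≤ 1 / 2 := by linarith
    have hkS : k ∈ cells η := mem_cells hη hxΩ.2.1 hz (hk.trans (by norm_num))
    have e1 : potentialGradOne P' κ η z₀ x = 0 := by
      rw [potentialGradOne, ← Finset.sum_mul, sum_offset_eq _ hp.P'_eq_zero hk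
        fun h => absurd hkS h, hp.P'_eq_one _ (h1.trans hrR), hp.κ_eq_one _ (h2.trans hrR)]
      norm_num
    have e2 : potentialGradTwo P κ' η z₀ x = 0 := by
      rw [potentialGradTwo, ← Finset.sum_mul, hp.κ'_eq_zero_of_le _ (h2.trans hrR), mul_zero,
        neg_zero]
    have e3 : layerCut η z₀ x = 0 := ramp_of_le (by linarith)
    ext i
    fin_cases i <;> simp [magneticTest, vecField, e1, e2, e3]
  · ext i
    fin_cases i <;> simp [magneticTest, vecField, h0 x hxΩ]

theorem height_ge_of_notMem_slab {η : ℝ} (hη : 0 < η) {z₀ : R2} (hz : z₀ 1 ∈ Set.Ioo (0 : ℝ) 1)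
    {x : R3} (h : x ∉ slab η) : 2 ≤ |height η z₀ x| := by
  by_contra h'
  exact h (mem_slab_of_height_le hη hz (not_le.1 h').le)

theorem magneticTest_eq_of_notMem_slab {R : ℝ} {P P' κ κ' : ℝ → ℝ}
    (hp : IsWireProfile R P P' κ κ') {η : ℝ} (hη : 0 < η) {z₀ : R2}
    (hz : z₀ 1 ∈ Set.Ioo (0 : ℝ) 1) (u : R3 → C3) {x : R3} (hx : x ∉ slab η) :
    magneticTest P P' κ κ' η z₀ u x = u x := by
  have h := height_ge_of_notMem_slab hη hz hx
  have h' : 1 / 2 ≤ |height η z₀ x| := by linarith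
  have e1 : potentialGradOne P' κ η z₀ x = 1 := by
    rw [potentialGradOne, ← Finset.sum_mul, hp.κ_eq_zero _ h', mul_zero, sub_zero]
  have e2 : potentialGradTwo P κ' η z₀ x = 0 := by
    rw [potentialGradTwo, ← Finset.sum_mul, hp.κ'_eq_zero _ h', mul_zero, neg_zero]
  have e3 : layerCut η z₀ x = 1 := ramp_of_ge h
  ext i
  fin_cases i <;> simp [magneticTest, vecField, e1, e2, e3]

theorem isClosed_slab (η : ℝ) : IsClosed (slab η) :=
  isClosed_le (continuous_coord 2).abs continuous_const

theorem norm_mul_le_mul {a b : ℂ} {A B : ℝ} (ha : ‖a‖ ≤ A) (hb : ‖b‖ ≤ B) :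
    ‖a * b‖ ≤ A * B := by
  rw [norm_mul]
  exact mul_le_mul ha hb (norm_nonneg _) ((norm_nonneg _).trans ha)

/-- In the slab the curl of the corrected test field is bounded uniformly in the period: the only
term with a factor `1/η` is `u₁ ∂₃χ`, and `u₁ = O(η)` there. -/
theorem norm_curl_magneticTest_le {R : ℝ} {P P' κ κ' : ℝ → ℝ} (hp : IsWireProfile R P P' κ κ')
    {η : ℝ} (hη : 0 < η) (z₀ : R2) {u : R3 → C3} (hu : BddLip u) {K : NNReal}
    (hK : ∀ i, LipschitzWith K fun x => u x i) {L : ℝ} (hL : ∀ x ∈ Omega, ‖u x 0‖ ≤ L * |x 2|)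
    {Q : ℝ} (hQ : ∀ x, ‖(potentialGradOne P' κ η z₀ x : ℂ)‖ ≤ Q ∧
      ‖(potentialGradTwo P κ' η z₀ x : ℂ)‖ ≤ Q) :
    ∀ᵐ x : R3, x ∈ Omega → x ∈ slab η →
      ‖curl (magneticTest P P' κ κ' η z₀ u) x‖ ≤ 4 * Q * K + 4 * K + 3 * |L| := by
  have bχ := bddLip_layerCut hη z₀
  have bq1 := bddLip_potentialGradOne hp hη z₀
  have bq2 := bddLip_potentialGradTwo hp hη z₀
  filter_upwards [bχ.ae_differentiableAt, bq1.ae_differentiableAt, bq2.ae_differentiableAt,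
    (hu.coord 0).ae_differentiableAt, (hu.coord 1).ae_differentiableAt,
    (hu.coord 2).ae_differentiableAt] with x dχ dq1 dq2 d0 d1 d2 hx hs
  have χ0 : partialD 0 (fun x => (layerCut η z₀ x : ℂ)) x = 0 :=
    partialD_eq_zero_of_const (fun x t => by simp only [layerCut, height_line_zero]) x
  have χ1 : partialD 1 (fun x => (layerCut η z₀ x : ℂ)) x = 0 :=
    partialD_eq_zero_of_const (fun x t => by simp only [layerCut, height_line_one]) x
  have q10 : partialD 0 (fun x => (potentialGradOne P' κ η z₀ x : ℂ)) x = 0 :=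
    partialD_eq_zero_of_const
      (fun x t => by simp only [potentialGradOne, height_line_zero, offset_line_zero]) x
  have q20 : partialD 0 (fun x => (potentialGradTwo P κ' η z₀ x : ℂ)) x = 0 :=
    partialD_eq_zero_of_const
      (fun x t => by simp only [potentialGradTwo, height_line_zero, offset_line_zero]) x
  have χ2 : ‖partialD 2 (fun x => (layerCut η z₀ x : ℂ)) x‖ ≤ 1 / η := by
    have := norm_partialD_le_of_lipschitz (lipschitzWith_layerCut hη z₀) 2 x
    rwa [Real.coe_toNNReal _ (by positivity)] at this
  have hD : ∀ j i, ‖partialD j (fun x => u x i) x‖ ≤ K := fun j i =>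
    norm_partialD_le_of_lipschitz (hK i) j x
  have hu0 : ‖u x 0‖ ≤ |L| * (3 * η) := (hL x hx).trans
    (mul_le_mul (le_abs_self L) hs (abs_nonneg _) (abs_nonneg _))
  have hc := norm_layerCut_le η z₀ x
  obtain ⟨hQ1, hQ2⟩ := hQ x
  have key : curl (magneticTest P P' κ κ' η z₀ u) x =
      !₂[potentialGradTwo P κ' η z₀ x * partialD 1 (fun x => u x 1) x +
          layerCut η z₀ x * partialD 1 (fun x => u x 2) x -
          potentialGradOne P' κ η z₀ x * partialD 2 (fun x => u x 1) x,
        layerCut η z₀ x * partialD 2 (fun x => u x 0) x +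
          partialD 2 (fun x => (layerCut η z₀ x : ℂ)) x * u x 0 -
          (potentialGradTwo P κ' η z₀ x * partialD 0 (fun x => u x 1) x +
          layerCut η z₀ x * partialD 0 (fun x => u x 2) x),
        potentialGradOne P' κ η z₀ x * partialD 0 (fun x => u x 1) x -
          layerCut η z₀ x * partialD 1 (fun x => u x 0) x] := by
    rw [magneticTest, curl_vecField (dχ.fun_mul d0) (dq1.fun_mul d1)
      ((dq2.fun_mul d1).fun_add (dχ.fun_mul d2))]
    rw [partialD_add (dq2.fun_mul d1) (dχ.fun_mul d2), partialD_add (dq2.fun_mul d1) (dχ.fun_mul d2),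
      partialD_mul dq2 d1, partialD_mul dq2 d1, partialD_mul dχ d2, partialD_mul dχ d2,
      partialD_mul dq1 d1, partialD_mul dq1 d1, partialD_mul dχ d0, partialD_mul dχ d0,
      partialD_two_potentialGradOne hp z₀ dq1, partialD_one_potentialGradTwo hp z₀ dq2,
      χ0, χ1, q10, q20]
    congr 1
    funext i
    fin_cases i
    · simp; ring
    · simp
    · simp
  rw [key]
  have m1 := fun j i => norm_mul_le_mul hQ1 (hD j i)
  have m2 := fun j i => norm_mul_le_mul hQ2 (hD j i)
  have m3 := fun j i => norm_mul_le_mul hc (hD j i)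
  have m4 := norm_mul_le_mul χ2 hu0
  have e4 : 1 / η * (|L| * (3 * η)) = 3 * |L| := by field_simp
  rw [e4] at m4
  refine (norm_vec_le (A := Q * K + 1 * K + Q * K) (B := 1 * K + 3 * |L| + (Q * K + 1 * K))
    (C := Q * K + 1 * K) ?_ ?_ ?_).trans (le_of_eq (by ring))
  · exact (norm_sub_le _ _).trans (add_le_add ((norm_add_le _ _).trans
      (add_le_add (m2 1 1) (m3 1 2))) (m1 2 1))
  · exact (norm_sub_le _ _).trans (add_le_add ((norm_add_le _ _).trans
      (add_le_add (m3 2 0) m4)) ((norm_add_le _ _).trans (add_le_add (m2 0 1) (m3 0 2))))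
  · exact (norm_sub_le _ _).trans (add_le_add (m1 0 1) (m3 1 0))

theorem inL2_Omega_of_bddLip {u : R3 → C3} (hu : BddLip u) : InL2 Omega u :=
  (inHCurl_of_bddLip volume_Omega_ne_top measurableSet_Omega hu).memL2

theorem inL2_Omega_curl_of_bddLip {u : R3 → C3} (hu : BddLip u) : InL2 Omega (curl u) :=
  (inHCurl_of_bddLip volume_Omega_ne_top measurableSet_Omega hu).curl_memL2

theorem inclusion_subset_slab {η : ℝ} (hη : 0 < η) {z₀ : R2} (hz : z₀ 1 ∈ Set.Ioo (0 : ℝ) 1)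
    {r : ℝ} (hr : r ≤ 1) {I : Set ℝ} : inclusion η (wireObstacle z₀ r I) ⊆ slab η := by
  intro x hx
  obtain ⟨k, -, h2⟩ := exists_offset_le_of_mem_inclusion hη hx
  exact mem_slab_of_height_le hη hz (by linarith)

/-- Test fields in the perforated domains that vanish on the wires and converge strongly, together
with their curls. -/
theorem exists_magnetic_test_fields {η : ℕ → ℝ} (hη : ∀ n, 0 < η n) (hη0 : Tendsto η atTop (𝓝 0))
    {z₀ : R2} {R : ℝ} (hR : Metric.closedBall z₀ R ⊆ crossSection) {r : ℕ → ℝ}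
    (hr : ∀ n, 0 < r n) (hrR : ∀ n, r n ≤ R) (I : ℕ → Set ℝ) {u : R3 → C3} (hu : BddLip u)
    (h0 : ∀ x, x ∉ Omega → u x = 0) {L : ℝ} (hL : ∀ x ∈ Omega, ‖u x 0‖ ≤ L * |x 2|) :
    ∃ φ : ℕ → R3 → C3,
      (∀ n, InHCurlZero (perforated (η n) (wireObstacle z₀ (r n) (I n))) (φ n) (curl (φ n))) ∧
      StrongConvL2 Omega
        (fun n => (perforated (η n) (wireObstacle z₀ (r n) (I n))).indicator (φ n)) u ∧
      StrongConvL2 Omega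
        (fun n => (perforated (η n) (wireObstacle z₀ (r n) (I n))).indicator (curl (φ n)))
        (curl u) := by
  have hR0 : 0 < R := (hr 0).trans_le (hrR 0)
  obtain ⟨⟨b1, b2⟩, b3, b4⟩ := disc_bounds hR hR0
  have hz0 : z₀ 0 ∈ Set.Ico (0 : ℝ) 1 := ⟨by linarith, by linarith⟩
  have hz1 : z₀ 1 ∈ Set.Ioo (0 : ℝ) 1 := ⟨by linarith, by linarith⟩
  have hR2 : R < 1 / 2 := by linarith
  obtain ⟨P, P', κ, κ', hp⟩ := exists_isWireProfile hR0 hR2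
  obtain ⟨Q, hQ⟩ := exists_bound_potentialGrad hp
  set U : ℕ → Set R3 := fun n => perforated (η n) (wireObstacle z₀ (r n) (I n)) with hUdef
  have hUm : ∀ n, MeasurableSet (U n) := fun n =>
    measurableSet_perforated (hη n).ne' isClosed_closure
  set φ : ℕ → R3 → C3 := fun n => magneticTest P P' κ κ' (η n) z₀ u with hφdef
  have hφ : ∀ n, BddLip (φ n) := fun n => bddLip_magneticTest hp (hη n) z₀ hu
  have hφ0 : ∀ n x, x ∉ U n → φ n x = 0 := fun n x hx =>
    magneticTest_eq_zero hp hR2 (hη n) hz0 (hrR n) h0 hx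
  obtain ⟨B, hB⟩ := hu.bdd
  obtain ⟨K, hK⟩ := hu.lip
  have hKi : ∀ i, LipschitzWith (‖coordC i‖₊ * K) fun x => u x i := fun i =>
    (coordC i).lipschitz.comp hK
  set K' : NNReal := ∑ i, ‖coordC i‖₊ * K with hK'
  have hKi' : ∀ i, LipschitzWith K' fun x => u x i := fun i =>
    (hKi i).weaken (Finset.single_le_sum (f := fun i => ‖coordC i‖₊ * K) (fun _ _ => by simp)
      (Finset.mem_univ i))
  have hmemU : ∀ n x, x ∈ Omega → x ∉ slab (η n) → x ∈ U n := fun n x hx hs =>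
    ⟨hx, fun h => hs (inclusion_subset_slab (hη n) hz1 ((hrR n).trans (by linarith)) h)⟩
  refine ⟨φ, fun n => inHCurlZero_of_bddLip (isBounded_Omega.subset (perforated_subset _ _))
    (hUm n) (hφ n) (hφ0 n), ?_, ?_⟩
  · refine strongConvL2_of_slab hη0
      (fun n => MemLp.indicator (hUm n) (inL2_Omega_of_bddLip (hφ n))) (inL2_Omega_of_bddLip hu)
      (C := (1 * B + Q * B + (Q * B + 1 * B)) + B)
      (fun n => ae_of_all _ fun x _ _ => (norm_sub_le _ _).trans (add_le_add ?_ (hB x)))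
      fun n x hx hs => ?_
    · refine (norm_indicator_le_norm_self (φ n) x).trans ?_
      have hu := fun i => (norm_coord_le (u x) i).trans (hB x)
      have hQx := hQ (η n) z₀ x
      have hc := norm_layerCut_le (η n) z₀ x
      exact norm_vec_le (norm_mul_le_mul hc (hu 0)) (norm_mul_le_mul hQx.1 (hu 1))
        ((norm_add_le _ _).trans (add_le_add (norm_mul_le_mul hQx.2 (hu 1))
          (norm_mul_le_mul hc (hu 2))))
    · rw [Set.indicator_of_mem (hmemU n x hx hs)]
      exact magneticTest_eq_of_notMem_slab hp (hη n) hz1 u hs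
  · refine strongConvL2_of_slab hη0
      (fun n => MemLp.indicator (hUm n) (inL2_Omega_curl_of_bddLip (hφ n)))
      (inL2_Omega_curl_of_bddLip hu)
      (C := (4 * Q * K' + 4 * K' + 3 * |L|) + 6 * K)
      (fun n => ?_) fun n x hx hs => ?_
    · filter_upwards [norm_curl_magneticTest_le hp (hη n) z₀ hu hKi' hL (hQ (η n) z₀)]
        with x hx hxΩ hxs
      exact (norm_sub_le _ _).trans (add_le_add ((norm_indicator_le_norm_self _ x).trans
        (hx hxΩ hxs)) (norm_curl_le_of_lipschitz hK x))
    · rw [Set.indicator_of_mem (hmemU n x hx hs)]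
      refine curl_congr ?_
      filter_upwards [(isClosed_slab (η n)).isOpen_compl.mem_nhds hs] with y hy
      exact magneticTest_eq_of_notMem_slab hp (hη n) hz1 u hy

/-! ### A field winding around each wire -/

/-- The radial factor `g` of the winding field, regularized at the scale `δ` and vanishing for
`m ≥ 1/2`. Between these two scales `2 g + m g' = -1`, because `m⁻²` is homogeneous of degree `-2`;
the constant is compensated by the slope of `step`. Taking for `m` the maximum norm rather than the
Euclidean one makes the supports fill the square period cells exactly. -/
def radialFactor (δ m : ℝ) : ℝ := 1 / 8 * (((max m δ)⁻¹) ^ 2 - ((max m (1 / 2))⁻¹) ^ 2)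

/-- The divergence of `(s g, t g)`, as a function of the maximum norm `m = max |s| |t|`. -/
def windingDensity (δ m : ℝ) : ℝ :=
  (if m < δ then 1 / (4 * δ ^ 2) else 0) - (if m < 1 / 2 then 1 else 0)

theorem radialFactor_eq_zero {δ m : ℝ} (hδ2 : δ ≤ 1 / 2) (hm : 1 / 2 ≤ m) :
    radialFactor δ m = 0 := by
  rw [radialFactor, max_eq_left (hδ2.trans hm), max_eq_left hm, sub_self, mul_zero]

theorem abs_radialFactor_le {δ : ℝ} (hδ : 0 < δ) (hδ2 : δ ≤ 1 / 2) (m : ℝ) :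
    |radialFactor δ m| ≤ 1 / 8 * ((max m δ)⁻¹) ^ 2 := by
  have h1 : (max m (1 / 2))⁻¹ ≤ (max m δ)⁻¹ := by
    gcongr
  have h3 : ((max m (1 / 2))⁻¹) ^ 2 ≤ ((max m δ)⁻¹) ^ 2 := by gcongr
  rw [radialFactor, abs_of_nonneg (by linarith)]
  nlinarith [sq_nonneg ((max m (1 / 2))⁻¹)]

theorem bddLip_inv_max {δ : ℝ} (hδ : 0 < δ) : BddLip fun m : ℝ => (max m δ)⁻¹ := by
  have hp : ∀ m : ℝ, δ ≤ max m δ := fun m => le_max_right _ _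
  refine ⟨⟨⟨δ⁻¹ * δ⁻¹, by positivity⟩, LipschitzWith.of_dist_le_mul fun x y => ?_⟩, δ⁻¹,
    fun m => ?_⟩
  · have hx := hp x
    have hy := hp y
    have hx0 : 0 < max x δ := hδ.trans_le hx
    have hy0 : 0 < max y δ := hδ.trans_le hy
    change _ ≤ δ⁻¹ * δ⁻¹ * dist x y
    rw [Real.dist_eq, inv_sub_inv hx0.ne' hy0.ne', abs_div, abs_of_pos (mul_pos hx0 hy0),
      div_eq_inv_mul, mul_inv, Real.dist_eq, abs_sub_comm x y]
    have h1 : |max y δ - max x δ| ≤ |y - x| := abs_max_sub_max_le_abs _ _ _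
    gcongr
  · rw [Real.norm_eq_abs, abs_of_pos (inv_pos.2 (hδ.trans_le (hp m)))]
    gcongr
    exact hp m

theorem bddLip_radialFactor {δ : ℝ} (hδ : 0 < δ) : BddLip (radialFactor δ) := by
  have h1 := bddLip_inv_max hδ
  have h2 := bddLip_inv_max (δ := 1 / 2) (by norm_num)
  have e : radialFactor δ = fun m => 1 / 8 *
      ((max m δ)⁻¹ * (max m δ)⁻¹ - (max m (1 / 2))⁻¹ * (max m (1 / 2))⁻¹) := by
    funext m; simp only [radialFactor, sq]
  rw [e]
  exact (BddLip.const (1 / 8 : ℝ)).mul ((h1.mul h1).sub (h2.mul h2))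

theorem exists_hasDerivAt_radialFactor {δ : ℝ} (hδ2 : δ ≤ 1 / 2) {m : ℝ} (hm : 0 < m)
    (h1 : m ≠ δ) (h2 : m ≠ 1 / 2) : ∃ g', HasDerivAt (radialFactor δ) g' m ∧
      2 * radialFactor δ m + m * g' = windingDensity δ m := by
  rcases lt_or_gt_of_ne h1 with h1 | h1
  · have hm2 : m < 1 / 2 := h1.trans_le hδ2
    refine ⟨0, (hasDerivAt_const m (radialFactor δ m)).congr_of_eventuallyEq ?_, ?_⟩
    · filter_upwards [Iio_mem_nhds h1] with x hx
      have hx' : x < δ := hx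
      simp only [radialFactor]
      rw [max_eq_right hx'.le, max_eq_right (hx'.le.trans hδ2), max_eq_right h1.le,
        max_eq_right hm2.le]
    · rw [radialFactor, windingDensity, if_pos h1, if_pos hm2, max_eq_right h1.le,
        max_eq_right hm2.le]
      have : δ ≠ 0 := (hm.trans h1).ne'
      field_simp
      ring
  · rcases lt_or_gt_of_ne h2 with h2 | h2
    · refine ⟨1 / 8 * (2 * m⁻¹ * (-(m ^ 2)⁻¹)), ?_, ?_⟩
      · have hd : HasDerivAt (fun x : ℝ => 1 / 8 * ((x⁻¹) ^ 2 - ((1 / 2 : ℝ)⁻¹) ^ 2))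
            (1 / 8 * (2 * m⁻¹ * (-(m ^ 2)⁻¹))) m := by
          have := ((((hasDerivAt_inv hm.ne').fun_pow 2).sub_const
            (((1 / 2 : ℝ)⁻¹) ^ 2)).const_mul (1 / 8))
          simpa using this
        refine hd.congr_of_eventuallyEq ?_
        filter_upwards [Ioo_mem_nhds h1 h2] with x hx
        rw [radialFactor, max_eq_left hx.1.le, max_eq_right hx.2.le]
      · rw [radialFactor, windingDensity, if_neg (not_lt.2 h1.le), if_pos h2, max_eq_left h1.le,
          max_eq_right h2.le]
        field_simp
        ring
    · refine ⟨0, (hasDerivAt_const m (0 : ℝ)).congr_of_eventuallyEq ?_, ?_⟩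
      · filter_upwards [Ioi_mem_nhds h2] with x hx
        exact radialFactor_eq_zero hδ2 (le_of_lt hx)
      · rw [radialFactor_eq_zero hδ2 h2.le, windingDensity, if_neg (not_lt.2 h1.le),
          if_neg (not_lt.2 h2.le)]
        ring

theorem exists_hasDerivAt_winding_of_lt {δ : ℝ} (hδ2 : δ ≤ 1 / 2) {s t : ℝ} (hst : |t| < |s|)
    (h1 : |s| ≠ δ) (h2 : |s| ≠ 1 / 2) : ∃ p q,
      HasDerivAt (fun s' => s' * radialFactor δ (max |s'| |t|)) p s ∧
      HasDerivAt (fun t' => t' * radialFactor δ (max |s| |t'|)) q t ∧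
      p + q = windingDensity δ (max |s| |t|) := by
  have hs : 0 < |s| := (abs_nonneg t).trans_lt hst
  have hs0 : s ≠ 0 := abs_pos.1 hs
  obtain ⟨g', hg, he⟩ := exists_hasDerivAt_radialFactor hδ2 hs h1 h2
  refine ⟨1 * radialFactor δ |s| + s * (g' * (SignType.sign s : ℝ)), 1 * radialFactor δ |s|,
    ?_, ?_, ?_⟩
  · have h3 := (hasDerivAt_id s).mul (hg.comp s (hasDerivAt_abs hs0))
    refine h3.congr_of_eventuallyEq ?_
    filter_upwards [(continuous_abs.tendsto s).eventually_const_lt hst] with x hx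
    rw [max_eq_left hx.le]; rfl
  · have h3 := (hasDerivAt_id t).mul_const (radialFactor δ |s|)
    refine h3.congr_of_eventuallyEq ?_
    filter_upwards [(continuous_abs.tendsto t).eventually_lt_const hst] with x hx
    rw [max_eq_left hx.le]; rfl
  · rw [max_eq_left hst.le, ← he]
    have : s * (SignType.sign s : ℝ) = |s| := self_mul_sign s
    rw [← this]; ring

/-- The divergence of `(s g, t g)` is a function of the maximum norm only. -/
theorem exists_hasDerivAt_winding {δ : ℝ} (hδ2 : δ ≤ 1 / 2) {s t : ℝ} (hst : |s| ≠ |t|)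
    (h1 : |s| ≠ δ) (h2 : |s| ≠ 1 / 2) (h3 : |t| ≠ δ) (h4 : |t| ≠ 1 / 2) : ∃ p q,
      HasDerivAt (fun s' => s' * radialFactor δ (max |s'| |t|)) p s ∧
      HasDerivAt (fun t' => t' * radialFactor δ (max |s| |t'|)) q t ∧
      p + q = windingDensity δ (max |s| |t|) := by
  rcases lt_or_gt_of_ne hst with h | h
  · obtain ⟨p, q, hp, hq, e⟩ := exists_hasDerivAt_winding_of_lt hδ2 h h3 h4
    refine ⟨q, p, ?_, ?_, ?_⟩
    · simpa only [max_comm] using hq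
    · simpa only [max_comm] using hp
    · rw [add_comm, e, max_comm]
  · exact exists_hasDerivAt_winding_of_lt hδ2 h h1 h2

/-- The piecewise linear step from `0` to `1` on `[-1/2, 1/2]`. -/
def step (t : ℝ) : ℝ := max 0 (min 1 (t + 1 / 2))

theorem step_of_le {t : ℝ} (h : t ≤ -(1 / 2)) : step t = 0 :=
  max_eq_left ((min_le_right _ _).trans (by linarith))

theorem step_of_ge {t : ℝ} (h : 1 / 2 ≤ t) : step t = 1 := by
  rw [step, min_eq_left (by linarith), max_eq_right zero_le_one]

theorem norm_step_le (t : ℝ) : ‖step t‖ ≤ 1 := by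
  rw [step, Real.norm_of_nonneg (le_max_left _ _)]
  exact max_le zero_le_one (min_le_left _ _)

theorem bddLip_step : BddLip step :=
  ⟨⟨1, LipschitzWith.const_max (LipschitzWith.const_min (LipschitzWith.of_dist_le_mul fun x y => by
    simp [dist_eq_norm]) 1) 0⟩, 1, norm_step_le⟩

theorem hasDerivAt_step {t : ℝ} (h : |t| ≠ 1 / 2) :
    HasDerivAt step (if |t| < 1 / 2 then 1 else 0) t := by
  by_cases h1 : |t| < 1 / 2
  · rw [if_pos h1]
    refine ((hasDerivAt_id t).add_const (1 / 2)).congr_of_eventuallyEq ?_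
    rw [abs_lt] at h1
    filter_upwards [Ioo_mem_nhds h1.1 h1.2] with x hx
    rw [step, min_eq_right (by linarith [hx.2]), max_eq_right (by linarith [hx.1])]; rfl
  · rw [if_neg h1]
    rcases lt_abs.1 (lt_of_le_of_ne (not_lt.1 h1) h.symm) with h2 | h2
    · refine (hasDerivAt_const t (1 : ℝ)).congr_of_eventuallyEq ?_
      filter_upwards [Ioi_mem_nhds h2] with x hx
      exact step_of_ge (le_of_lt hx)
    · refine (hasDerivAt_const t (0 : ℝ)).congr_of_eventuallyEq ?_
      filter_upwards [Iio_mem_nhds (show t < -(1 / 2) by linarith)] with x hx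
      exact step_of_le (le_of_lt hx)

/-- The radial factor centred at the `k`-th wire. -/
def wireFactor (δ η : ℝ) (z₀ : R2) (k : ℤ) (x : R3) : ℝ :=
  radialFactor δ (max |offset η z₀ k x| |height η z₀ x|)

/-- Component along `e₂` of the winding field. The field is curl-free outside of the tubes of
half-width `δ`, equals `e₂` above and `0` below the layer of wires, and its circulation around each
wire is, up to the sign, the period. -/
def windingOne (δ η : ℝ) (z₀ : R2) (x : R3) : ℝ :=
  step (height η z₀ x) + ∑ k ∈ cells η, height η z₀ x * wireFactor δ η z₀ k x

/-- Component along `e₃` of the winding field. -/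
def windingTwo (δ η : ℝ) (z₀ : R2) (x : R3) : ℝ :=
  -∑ k ∈ cells η, offset η z₀ k x * wireFactor δ η z₀ k x

theorem BddLip.mul_of_support {f g : R3 → ℝ} {K : NNReal} (hf : LipschitzWith K f)
    (hg : BddLip g) (h : ∀ x, g x ≠ 0 → |f x| ≤ 1 / 2) : BddLip fun x => f x * g x := by
  obtain ⟨⟨L, hL⟩, B, hB⟩ := hg
  refine ⟨exists_lipschitzWith_smul hf hL h hB, 1 / 2 * |B|, fun x => ?_⟩
  by_cases hx : g x = 0
  · rw [hx, mul_zero, norm_zero]; positivity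
  · rw [norm_mul]
    exact mul_le_mul (h x hx) ((hB x).trans (le_abs_self B)) (norm_nonneg _) (by norm_num)

theorem lipschitzWith_max_abs {f g : R3 → ℝ} {K : NNReal} (hf : LipschitzWith K f)
    (hg : LipschitzWith K g) : LipschitzWith K fun x => max |f x| |g x| := by
  have h1 : LipschitzWith (1 * K) fun x => |f x| := lipschitzWith_one_norm.comp hf
  have h2 : LipschitzWith (1 * K) fun x => |g x| := lipschitzWith_one_norm.comp hg
  rw [one_mul] at h1 h2
  simpa using h1.max h2

theorem max_lt_half_of_wireFactor_ne_zero {δ η : ℝ} (hδ2 : δ ≤ 1 / 2) {z₀ : R2} {k : ℤ} {x : R3}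
    (h : wireFactor δ η z₀ k x ≠ 0) : max |offset η z₀ k x| |height η z₀ x| < 1 / 2 := by
  by_contra h'
  exact h (radialFactor_eq_zero hδ2 (not_lt.1 h'))

theorem bddLip_wireFactor {δ η : ℝ} (hδ : 0 < δ) (hη : 0 < η) (z₀ : R2) (k : ℤ) :
    BddLip (wireFactor δ η z₀ k) :=
  (bddLip_radialFactor hδ).comp
    (lipschitzWith_max_abs (lipschitzWith_offset hη z₀ k) (lipschitzWith_height hη z₀))

theorem bddLip_windingOne {δ η : ℝ} (hδ : 0 < δ) (hδ2 : δ ≤ 1 / 2) (hη : 0 < η) (z₀ : R2) :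
    BddLip fun x => (windingOne δ η z₀ x : ℂ) :=
  ((bddLip_step.comp (lipschitzWith_height hη z₀)).add (BddLip.sum _ fun k =>
    BddLip.mul_of_support (lipschitzWith_height hη z₀) (bddLip_wireFactor hδ hη z₀ k)
      fun _ hx => (le_max_right _ _).trans (max_lt_half_of_wireFactor_ne_zero hδ2 hx).le)).ofReal

theorem bddLip_windingTwo {δ η : ℝ} (hδ : 0 < δ) (hδ2 : δ ≤ 1 / 2) (hη : 0 < η) (z₀ : R2) :
    BddLip fun x => (windingTwo δ η z₀ x : ℂ) :=
  (BddLip.sum _ fun k =>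
    BddLip.mul_of_support (lipschitzWith_offset hη z₀ k) (bddLip_wireFactor hδ hη z₀ k)
      fun _ hx => (le_max_left _ _).trans (max_lt_half_of_wireFactor_ne_zero hδ2 hx).le).neg.ofReal

theorem ae_offset_ne {η : ℝ} (hη : 0 < η) (z₀ : R2) (k : ℤ) (c : ℝ) :
    ∀ᵐ x : R3, offset η z₀ k x ≠ c := by
  have hT : coordR 1 ≠ 0 := fun h => by
    have := DFunLike.congr_fun h (e3 1)
    simp at this
  filter_upwards [ae_notMem_of_countable (coordR 1) hT
    (Set.countable_singleton (η * (c + (k + z₀ 0))))] with x hx h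
  apply hx
  rw [← h, Set.mem_singleton_iff, coordR_apply, offset]
  field_simp; ring

theorem ae_height_ne {η : ℝ} (hη : 0 < η) (z₀ : R2) (c : ℝ) :
    ∀ᵐ x : R3, height η z₀ x ≠ c := by
  have hT : coordR 2 ≠ 0 := fun h => by
    have := DFunLike.congr_fun h (e3 2)
    simp at this
  filter_upwards [ae_notMem_of_countable (coordR 2) hT
    (Set.countable_singleton (η * (c + z₀ 1)))] with x hx h
  apply hx
  rw [← h, Set.mem_singleton_iff, coordR_apply, height]
  field_simp; ring

theorem ae_abs_offset_ne_abs_height {η : ℝ} (hη : 0 < η) (z₀ : R2) (k : ℤ) :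
    ∀ᵐ x : R3, |offset η z₀ k x| ≠ |height η z₀ x| := by
  have hT1 : coordR 1 - coordR 2 ≠ 0 := fun h => by
    have := DFunLike.congr_fun h (e3 1)
    simp at this
  have hT2 : coordR 1 + coordR 2 ≠ 0 := fun h => by
    have := DFunLike.congr_fun h (e3 1)
    simp at this
  filter_upwards [ae_notMem_of_countable _ hT1
    (Set.countable_singleton (η * (k + z₀ 0 - z₀ 1))), ae_notMem_of_countable _ hT2
    (Set.countable_singleton (η * (k + z₀ 0 + z₀ 1)))] with x h1 h2 h
  rcases abs_eq_abs.1 h with h | h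
  · apply h1
    rw [offset, height] at h
    have : x 1 / η - x 2 / η = k + z₀ 0 - z₀ 1 := by linarith
    rw [Set.mem_singleton_iff, ← this]
    simp only [_root_.sub_apply, coordR_apply]
    field_simp
  · apply h2
    rw [offset, height] at h
    have : x 1 / η + x 2 / η = k + z₀ 0 + z₀ 1 := by linarith
    rw [Set.mem_singleton_iff, ← this]
    simp only [_root_.add_apply, coordR_apply]
    field_simp

/-- The index of the cell containing `x ∈ Ω` is one of the finitely many indices in `cells η`. -/
theorem exists_mem_cells {η : ℝ} (hη : 0 < η) {z₀ : R2} (hz : z₀ 0 ∈ Set.Ico (0 : ℝ) 1) {x : R3}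
    (hx : x ∈ Omega) : ∃ k ∈ cells η, |offset η z₀ k x| ≤ 1 / 2 := by
  obtain ⟨k, hk⟩ := exists_offset_le_half η z₀ x
  exact ⟨k, mem_cells hη hx.2.1 hz (hk.trans (by norm_num)), hk⟩

/-- The curl of the winding field is concentrated in the square tubes of half-width `δ`. -/
theorem ae_curl_winding {δ η : ℝ} (hδ : 0 < δ) (hδ2 : δ ≤ 1 / 2) (hη : 0 < η) (z₀ : R2) :
    ∀ᵐ x : R3, ∀ k ∈ cells η, |offset η z₀ k x| ≤ 1 / 2 →
      partialD 1 (fun x => (windingTwo δ η z₀ x : ℂ)) x -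
        partialD 2 (fun x => (windingOne δ η z₀ x : ℂ)) x =
      ((-(1 / η) * if max |offset η z₀ k x| |height η z₀ x| < δ then 1 / (4 * δ ^ 2) else 0 : ℝ) :
        ℂ) := by
  have hne : ∀ c : ℝ, 0 < c → ∀ᵐ x : R3, ∀ k, |offset η z₀ k x| ≠ c := by
    intro c hc
    rw [ae_all_iff]
    intro k
    filter_upwards [ae_offset_ne hη z₀ k c, ae_offset_ne hη z₀ k (-c)] with x h1 h2 h
    rcases (abs_eq hc.le).1 h with h | h
    · exact h1 h
    · exact h2 h
  have hne' : ∀ c : ℝ, 0 < c → ∀ᵐ x : R3, |height η z₀ x| ≠ c := by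
    intro c hc
    filter_upwards [ae_height_ne hη z₀ c, ae_height_ne hη z₀ (-c)] with x h1 h2 h
    rcases (abs_eq hc.le).1 h with h | h
    · exact h1 h
    · exact h2 h
  filter_upwards [hne δ hδ, hne (1 / 2) (by norm_num), hne' δ hδ, hne' (1 / 2) (by norm_num),
    ae_all_iff.2 fun k => ae_abs_offset_ne_abs_height hη z₀ k,
    (bddLip_windingOne hδ hδ2 hη z₀).ae_differentiableAt,
    (bddLip_windingTwo hδ hδ2 hη z₀).ae_differentiableAt] with x o1 o2 t1 t2 ot d1 d2 k hkc hk
  choose p q hp hq hpq using fun k => exists_hasDerivAt_winding hδ2 (ot k) (o1 k) (o2 k) t1 t2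
  have l1 : ∀ a : ℝ, HasDerivAt (fun t : ℝ => a + t / η) (1 / η) 0 := fun a =>
    ((hasDerivAt_id (0 : ℝ)).div_const η).const_add _
  have l0 : ∀ a : ℝ, a + 0 / η = a := fun a => by rw [zero_div, add_zero]
  have e1 : partialD 1 (fun x => (windingTwo δ η z₀ x : ℂ)) x =
      ((-∑ k ∈ cells η, p k * (1 / η) : ℝ) : ℂ) := by
    refine partialD_eq_of_hasDerivAt d2 (HasDerivAt.ofReal_comp ?_)
    simp only [windingTwo, wireFactor, offset_line_one, height_line_one]
    refine (HasDerivAt.fun_sum fun k _ => ?_).fun_neg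
    have h2 := hp k
    rw [← l0 (offset η z₀ k x)] at h2
    have h3 := h2.comp (0 : ℝ) (l1 (offset η z₀ k x))
    exact h3
  have e2 : partialD 2 (fun x => (windingOne δ η z₀ x : ℂ)) x =
      (((if |height η z₀ x| < 1 / 2 then 1 else 0) * (1 / η) +
        ∑ k ∈ cells η, q k * (1 / η) : ℝ) : ℂ) := by
    refine partialD_eq_of_hasDerivAt d1 (HasDerivAt.ofReal_comp ?_)
    simp only [windingOne, wireFactor, offset_line_two, height_line_two]
    refine HasDerivAt.fun_add ?_ (HasDerivAt.fun_sum fun k _ => ?_)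
    · have h2 : HasDerivAt step (if |height η z₀ x| < 1 / 2 then 1 else 0)
          (height η z₀ x + 0 / η) := by
        rw [l0]; exact hasDerivAt_step t2
      exact HasDerivAt.comp (h₂ := step) (0 : ℝ) h2 (l1 (height η z₀ x))
    · have h2 := hq k
      rw [← l0 (height η z₀ x)] at h2
      have h3 := h2.comp (0 : ℝ) (l1 (height η z₀ x))
      simpa only [l0, Function.comp_def] using h3
  have hsum : ∑ k ∈ cells η, (p k + q k) =
      windingDensity δ (max |offset η z₀ k x| |height η z₀ x|) := by
    simp only [hpq]
    refine sum_offset_eq (cells η) (f := fun t => windingDensity δ (max |t| |height η z₀ x|))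
      (fun t ht => ?_) hk fun h => absurd hkc h
    have h1 : 1 / 2 ≤ max |t| |height η z₀ x| := ht.trans (le_max_left _ _)
    simp only [windingDensity]
    rw [if_neg (not_lt.2 (hδ2.trans h1)), if_neg (not_lt.2 h1), sub_zero]
  have hk' : |offset η z₀ k x| < 1 / 2 := lt_of_le_of_ne hk (o2 k)
  rw [e1, e2, ← Complex.ofReal_sub]
  congr 1
  have e3 : -∑ k ∈ cells η, p k * (1 / η) - ((if |height η z₀ x| < 1 / 2 then 1 else 0) * (1 / η) +
      ∑ k ∈ cells η, q k * (1 / η)) = -(1 / η) * (∑ k ∈ cells η, (p k + q k) +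
        (if |height η z₀ x| < 1 / 2 then 1 else 0)) := by
    rw [← Finset.sum_mul, ← Finset.sum_mul, Finset.sum_add_distrib]; ring
  rw [e3, hsum, windingDensity]
  congr 1
  have h5 : max |offset η z₀ k x| |height η z₀ x| < 1 / 2 ↔ |height η z₀ x| < 1 / 2 := by
    rw [max_lt_iff]; exact ⟨fun h => h.2, fun h => ⟨hk', h⟩⟩
  simp only [h5]
  ring

theorem abs_mul_radialFactor_le {δ : ℝ} (hδ : 0 < δ) (hδ2 : δ ≤ 1 / 2) {a m : ℝ} (ha : |a| ≤ m) :
    |a * radialFactor δ m| ≤ 1 / 8 * (max m δ)⁻¹ := by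
  have h0 : 0 < max m δ := hδ.trans_le (le_max_right _ _)
  have h1 := abs_radialFactor_le hδ hδ2 m
  rw [abs_mul]
  calc |a| * |radialFactor δ m| ≤ max m δ * (1 / 8 * ((max m δ)⁻¹) ^ 2) := by
        gcongr
        exact ha.trans (le_max_left _ _)
    _ = _ := by field_simp

theorem winding_le {δ η : ℝ} (hδ : 0 < δ) (hδ2 : δ ≤ 1 / 2) {z₀ : R2} {x : R3} {k : ℤ}
    (hkc : k ∈ cells η) (hk : |offset η z₀ k x| ≤ 1 / 2) :
    ‖(windingOne δ η z₀ x : ℂ)‖ ≤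
      1 + 1 / 8 * (max (max |offset η z₀ k x| |height η z₀ x|) δ)⁻¹ ∧
    ‖(windingTwo δ η z₀ x : ℂ)‖ ≤
      1 / 8 * (max (max |offset η z₀ k x| |height η z₀ x|) δ)⁻¹ := by
  have hz : ∀ t, 1 / 2 ≤ |t| → radialFactor δ (max |t| |height η z₀ x|) = 0 := fun t ht =>
    radialFactor_eq_zero hδ2 (ht.trans (le_max_left _ _))
  constructor
  · rw [Complex.norm_real, windingOne]
    refine (norm_add_le _ _).trans (add_le_add (norm_step_le _) ?_)
    simp only [wireFactor]
    rw [sum_offset_eq (cells η) (f := fun t => height η z₀ x *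
      radialFactor δ (max |t| |height η z₀ x|)) (fun t ht => by rw [hz t ht, mul_zero]) hk
      fun h => absurd hkc h]
    exact abs_mul_radialFactor_le hδ hδ2 (le_max_right _ _)
  · rw [Complex.norm_real, windingTwo, norm_neg]
    simp only [wireFactor]
    rw [sum_offset_eq (cells η) (f := fun t => t *
      radialFactor δ (max |t| |height η z₀ x|)) (fun t ht => by rw [hz t ht, mul_zero]) hk
      fun h => absurd hkc h]
    exact abs_mul_radialFactor_le hδ hδ2 (le_max_left _ _)

theorem winding_of_height_ge {δ η : ℝ} (hδ2 : δ ≤ 1 / 2) {z₀ : R2} {x : R3}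
    (h : 1 / 2 ≤ |height η z₀ x|) :
    windingOne δ η z₀ x = step (height η z₀ x) ∧ windingTwo δ η z₀ x = 0 := by
  have hz : ∀ k, wireFactor δ η z₀ k x = 0 := fun k =>
    radialFactor_eq_zero hδ2 (h.trans (le_max_right _ _))
  simp [windingOne, windingTwo, hz]

/-! ### Test fields for the electric equation -/

theorem enorm_sq_le_of_norm_le {v : C3} {a b c : ℝ} (h : ‖v‖ ≤ a + b + c) :
    ‖v‖ₑ ^ 2 ≤ ENNReal.ofReal (3 * a ^ 2) +
      (ENNReal.ofReal (3 * b ^ 2) + ENNReal.ofReal (3 * c ^ 2)) := by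
  rw [← ENNReal.ofReal_add (by positivity) (by positivity),
    ← ENNReal.ofReal_add (by positivity) (by positivity), ← ofReal_norm,
    ← ENNReal.ofReal_pow (norm_nonneg _)]
  refine ENNReal.ofReal_le_ofReal ?_
  have h1 : ‖v‖ ^ 2 ≤ (a + b + c) ^ 2 := by gcongr
  nlinarith [sq_nonneg (a - b), sq_nonneg (a - c), sq_nonneg (b - c)]

theorem tendsto_eta_log {η r : ℕ → ℝ} (hη : ∀ n, 0 < η n) (hη0 : Tendsto η atTop (𝓝 0))
    (hr : ∀ n, 0 < r n) (hlog : Tendsto (fun n => η n * |Real.log (r n)|) atTop (𝓝 0)) :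
    Tendsto (fun n => η n * |Real.log (r n / 2)|) atTop (𝓝 0) := by
  have h1 : Tendsto (fun n => η n * |Real.log (r n)| + η n * Real.log 2) atTop (𝓝 0) := by
    simpa using hlog.add (hη0.mul_const (Real.log 2))
  refine squeeze_zero (fun n => mul_nonneg (hη n).le (abs_nonneg _)) (fun n => ?_) h1
  rw [← mul_add, Real.log_div (hr n).ne' two_ne_zero]
  refine mul_le_mul_of_nonneg_left ((abs_sub _ _).trans ?_) (hη n).le
  rw [abs_of_nonneg (Real.log_nonneg one_le_two)]

/-- Strong convergence for corrections supported in the slab that are controlled by the winding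
field and, over the gaps, by its curl. The energy of the former is of order `η |log r|`, that of the
latter of order `η⁻¹ r⁻² |I|`. -/
theorem strongConvL2_of_winding_bound {η : ℕ → ℝ} (hη : ∀ n, 0 < η n)
    (hη0 : Tendsto η atTop (𝓝 0)) {z₀ : R2} (hz : z₀ 0 ∈ Set.Ico (0 : ℝ) 1) {r : ℕ → ℝ}
    (hr : ∀ n, 0 < r n) (hr1 : ∀ n, r n ≤ 1) {I : ℕ → Set ℝ} (hI : ∀ n, IsOpen (I n))
    (hI01 : ∀ n, I n ⊆ Set.Ioo (0 : ℝ) 1)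
    (hlog : Tendsto (fun n => η n * |Real.log (r n)|) atTop (𝓝 0))
    (hgap : Tendsto (fun n => (η n)⁻¹ * (r n ^ 2)⁻¹ * volume.real (I n)) atTop (𝓝 0))
    {g : ℕ → R3 → C3} {g' : R3 → C3} (hg : ∀ n, InL2 Omega (g n)) (hg' : InL2 Omega g')
    {α β γ : ℝ}
    (hin : ∀ n, ∀ᵐ x : R3, x ∈ Omega → ∀ k ∈ cells (η n), |offset (η n) z₀ k x| ≤ 1 / 2 →
      ‖g n x - g' x‖ ≤
        α + β * (max (max |offset (η n) z₀ k x| |height (η n) z₀ x|) (r n / 2))⁻¹ +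
        γ * (1 / (η n * r n ^ 2)) * (gapSet (η n) z₀ (r n / 2) (I n)).indicator 1 x)
    (hout : ∀ n, ∀ᵐ x : R3, x ∈ Omega → x ∉ slab (η n) → g n x = g' x) :
    StrongConvL2 Omega g g' := by
  have hη1 : ∀ᶠ n in atTop, η n ≤ 1 := hη0.eventually_le_const one_pos
  let F₁ : ℕ → R3 → ℝ≥0∞ := fun n => (slab (η n)).indicator fun _ => ENNReal.ofReal (3 * α ^ 2)
  let F₂ : ℕ → R3 → ℝ≥0∞ := fun n x => ENNReal.ofReal (3 * β ^ 2) *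
    ∑ k ∈ cells (η n), energyDensity (r n / 2) (x 1 / η n - (k + z₀ 0)) (x 2 / η n - z₀ 1)
  let F₃ : ℕ → R3 → ℝ≥0∞ := fun n => (gapSet (η n) z₀ (r n / 2) (I n)).indicator
    fun _ => ENNReal.ofReal (3 * (γ * (1 / (η n * r n ^ 2))) ^ 2)
  have hm₁ : ∀ n, Measurable (F₁ n) := fun n => measurable_const.indicator (measurableSet_slab _)
  have hme : ∀ n (k : ℤ), Measurable fun x : R3 =>
      energyDensity (r n / 2) (x 1 / η n - (k + z₀ 0)) (x 2 / η n - z₀ 1) := fun n k =>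
    (measurable_energyDensity (r n / 2)).comp
      (f := fun x : R3 => (x 1 / η n - (k + z₀ 0), x 2 / η n - z₀ 1)) (by fun_prop)
  have hm₂ : ∀ n, Measurable (F₂ n) := fun n =>
    (Finset.measurable_fun_sum _ fun k _ => hme n k).const_mul _
  refine strongConvL2_of_sq_le hg hg' (F := fun n x => F₁ n x + (F₂ n x + F₃ n x))
    (Eventually.of_forall fun n => ?_) ?_
  · rw [ae_restrict_iff' measurableSet_Omega]
    filter_upwards [hin n, hout n, ae_all_iff.2 fun k => ae_offset_ne (hη n) z₀ k (-(1 / 2))]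
      with x hx1 hx2 hx3 hxΩ
    by_cases hs : x ∈ slab (η n)
    · obtain ⟨k, hkc, hk⟩ := exists_mem_cells (hη n) hz hxΩ
      refine (enorm_sq_le_of_norm_le (hx1 hxΩ k hkc hk)).trans ?_
      refine add_le_add ?_ (add_le_add ?_ ?_)
      · simp only [F₁]; rw [Set.indicator_of_mem hs]
      · have hmem : offset (η n) z₀ k x ∈ Set.Ioc (-(1 / 2) : ℝ) (1 / 2) :=
          ⟨lt_of_le_of_ne (abs_le.1 hk).1 (hx3 k).symm, (abs_le.1 hk).2⟩
        have e : ENNReal.ofReal (3 * (β * (max (max |offset (η n) z₀ k x| |height (η n) z₀ x|)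
            (r n / 2))⁻¹) ^ 2) = ENNReal.ofReal (3 * β ^ 2) *
              energyDensity (r n / 2) (offset (η n) z₀ k x) (height (η n) z₀ x) := by
          rw [energyDensity, Set.indicator_of_mem hmem, Pi.one_apply, one_mul,
            ← ENNReal.ofReal_mul (by positivity)]
          congr 1
          rw [mul_pow, inv_pow, one_div, mul_assoc]
        rw [e]
        simp only [F₂]
        gcongr
        exact Finset.single_le_sum (f := fun k : ℤ => energyDensity (r n / 2)
          (x 1 / η n - (k + z₀ 0)) (x 2 / η n - z₀ 1)) (fun _ _ => zero_le) hkc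
      · simp only [F₃]
        by_cases hx : x ∈ gapSet (η n) z₀ (r n / 2) (I n)
        · rw [Set.indicator_of_mem hx, Set.indicator_of_mem hx]; simp
        · rw [Set.indicator_of_notMem hx, Set.indicator_of_notMem hx]; simp
    · rw [hx2 hxΩ hs]; simp
  · have hsplit : ∀ n, ∫⁻ x in Omega, (F₁ n x + (F₂ n x + F₃ n x)) =
        (∫⁻ x in Omega, F₁ n x) + ((∫⁻ x in Omega, F₂ n x) + ∫⁻ x in Omega, F₃ n x) :=
        fun n => by
      rw [lintegral_add_left (hm₁ n), lintegral_add_left (hm₂ n)]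
    have t₁ : Tendsto (fun n => ∫⁻ x in Omega, F₁ n x) atTop (𝓝 0) :=
      tendsto_lintegral_slab hη0 _
    have t₂ : Tendsto (fun n => ∫⁻ x in Omega, F₂ n x) atTop (𝓝 0) := by
      have hl : Tendsto (fun n => ENNReal.ofReal
          (3 * β ^ 2 * (72 * Real.pi) * (η n * |Real.log (r n / 2)|))) atTop (𝓝 0) := by
        have := ENNReal.tendsto_ofReal ((tendsto_eta_log hη hη0 hr hlog).const_mul
          (3 * β ^ 2 * (72 * Real.pi)))
        simpa using this
      refine tendsto_of_tendsto_of_tendsto_of_le_of_le' tendsto_const_nhds hl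
        (Eventually.of_forall fun _ => zero_le) ?_
      filter_upwards [hη1] with n hn
      have hδ : 0 < r n / 2 := half_pos (hr n)
      have hδ2 : r n / 2 ≤ 1 / 2 := by linarith [hr1 n]
      simp only [F₂]
      rw [lintegral_const_mul _ (Finset.measurable_fun_sum _ fun k _ => hme n k),
        lintegral_finsetSum _ fun k _ => hme n k]
      have h1 : ∀ k ∈ cells (η n), ∫⁻ x in Omega, energyDensity (r n / 2)
          (x 1 / η n - (k + z₀ 0)) (x 2 / η n - z₀ 1) ≤
          ENNReal.ofReal (η n ^ 2 * (8 * Real.pi * |Real.log (r n / 2)|)) := fun k _ => by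
        refine (lintegral_Omega_le (hη n) _ _ (measurable_energyDensity _)).trans ?_
        rw [ENNReal.ofReal_mul (by positivity)]
        gcongr
        exact lintegral_energyDensity_le hδ hδ2
      refine (mul_le_mul_right (Finset.sum_le_sum h1) _).trans ?_
      rw [Finset.sum_const, nsmul_eq_mul, ← ENNReal.ofReal_natCast,
        ← ENNReal.ofReal_mul (Nat.cast_nonneg _), ← ENNReal.ofReal_mul (by positivity)]
      refine ENNReal.ofReal_le_ofReal ?_
      have hc := card_cells_le (hη n) hn
      have hηn := hη n
      calc 3 * β ^ 2 * (((cells (η n)).card : ℝ) *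
            (η n ^ 2 * (8 * Real.pi * |Real.log (r n / 2)|)))
          ≤ 3 * β ^ 2 * (9 / η n * (η n ^ 2 * (8 * Real.pi * |Real.log (r n / 2)|))) := by
            gcongr
        _ = _ := by field_simp; ring
    have t₃ : Tendsto (fun n => ∫⁻ x in Omega, F₃ n x) atTop (𝓝 0) := by
      have hl : Tendsto (fun n => ENNReal.ofReal
          (243 * γ ^ 2 * ((η n)⁻¹ * (r n ^ 2)⁻¹ * volume.real (I n)))) atTop (𝓝 0) := by
        have := ENNReal.tendsto_ofReal (hgap.const_mul (243 * γ ^ 2))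
        simpa using this
      refine tendsto_of_tendsto_of_tendsto_of_le_of_le' tendsto_const_nhds hl
        (Eventually.of_forall fun _ => zero_le) ?_
      filter_upwards [hη1] with n hn
      have hδ : 0 < r n / 2 := half_pos (hr n)
      have hηn := hη n
      have hrn := hr n
      have hIfin : volume (I n) ≠ ⊤ :=
        ((measure_mono (hI01 n)).trans_lt (by simp)).ne
      simp only [F₃]
      -- `243 = 3 * 324 / 4`, with `324` from `volume_gapSet_le` at half-width `r / 2`
      refine (lintegral_indicator_const_le _ _).trans ?_
      refine (mul_le_mul_right ((Measure.restrict_apply_le _ _).trans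
        (volume_gapSet_le (hη n) hn z₀ hδ (hI n).measurableSet)) _).trans ?_
      rw [← ofReal_measureReal hIfin, ← ENNReal.ofReal_mul (by positivity),
        ← ENNReal.ofReal_mul (by positivity)]
      refine ENNReal.ofReal_le_ofReal (le_of_eq ?_)
      field_simp
      ring
    simp only [hsplit]
    simpa using t₁.add (t₂.add t₃)

/-- The corrected test field for a limit field that equals `B` below and `B + J` above the layer,
up to the first component, which `B` carries alone: the jump `J₂` is multiplied by the winding field,
the jump `J₃` of the normal component by a step across the layer. -/
def electricTest (δ η : ℝ) (z₀ : R2) (B J : R3 → C3) : R3 → C3 :=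
  vecField (fun x => B x 0) (fun x => B x 1 + windingOne δ η z₀ x * J x 1)
    (fun x => B x 2 + windingTwo δ η z₀ x * J x 1 + (step (height η z₀ x) : ℂ) * J x 2)

theorem bddLip_stepHeight {η : ℝ} (hη : 0 < η) (z₀ : R2) :
    BddLip fun x => (step (height η z₀ x) : ℂ) :=
  (bddLip_step.comp (lipschitzWith_height hη z₀)).ofReal

theorem bddLip_electricTest {δ η : ℝ} (hδ : 0 < δ) (hδ2 : δ ≤ 1 / 2) (hη : 0 < η) (z₀ : R2)
    {B J : R3 → C3} (hB : BddLip B) (hJ : BddLip J) : BddLip (electricTest δ η z₀ B J) :=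
  (hB.coord 0).vecField ((hB.coord 1).add ((bddLip_windingOne hδ hδ2 hη z₀).mul (hJ.coord 1)))
    (((hB.coord 2).add ((bddLip_windingTwo hδ hδ2 hη z₀).mul (hJ.coord 1))).add
      ((bddLip_stepHeight hη z₀).mul (hJ.coord 2)))

/-- The curl of the corrected test field is controlled by the winding field and its curl. The step in
the third component only enters undifferentiated. -/
theorem norm_curl_electricTest_le {δ η : ℝ} (hδ : 0 < δ) (hδ2 : δ ≤ 1 / 2) (hη : 0 < η) (z₀ : R2)
    {B J : R3 → C3} (hB : BddLip B) (hJ : BddLip J) {K : NNReal} {C : ℝ}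
    (hBK : ∀ i, LipschitzWith K fun x => B x i) (hJK : ∀ i, LipschitzWith K fun x => J x i)
    (hJC : ∀ x, ‖J x 1‖ ≤ C) :
    ∀ᵐ x : R3, ∀ a : ℝ, ‖(windingOne δ η z₀ x : ℂ)‖ ≤ 1 + a →
      ‖(windingTwo δ η z₀ x : ℂ)‖ ≤ a →
      ‖curl (electricTest δ η z₀ B J) x‖ ≤ 10 * K + 4 * a * K +
        C * ‖partialD 1 (fun x => (windingTwo δ η z₀ x : ℂ)) x -
          partialD 2 (fun x => (windingOne δ η z₀ x : ℂ)) x‖ := by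
  filter_upwards [(bddLip_windingOne hδ hδ2 hη z₀).ae_differentiableAt,
    (bddLip_windingTwo hδ hδ2 hη z₀).ae_differentiableAt,
    (bddLip_stepHeight hη z₀).ae_differentiableAt,
    (hB.coord 0).ae_differentiableAt, (hB.coord 1).ae_differentiableAt,
    (hB.coord 2).ae_differentiableAt, (hJ.coord 1).ae_differentiableAt,
    (hJ.coord 2).ae_differentiableAt] with x w1 w2 ds b0 b1 b2 j1 j2 a ha1 ha2
  have s0 : partialD 0 (fun x => (step (height η z₀ x) : ℂ)) x = 0 :=
    partialD_eq_zero_of_const (fun x t => by simp only [height_line_zero]) x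
  have s1 : partialD 1 (fun x => (step (height η z₀ x) : ℂ)) x = 0 :=
    partialD_eq_zero_of_const (fun x t => by simp only [height_line_one]) x
  have w10 : partialD 0 (fun x => (windingOne δ η z₀ x : ℂ)) x = 0 :=
    partialD_eq_zero_of_const
      (fun x t => by simp only [windingOne, wireFactor, height_line_zero, offset_line_zero]) x
  have w20 : partialD 0 (fun x => (windingTwo δ η z₀ x : ℂ)) x = 0 :=
    partialD_eq_zero_of_const
      (fun x t => by simp only [windingTwo, wireFactor, height_line_zero, offset_line_zero]) x
  have key : curl (electricTest δ η z₀ B J) x =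
      !₂[partialD 1 (fun x => B x 2) x - partialD 2 (fun x => B x 1) x +
          windingTwo δ η z₀ x * partialD 1 (fun x => J x 1) x +
          step (height η z₀ x) * partialD 1 (fun x => J x 2) x -
          windingOne δ η z₀ x * partialD 2 (fun x => J x 1) x +
          J x 1 * (partialD 1 (fun x => (windingTwo δ η z₀ x : ℂ)) x -
          partialD 2 (fun x => (windingOne δ η z₀ x : ℂ)) x),
        partialD 2 (fun x => B x 0) x - partialD 0 (fun x => B x 2) x -
          windingTwo δ η z₀ x * partialD 0 (fun x => J x 1) x -
          step (height η z₀ x) * partialD 0 (fun x => J x 2) x,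
        partialD 0 (fun x => B x 1) x - partialD 1 (fun x => B x 0) x +
          windingOne δ η z₀ x * partialD 0 (fun x => J x 1) x] := by
    have p1 := w1.fun_mul j1
    have p2 := w2.fun_mul j1
    have p3 := ds.fun_mul j2
    rw [electricTest, curl_vecField b0 (b1.fun_add p1) ((b2.fun_add p2).fun_add p3),
      partialD_add (b2.fun_add p2) p3, partialD_add (b2.fun_add p2) p3, partialD_add b2 p2,
      partialD_add b2 p2, partialD_add b1 p1, partialD_add b1 p1,
      partialD_mul w1 j1, partialD_mul w1 j1, partialD_mul w2 j1, partialD_mul w2 j1,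
      partialD_mul ds j2, partialD_mul ds j2, s0, s1, w10, w20]
    congr 1
    funext i
    fin_cases i
    · simp; ring
    · simp; ring
    · simp; ring
  rw [key]
  have hDB : ∀ j i, ‖partialD j (fun x => B x i) x‖ ≤ K := fun j i =>
    norm_partialD_le_of_lipschitz (hBK i) j x
  have hDJ : ∀ j i, ‖partialD j (fun x => J x i) x‖ ≤ K := fun j i =>
    norm_partialD_le_of_lipschitz (hJK i) j x
  have hs : ‖(step (height η z₀ x) : ℂ)‖ ≤ 1 := by rw [Complex.norm_real]; exact norm_step_le _
  have m1 := fun j i => norm_mul_le_mul ha1 (hDJ j i)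
  have m2 := fun j i => norm_mul_le_mul ha2 (hDJ j i)
  have m3 := fun j i => norm_mul_le_mul hs (hDJ j i)
  have m4 := norm_mul_le_mul (hJC x) (le_refl
    ‖partialD 1 (fun x => (windingTwo δ η z₀ x : ℂ)) x -
          partialD 2 (fun x => (windingOne δ η z₀ x : ℂ)) x‖)
  have two : ∀ j i j' i', ‖partialD j (fun x => B x i) x - partialD j' (fun x => B x i') x‖ ≤
      K + K := fun j i j' i' => (norm_sub_le _ _).trans (add_le_add (hDB j i) (hDB j' i'))
  refine (norm_vec_le (A := K + K + a * K + 1 * K + (1 + a) * K + C *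
    ‖partialD 1 (fun x => (windingTwo δ η z₀ x : ℂ)) x -
          partialD 2 (fun x => (windingOne δ η z₀ x : ℂ)) x‖) (B := K + K + a * K + 1 * K)
    (C := K + K + (1 + a) * K) ?_ ?_ ?_).trans (le_of_eq (by ring))
  · refine (norm_add_le _ _).trans (add_le_add ((norm_sub_le _ _).trans (add_le_add
      ((norm_add_le _ _).trans (add_le_add ((norm_add_le _ _).trans (add_le_add (two 1 2 2 1)
        (m2 1 1))) (m3 1 2))) (m1 2 1))) m4)
  · exact (norm_sub_le _ _).trans (add_le_add ((norm_sub_le _ _).trans (add_le_add (two 2 0 0 2)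
      (m2 0 1))) (m3 0 2))
  · exact (norm_add_le _ _).trans (add_le_add (two 0 1 1 0) (m1 0 1))

theorem ae_fract_ne_zero (η : ℝ) (hη : 0 < η) : ∀ᵐ x : R3, Int.fract (x 0 / η) ≠ 0 := by
  have hT : coordR 0 ≠ 0 := fun h => by
    have := DFunLike.congr_fun h (e3 0)
    simp at this
  filter_upwards [ae_notMem_of_countable (coordR 0) hT
    (Set.countable_range fun k : ℤ => η * k)] with x hx h
  apply hx
  refine ⟨⌊x 0 / η⌋, ?_⟩
  have h1 := Int.floor_add_fract (x 0 / η)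
  rw [h, add_zero] at h1
  simp only [h1, coordR_apply]
  field_simp

/-- In the perforated domain, the curl of the winding field lives over the gaps: its regularization
scale `r / 2` is chosen such that the square tube of half-width `r / 2` fits into the round wire of
radius `r`. -/
theorem norm_curl_winding_le {η r : ℝ} (hr : 0 < r) (hr1 : r ≤ 1) (hη : 0 < η) (z₀ : R2)
    (I : Set ℝ) :
    ∀ᵐ x : R3, x ∈ perforated η (wireObstacle z₀ r I) → ∀ k ∈ cells η,
      |offset η z₀ k x| ≤ 1 / 2 →
      ‖partialD 1 (fun x => (windingTwo (r / 2) η z₀ x : ℂ)) x -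
        partialD 2 (fun x => (windingOne (r / 2) η z₀ x : ℂ)) x‖ ≤
      1 / (η * r ^ 2) * (gapSet η z₀ (r / 2) I).indicator 1 x := by
  filter_upwards [ae_curl_winding (half_pos hr) (by linarith) hη z₀, ae_fract_ne_zero η hη]
    with x hx hf hxU k hkc hk
  rw [hx k hkc hk, Complex.norm_real, norm_mul, norm_neg, Real.norm_of_nonneg (by positivity)]
  by_cases hm : max |offset η z₀ k x| |height η z₀ x| < r / 2
  · have h1 : |offset η z₀ k x| ≤ r / 2 := (le_max_left _ _).trans hm.le
    have h2 : |height η z₀ x| ≤ r / 2 := (le_max_right _ _).trans hm.le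
    have hI : Int.fract (x 0 / η) ∈ I := by
      by_contra h
      exact hxU.2 (mem_inclusion_of_offset_le hη hr hxU.1 h1 h2 h hf)
    have hgap : x ∈ gapSet η z₀ (r / 2) I := ⟨hxU.1, hI, h2, k, hkc, h1⟩
    rw [if_pos hm, Set.indicator_of_mem hgap, Real.norm_of_nonneg (by positivity)]
    refine le_of_eq ?_
    simp only [Pi.one_apply]
    field_simp
    norm_num
  · rw [if_neg hm, norm_zero, mul_zero]
    exact mul_nonneg (by positivity) (Set.indicator_nonneg (fun _ _ => zero_le_one) x)

/-- The projection onto the closed upper half-space. If `P₁ = M₁` on `Γ`, then `(P₁ - M₁) ∘ clip` is a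
Lipschitz function that equals `P₁ - M₁` on `Ω₊` and `0` on `Ω₋`. -/
def clip (x : R3) : R3 := x + (max (x 2) 0 - x 2) • e3 2

theorem exists_lipschitzWith_clip : ∃ K, LipschitzWith K clip := by
  have h1 : LipschitzWith 1 fun x : R3 => x 2 :=
    LipschitzWith.of_dist_le_mul fun x y => by
      rw [NNReal.coe_one, one_mul, Real.dist_eq]; exact dist_coord_le x y 2
  have h2 : LipschitzWith (1 + 1) fun x : R3 => max (x 2) 0 - x 2 := (h1.max_const 0).sub h1
  have h3 : LipschitzWith (‖e3 2‖₊ * (1 + 1)) fun x : R3 => (max (x 2) 0 - x 2) • e3 2 :=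
    LipschitzWith.of_dist_le_mul fun x y => by
      rw [dist_eq_norm, ← sub_smul, norm_smul, ← dist_eq_norm, mul_comm, NNReal.coe_mul, mul_assoc]
      gcongr
      · rfl
      · exact h2.dist_le_mul x y
  exact ⟨_, LipschitzWith.id.add h3⟩

theorem clip_of_nonneg {x : R3} (h : 0 ≤ x 2) : clip x = x := by
  rw [clip, max_eq_left h, sub_self, zero_smul, add_zero]

theorem clip_mem_Gam {x : R3} (hx : x ∈ Omega) (h : x 2 ≤ 0) : clip x ∈ Gam := by
  have e : clip x = x + (-x 2) • e3 2 := by rw [clip, max_eq_right h, zero_sub]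
  rw [e]
  exact ⟨by simpa using hx.1, by simpa using hx.2.1, by simp⟩

/-- The field equal to `P` above and to `M` below the plane `x₃ = 0`. -/
def glue (P M : R3 → C3) (x : R3) : C3 := if 0 < x 2 then P x else M x

theorem glue_eventuallyEq_of_pos {P M : R3 → C3} {x : R3} (h : 0 < x 2) :
    glue P M =ᶠ[𝓝 x] P := by
  filter_upwards [((continuous_coord 2).tendsto x).eventually_const_lt h] with y hy
  rw [glue, if_pos hy]

theorem glue_eventuallyEq_of_neg {P M : R3 → C3} {x : R3} (h : x 2 < 0) :
    glue P M =ᶠ[𝓝 x] M := by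
  filter_upwards [((continuous_coord 2).tendsto x).eventually_lt_const h] with y hy
  rw [glue, if_neg (not_lt.2 (le_of_lt hy))]

theorem ae_coord_two_ne_zero : ∀ᵐ x : R3, x 2 ≠ 0 := by
  have hT : coordR 2 ≠ 0 := fun h => by
    have := DFunLike.congr_fun h (e3 2)
    simp at this
  filter_upwards [ae_notMem_of_countable (coordR 2) hT (Set.countable_singleton 0)] with x hx
  simpa using hx

/-- Outside of the slab no correction is made. -/
theorem electricTest_eq_glue {δ η : ℝ} (hδ2 : δ ≤ 1 / 2) (hη : 0 < η) {z₀ : R2}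
    (hz : z₀ 1 ∈ Set.Ioo (0 : ℝ) 1) {P M : R3 → C3} (hPM : ∀ x ∈ Gam, P x 0 = M x 0) {x : R3}
    (hx : x ∈ Omega) (hs : x ∉ slab η) :
    electricTest δ η z₀
      (fun x => M x + (P (clip x) 0 - M (clip x) 0) • (EuclideanSpace.single 0 1 : C3))
      (fun x => P x - M x) x = glue P M x := by
  have hh := height_ge_of_notMem_slab hη hz hs
  obtain ⟨h1, h2⟩ := winding_of_height_ge hδ2 (show 1 / 2 ≤ |height η z₀ x| by linarith)
  have hs' : 3 * η < |x 2| := not_le.1 hs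
  rcases lt_or_ge 0 (x 2) with hp | hn
  · have hst : step (height η z₀ x) = 1 := by
      refine step_of_ge ?_
      have : 3 < x 2 / η := by rw [lt_div_iff₀ hη]; rwa [abs_of_pos hp] at hs'
      rw [height]; linarith [hz.2]
    rw [glue, if_pos hp]
    ext i
    fin_cases i <;> simp [electricTest, vecField, h1, h2, hst, clip_of_nonneg hp.le]
  · have hst : step (height η z₀ x) = 0 := by
      refine step_of_le ?_
      have : x 2 / η ≤ 0 := div_nonpos_of_nonpos_of_nonneg hn hη.le
      have h3 : x 2 / η < -3 := by
        rw [div_lt_iff₀ hη]; rw [abs_of_nonpos hn] at hs'; linarith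
      rw [height]; linarith [hz.1]
    rw [glue, if_neg (not_lt.2 hn)]
    ext i
    fin_cases i <;>
      simp [electricTest, vecField, h1, h2, hst, hPM _ (clip_mem_Gam hx hn)]

theorem BddLip.exists_lipschitz_coord {u : R3 → C3} (hu : BddLip u) :
    ∃ K : NNReal, ∀ i, LipschitzWith K fun x => u x i := by
  obtain ⟨K, hK⟩ := hu.lip
  exact ⟨∑ i, ‖coordC i‖₊ * K, fun i => ((coordC i).lipschitz.comp hK).weaken
    (Finset.single_le_sum (f := fun i => ‖coordC i‖₊ * K) (fun _ _ => by simp)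
      (Finset.mem_univ i))⟩

/-- Test fields in the perforated domains that converge strongly, together with their curls, to a
field whose second and third components may jump across `Γ`. -/
theorem exists_electric_test_fields {η : ℕ → ℝ} (hη : ∀ n, 0 < η n) (hη0 : Tendsto η atTop (𝓝 0))
    {z₀ : R2} {R : ℝ} (hR : Metric.closedBall z₀ R ⊆ crossSection) {r : ℕ → ℝ}
    (hr : ∀ n, 0 < r n) (hrR : ∀ n, r n ≤ R) {I : ℕ → Set ℝ} (hI : ∀ n, IsOpen (I n))
    (hI01 : ∀ n, I n ⊆ Set.Ioo (0 : ℝ) 1)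
    (hlog : Tendsto (fun n => η n * |Real.log (r n)|) atTop (𝓝 0))
    (hgap : Tendsto (fun n => (η n)⁻¹ * (r n ^ 2)⁻¹ * volume.real (I n)) atTop (𝓝 0))
    {P M : R3 → C3} (hP : BddLip P) (hM : BddLip M) (hPM : ∀ x ∈ Gam, P x 0 = M x 0) :
    ∃ ψ : ℕ → R3 → C3,
      (∀ n, InHCurl (perforated (η n) (wireObstacle z₀ (r n) (I n))) (ψ n) (curl (ψ n))) ∧
      StrongConvL2 Omega
        (fun n => (perforated (η n) (wireObstacle z₀ (r n) (I n))).indicator (ψ n)) (glue P M) ∧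
      StrongConvL2 Omega
        (fun n => (perforated (η n) (wireObstacle z₀ (r n) (I n))).indicator (curl (ψ n)))
        (curl (glue P M)) := by
  have hR0 : 0 < R := (hr 0).trans_le (hrR 0)
  obtain ⟨⟨b1, b2⟩, b3, b4⟩ := disc_bounds hR hR0
  have hz0 : z₀ 0 ∈ Set.Ico (0 : ℝ) 1 := ⟨by linarith, by linarith⟩
  have hz1 : z₀ 1 ∈ Set.Ioo (0 : ℝ) 1 := ⟨by linarith, by linarith⟩
  have hr1 : ∀ n, r n ≤ 1 := fun n => (hrR n).trans (by linarith)
  have hδ : ∀ n, 0 < r n / 2 := fun n => half_pos (hr n)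
  have hδ2 : ∀ n, r n / 2 ≤ 1 / 2 := fun n => by linarith [hr1 n]
  set U : ℕ → Set R3 := fun n => perforated (η n) (wireObstacle z₀ (r n) (I n)) with hUdef
  have hUm : ∀ n, MeasurableSet (U n) := fun n =>
    measurableSet_perforated (hη n).ne' isClosed_closure
  have hUΩ : ∀ n, U n ⊆ Omega := fun n => perforated_subset _ _
  obtain ⟨Kc, hKc⟩ := exists_lipschitzWith_clip
  set B : R3 → C3 := fun x =>
    M x + (P (clip x) 0 - M (clip x) 0) • (EuclideanSpace.single 0 1 : C3) with hBdef
  set J : R3 → C3 := fun x => P x - M x with hJdef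
  have hB : BddLip B := hM.add ((((hP.comp hKc).coord 0).sub ((hM.comp hKc).coord 0)).smul
    (BddLip.const _))
  have hJ : BddLip J := hP.sub hM
  set ψ : ℕ → R3 → C3 := fun n => electricTest (r n / 2) (η n) z₀ B J with hψdef
  have hψ : ∀ n, BddLip (ψ n) := fun n => bddLip_electricTest (hδ n) (hδ2 n) (hη n) z₀ hB hJ
  obtain ⟨CB, hCB⟩ := hB.bdd
  obtain ⟨CJ, hCJ⟩ := hJ.bdd
  obtain ⟨CP, hCP⟩ := hP.bdd
  obtain ⟨CM, hCM⟩ := hM.bdd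
  obtain ⟨KP, hKP⟩ := hP.lip
  obtain ⟨KM, hKM⟩ := hM.lip
  obtain ⟨KB, hKB⟩ := hB.exists_lipschitz_coord
  obtain ⟨KJ, hKJ⟩ := hJ.exists_lipschitz_coord
  have hCP0 : 0 ≤ CP := (norm_nonneg _).trans (hCP 0)
  have hCM0 : 0 ≤ CM := (norm_nonneg _).trans (hCM 0)
  have hCB0 : 0 ≤ CB := (norm_nonneg _).trans (hCB 0)
  have hCJ0 : 0 ≤ CJ := (norm_nonneg _).trans (hCJ 0)
  have hglue : ∀ x, ‖glue P M x‖ ≤ CP + CM := fun x => by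
    rw [glue]
    split_ifs
    · linarith [hCP x]
    · linarith [hCM x]
  have hglueL2 : InL2 Omega (glue P M) :=
    memLp_of_bounded volume_Omega_ne_top (Measurable.aestronglyMeasurable
      (Measurable.ite (measurableSet_lt measurable_const (measurable_coord 2))
        hP.continuous.measurable hM.continuous.measurable)) (fun x _ => hglue x) measurableSet_Omega
  have hcglue : ∀ᵐ x : R3, ‖curl (glue P M) x‖ ≤ 6 * KP + 6 * KM := by
    filter_upwards [ae_coord_two_ne_zero] with x hx
    rcases lt_or_gt_of_ne hx with h | h
    · rw [curl_congr (glue_eventuallyEq_of_neg h)]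
      exact (norm_curl_le_of_lipschitz hKM x).trans (by simp)
    · rw [curl_congr (glue_eventuallyEq_of_pos h)]
      exact (norm_curl_le_of_lipschitz hKP x).trans (by simp)
  have hcglueL2 : InL2 Omega (curl (glue P M)) := by
    have : IsFiniteMeasure (volume.restrict Omega) := ⟨by simpa using volume_Omega_ne_top.lt_top⟩
    exact MemLp.of_bound (measurable_curl _).aestronglyMeasurable _ (ae_restrict_of_ae hcglue)
  have hmemU : ∀ n x, x ∈ Omega → x ∉ slab (η n) → x ∈ U n := fun n x hx hs =>
    ⟨hx, fun h => hs (inclusion_subset_slab (hη n) hz1 (hr1 n) h)⟩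
  have hmax : ∀ n k x, 0 ≤ (max (max |offset (η n) z₀ k x| |height (η n) z₀ x|) (r n / 2))⁻¹ :=
    fun n k x => inv_nonneg.2 ((hδ n).le.trans (le_max_right _ _))
  refine ⟨ψ, fun n => inHCurl_of_bddLip (isBounded_Omega.subset (hUΩ n)).measure_lt_top.ne
    (hUm n) (hψ n), ?_, ?_⟩
  · refine strongConvL2_of_winding_bound hη hη0 hz0 hr hr1 hI hI01 hlog hgap
      (α := 3 * CB + 2 * CJ + (CP + CM)) (β := CJ) (γ := 0)
      (fun n => MemLp.indicator (hUm n) (inL2_Omega_of_bddLip (hψ n))) hglueL2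
      (fun n => ae_of_all _ fun x _ k hkc hk => ?_)
      (fun n => ae_of_all _ fun x hx hs => ?_)
    · obtain ⟨hw1, hw2⟩ := winding_le (hδ n) (hδ2 n) hkc hk
      have hm := hmax n k x
      set a := (max (max |offset (η n) z₀ k x| |height (η n) z₀ x|) (r n / 2))⁻¹
      have cB := fun i => (norm_coord_le (B x) i).trans (hCB x)
      have cJ := fun i => (norm_coord_le (J x) i).trans (hCJ x)
      have hs : ‖(step (height (η n) z₀ x) : ℂ)‖ ≤ 1 := by
        rw [Complex.norm_real]; exact norm_step_le _
      have h1 : ‖ψ n x‖ ≤ CB + (CB + (1 + 1 / 8 * a) * CJ) + (CB + 1 / 8 * a * CJ + 1 * CJ) :=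
        norm_vec_le (cB 0) ((norm_add_le _ _).trans (add_le_add (cB 1)
          (norm_mul_le_mul hw1 (cJ 1))))
          ((norm_add_le _ _).trans (add_le_add ((norm_add_le _ _).trans (add_le_add (cB 2)
            (norm_mul_le_mul hw2 (cJ 1)))) (norm_mul_le_mul hs (cJ 2))))
      have h2 := (norm_sub_le ((U n).indicator (ψ n) x) (glue P M x)).trans
        (add_le_add ((norm_indicator_le_norm_self (ψ n) x).trans h1) (hglue x))
      refine h2.trans ?_
      nlinarith [mul_nonneg hm hCJ0]
    · rw [Set.indicator_of_mem (hmemU n x hx hs)]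
      exact electricTest_eq_glue (hδ2 n) (hη n) hz1 hPM hx hs
  · set K : NNReal := KB + KJ with hKdef
    have hBK : ∀ i, LipschitzWith K fun x => B x i := fun i => (hKB i).weaken (by simp [hKdef])
    have hJK : ∀ i, LipschitzWith K fun x => J x i := fun i => (hKJ i).weaken (by simp [hKdef])
    refine strongConvL2_of_winding_bound hη hη0 hz0 hr hr1 hI hI01 hlog hgap
      (α := 10 * K + (6 * KP + 6 * KM)) (β := K) (γ := CJ)
      (fun n => MemLp.indicator (hUm n) (inL2_Omega_curl_of_bddLip (hψ n))) hcglueL2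
      (fun n => ?_) (fun n => ae_of_all _ fun x hx hs => ?_)
    · filter_upwards [hcglue, norm_curl_electricTest_le (hδ n) (hδ2 n) (hη n) z₀ hB hJ hBK hJK
        (fun x => (norm_coord_le (J x) 1).trans (hCJ x)),
        norm_curl_winding_le (hr n) (hr1 n) (hη n) z₀ (I n)] with x c1 c2 c3 hxΩ k hkc hk
      obtain ⟨hw1, hw2⟩ := winding_le (hδ n) (hδ2 n) hkc hk
      have h2 := c2 _ hw1 hw2
      have hm := hmax n k x
      have hηn := hη n
      have hrn := hr n
      have hgi : 0 ≤ 1 / (η n * r n ^ 2) *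
          (gapSet (η n) z₀ (r n / 2) (I n)).indicator (1 : R3 → ℝ) x :=
        mul_nonneg (by positivity) (Set.indicator_nonneg (fun _ _ => zero_le_one) x)
      have hK0 : (0 : ℝ) ≤ K := K.coe_nonneg
      refine (norm_sub_le _ _).trans ?_
      by_cases hxU : x ∈ U n
      · have h3 := mul_le_mul_of_nonneg_left (c3 hxU k hkc hk) hCJ0
        rw [Set.indicator_of_mem hxU]
        nlinarith [mul_nonneg hm hK0]
      · rw [Set.indicator_of_notMem hxU, norm_zero, zero_add]
        have h4 := mul_nonneg hK0 hm
        have h5 := mul_nonneg hCJ0 hgi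
        rw [mul_assoc CJ]
        linarith
    · rw [Set.indicator_of_mem (hmemU n x hx hs)]
      refine curl_congr ?_
      filter_upwards [(isClosed_slab (η n)).isOpen_compl.mem_nhds hs,
        isOpen_Omega.mem_nhds hx] with y hy hyΩ
      exact electricTest_eq_glue (hδ2 n) (hη n) hz1 hPM hyΩ hy

/-! ### The limit test fields -/

theorem mem_closure_half {x : R3} (hx : x ∈ Gam) :
    x ∈ closure OmegaPlus ∧ x ∈ closure OmegaMinus := by
  have hc : Tendsto (fun t : ℝ => x + t • e3 2) (𝓝 0) (𝓝 x) := by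
    have : Continuous fun t : ℝ => x + t • e3 2 := by fun_prop
    simpa using this.tendsto 0
  constructor
  · refine mem_closure_of_tendsto (hc.mono_left (nhdsWithin_le_nhds (s := Set.Ioi 0))) ?_
    filter_upwards [Ioo_mem_nhdsGT (zero_lt_one (α := ℝ))] with t ht
    exact ⟨by simpa using hx.1, by simpa using hx.2.1, by simpa [hx.2.2] using ht⟩
  · refine mem_closure_of_tendsto (hc.mono_left (nhdsWithin_le_nhds (s := Set.Iio 0))) ?_
    filter_upwards [Ioo_mem_nhdsLT (show (-1 : ℝ) < 0 by norm_num)] with t ht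
    exact ⟨by simpa using hx.1, by simpa using hx.2.1, by simpa [hx.2.2] using ht⟩

theorem MemY.trace_eq {ψ P M : R3 → C3} (hψ : MemY 0 ψ) (hP : Continuous P) (hM : Continuous M)
    (hPψ : Set.EqOn P ψ OmegaPlus) (hMψ : Set.EqOn M ψ OmegaMinus) {x : R3} (hx : x ∈ Gam) :
    P x 0 = M x 0 := by
  obtain ⟨c, h1, h2⟩ := hψ.no_jump x hx
  obtain ⟨n1, n2⟩ := mem_closure_half hx
  have : (𝓝[OmegaPlus] x).NeBot := mem_closure_iff_nhdsWithin_neBot.1 n1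
  have : (𝓝[OmegaMinus] x).NeBot := mem_closure_iff_nhdsWithin_neBot.1 n2
  have cP : Continuous fun y => P y 0 := (coordC 0).continuous.comp hP
  have cM : Continuous fun y => M y 0 := (coordC 0).continuous.comp hM
  have e1 : P x 0 = c := by
    refine tendsto_nhds_unique ((cP.tendsto x).mono_left nhdsWithin_le_nhds) (h1.congr' ?_)
    filter_upwards [self_mem_nhdsWithin] with y hy
    rw [hPψ hy]
  have e2 : M x 0 = c := by
    refine tendsto_nhds_unique ((cM.tendsto x).mono_left nhdsWithin_le_nhds) (h2.congr' ?_)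
    filter_upwards [self_mem_nhdsWithin] with y hy
    rw [hMψ hy]
  rw [e1, e2]

theorem volume_Gam : volume Gam = 0 := by
  have h := ae_coord_two_ne_zero
  rw [ae_iff] at h
  refine measure_mono_null (fun x hx => ?_) h
  simpa using hx.2.2

theorem setIntegral_Omega_diff_Gam (f : R3 → ℂ) : ∫ x in Omega \ Gam, f x = ∫ x in Omega, f x :=
  setIntegral_congr_set (sdiff_null_ae_eq_self volume_Gam)

theorem eventuallyEq_glue {ψ P M : R3 → C3} (hPψ : Set.EqOn P ψ OmegaPlus)
    (hMψ : Set.EqOn M ψ OmegaMinus) {x : R3} (hx : x ∈ Omega) (h0 : x 2 ≠ 0) :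
    ψ =ᶠ[𝓝 x] glue P M := by
  rcases lt_or_gt_of_ne h0 with h | h
  · have hm : x ∈ OmegaMinus := ⟨hx.1, hx.2.1, hx.2.2.1, h⟩
    filter_upwards [isOpen_OmegaMinus.mem_nhds hm] with y hy
    rw [glue, if_neg (not_lt.2 hy.2.2.2.le), hMψ hy]
  · have hm : x ∈ OmegaPlus := ⟨hx.1, hx.2.1, h, hx.2.2.2⟩
    filter_upwards [isOpen_OmegaPlus.mem_nhds hm] with y hy
    rw [glue, if_pos hy.2.2.1, hPψ hy]

/-- Fields in `X₁` are `O(|x₃|)` in the first component: compare with the projection of `x` to `Γ`. -/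
theorem MemX.norm_le {φ : R3 → C3} (hφ : MemX 0 φ) :
    ∃ L : ℝ, ∀ x ∈ Omega, ‖Omega.indicator φ x 0‖ ≤ L * |x 2| := by
  obtain ⟨K, hK⟩ := hφ.toMemXMinus.bddLip_indicator.lip
  refine ⟨K, fun x hx => ?_⟩
  have hy : x + (-x 2) • e3 2 ∈ Gam := ⟨by simpa using hx.1, by simpa using hx.2.1, by simp⟩
  have hyΩ : x + (-x 2) • e3 2 ∈ Omega := ⟨hy.1, hy.2.1, by rw [hy.2.2]; norm_num⟩
  have h1 := hK.dist_le_mul x (x + (-x 2) • e3 2)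
  have h2 : dist x (x + (-x 2) • e3 2) = |x 2| := by
    rw [dist_self_add_right, norm_smul]; simp
  rw [h2, dist_eq_norm] at h1
  have h3 := (norm_coord_le _ 0).trans h1
  have h4 : Omega.indicator φ (x + (-x 2) • e3 2) 0 = 0 := by
    rw [Set.indicator_of_mem hyΩ]; exact hφ.interface _ hy
  rwa [PiLp.sub_apply, h4, sub_zero] at h3

end MaxwellWires

end

theorem theorem2p4
    -- frequency, coefficients and right-hand sides
    (ω : ℝ) (hω : 0 < ω) (μ ε : ℂ)
    (fh fe : MaxwellWires.R3 → MaxwellWires.C3)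
    (hfh : MaxwellWires.InL2 MaxwellWires.Omega fh)
    (hfe : MaxwellWires.InL2 MaxwellWires.Omega fe)
    -- the periodicity
    (η : ℕ → ℝ) (hη : ∀ n, 0 < η n) (hη0 : Tendsto η atTop (𝓝 0))
    -- centre, radii and gaps of the wires
    (z₀ : MaxwellWires.R2) (R : ℝ)
    (hR : Metric.closedBall z₀ R ⊆ MaxwellWires.crossSection)
    (r : ℕ → ℝ) (hr : ∀ n, 0 < r n) (hrR : ∀ n, r n ≤ R)
    (I : ℕ → Set ℝ) (hI : ∀ n, IsOpen (I n)) (hI01 : ∀ n, I n ⊆ Set.Ioo (0 : ℝ) 1)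
    (hlog : Tendsto (fun n => η n * |Real.log (r n)|) atTop (𝓝 0))
    (hgap : Tendsto (fun n => (η n)⁻¹ * (r n ^ 2)⁻¹ * volume.real (I n)) atTop (𝓝 0))
    -- solutions in the perforated domains, and the weak limits of their trivial extensions
    (E H : ℕ → MaxwellWires.R3 → MaxwellWires.C3)
    (hsol : ∀ n, MaxwellWires.IsMaxwellSolution
      (MaxwellWires.perforated (η n) (MaxwellWires.wireObstacle z₀ (r n) (I n))) ω μ ε fh fe (E n) (H n))
    (Ehom Hhom : MaxwellWires.R3 → MaxwellWires.C3)
    (hE : MaxwellWires.WeakConvL2 MaxwellWires.Omega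
      (fun n =>
        (MaxwellWires.perforated (η n) (MaxwellWires.wireObstacle z₀ (r n) (I n))).indicator (E n)) Ehom)
    (hH : MaxwellWires.WeakConvL2 MaxwellWires.Omega
      (fun n =>
        (MaxwellWires.perforated (η n) (MaxwellWires.wireObstacle z₀ (r n) (I n))).indicator (H n)) Hhom) :
    MaxwellWires.IsPolarizingSolution 0 ω μ ε fh fe Ehom Hhom := by
  have hUm : ∀ n, MeasurableSet (MaxwellWires.perforated (η n)
      (MaxwellWires.wireObstacle z₀ (r n) (I n))) := fun n =>
    MaxwellWires.measurableSet_perforated (hη n).ne' isClosed_closure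
  have hUΩ : ∀ n, MaxwellWires.perforated (η n) (MaxwellWires.wireObstacle z₀ (r n) (I n)) ⊆
      MaxwellWires.Omega := fun n => MaxwellWires.perforated_subset _ _
  refine ⟨hE.limit_memL2, hH.limit_memL2, fun ψ hψ => ?_, fun φ hφ => ?_⟩
  · obtain ⟨P, hP, hPψ⟩ := hψ.isC1_plus.exists_bddLip MaxwellWires.isOpen_OmegaPlus
      MaxwellWires.convex_OmegaPlus MaxwellWires.OmegaPlus_subset
    obtain ⟨M, hM, hMψ⟩ := hψ.isC1_minus.exists_bddLip MaxwellWires.isOpen_OmegaMinus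
      MaxwellWires.convex_OmegaMinus MaxwellWires.OmegaMinus_subset
    obtain ⟨ψn, h, hs, hc⟩ := MaxwellWires.exists_electric_test_fields hη hη0 hR hr hrR hI hI01
      hlog hgap hP hM fun x hx =>
        MaxwellWires.MemY.trace_eq hψ hP.continuous hM.continuous hPψ hMψ hx
    have key := MaxwellWires.integral_eq_of_strong_test_fields hUm hUΩ (Complex.I * ω * μ) hfh
      hE hH hs hc fun n => (hsol n).eq_E _ _ (h n)
    rw [MaxwellWires.setIntegral_Omega_diff_Gam, MaxwellWires.setIntegral_Omega_diff_Gam]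
    have hae : ∀ᵐ x, x ∈ MaxwellWires.Omega → ψ =ᶠ[𝓝 x] MaxwellWires.glue P M := by
      filter_upwards [MaxwellWires.ae_coord_two_ne_zero] with x hx hxΩ
      exact MaxwellWires.eventuallyEq_glue hPψ hMψ hxΩ hx
    refine (setIntegral_congr_ae MaxwellWires.measurableSet_Omega ?_).trans (key.trans
      (setIntegral_congr_ae MaxwellWires.measurableSet_Omega ?_))
    · filter_upwards [hae] with x hx hxΩ
      rw [MaxwellWires.curl_congr (hx hxΩ)]
    · filter_upwards [hae] with x hx hxΩ
      rw [(hx hxΩ).self_of_nhds]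
  · obtain ⟨L, hL⟩ := hφ.norm_le
    obtain ⟨φn, h, hs, hc⟩ := MaxwellWires.exists_magnetic_test_fields hη hη0 hR hr hrR I
      hφ.toMemXMinus.bddLip_indicator (fun x hx => Set.indicator_of_notMem hx φ) hL
    have key := MaxwellWires.integral_eq_of_strong_test_fields hUm hUΩ (-(Complex.I * ω * ε)) hfe
      hH hE hs hc fun n => (hsol n).eq_H _ _ (h n)
    have hev : ∀ x ∈ MaxwellWires.Omega, φ =ᶠ[𝓝 x] MaxwellWires.Omega.indicator φ := fun x hx => by
      filter_upwards [MaxwellWires.isOpen_Omega.mem_nhds hx] with y hy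
      rw [Set.indicator_of_mem hy]
    refine (setIntegral_congr_fun MaxwellWires.measurableSet_Omega fun x hx => ?_).trans (key.trans
      (setIntegral_congr_fun MaxwellWires.measurableSet_Omega fun x hx => ?_))
    · simp only [MaxwellWires.curl_congr (hev x hx)]
    · simp only [Set.indicator_of_mem hx]
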